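/- **Theorem 1.7.** Let $N$ be a free abelian group of finite rank and let $\Sigma$ be a rational fan in $N_{\mathbb R}=N\otimes\mathbb R$ (a finite collection of strictly convex rational polyhedral cones closed under taking faces, any two of which meet in a common face). Write $|\sigma|$ for the dimension of a cone $\sigma$, $N_\sigma=N\cap\operatorname{span}_{\mathbb R}\sigma$, $N^\tau=N/N_\tau$, and $N^\tau_\sigma=N_\sigma/N_\tau\subseteq N^\tau$ for $\tau\subseteq\sigma$ in $\Sigma$. The canonical compactification $\overline\Sigma$ has as faces the cubes $\square^\tau_\sigma$, $\tau\subseteq\sigma$ in $\Sigma$, of dimension $|\sigma|-|\tau|$, where $\square^\tau_\sigma$ is a face of $\square^{\tau'}_{\sigma'}$ if and only if $\tau'\subseteq\tau\subseteq\sigma\subseteq\sigma'$; we write $\infty_\sigma=\square^\sigma_\sigma$. For $R\in\{\mathbb Z,\mathbb Q\}$ and $k\ge 0$ put $$F_k(\square^\tau_\sigma)=\sum_{\eta\in\Sigma,\ \eta\supseteq\sigma}\textstyle\bigwedge^k N^\tau_\eta\subseteq\bigwedge^kN^\tau,\qquad F^k(\square^\tau_\sigma,R)=\operatorname{Hom}_{\mathbb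 Z}(F_k(\square^\tau_\sigma),R),$$ and $F_k=F^k=0$ for $k<0$. *Tropical cohomology.* Fix for each face $\delta=\square^\tau_\sigma$ a generator $\nu_\delta$ of $\bigwedge^{|\sigma|-|\tau|}N^\tau_\sigma$, with dual form $\varpi_\delta$. For $\tau\subset\sigma$ of codimension one, let $e^\tau_\sigma$ be the generator of $N^\tau_\sigma$ lying in the image of $\sigma$. Let $C^{p,q}(\overline\Sigma,R)=\bigoplus_{\dim\delta=q}F^p(\delta,R)$, with differential the sum, over all faces $\gamma$ of codimension one in a face $\delta$, of $\operatorname{sign}(\gamma,\delta)$ times the map $F^p(\gamma,R)\to F^p(\delta,R)$ dual to the map $F_p(\delta)\to F_p(\gamma)$ given by projection and inclusion. Here, if $\gamma=\square^\tau_{\sigma'}$ and $\delta=\square^\tau_\sigma$, then $\operatorname{sign}(\gamma,\delta)$ is the sign of $\varpi_\delta(n\wedge\nu_\gamma)$, with $n\in N^\tau_\sigma$ any lift of $e^{\sigma'}_\sigma$; and if $\gamma=\square^\tau_\sigma$ and $\delta=\square^{\tau'}_\sigma$, it is the sign of $-\varpi_\delta(e^{\tau'}_\tau\wedge\nu')$,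 with $\nu'$ any lift of $\nu_\gamma$ to $\bigwedge^\bullet N^{\tau'}_\sigma$. The tropical cohomology $H^{p,q}(\overline\Sigma,R)$ is the cohomology in degree $q$ of $C^{p,\bullet}(\overline\Sigma,R)$. *Cubical complex.* For $p,q\ge0$ let $$\mathcal C^{p,q}(\overline\Sigma,R)=\bigoplus_{\sigma\in\Sigma,\ |\sigma|=q}F^{p-q}(\infty_\sigma,R),$$ with differential $\partial^q$ the sum, over all pairs $\tau\subset\sigma$ in $\Sigma$ with $|\sigma|=|\tau|+1=q+1$, of the maps $F^{k}(\infty_\tau,R)\to F^{k-1}(\infty_\sigma,R)$, $k=p-q$, given by contraction with $e^\tau_\sigma$ followed by projection: $\alpha\in F^k(\infty_\tau,R)$ is sent to the form $x\mapsto\alpha(e^\tau_\sigma\wedge\tilde x)$, where $\tilde x$ is any lift of $x\in F_{k-1}(\infty_\sigma)$ to $F_{k-1}(\square^\tau_\sigma)$. If $\Sigma$ is unimodular (each cone is generated by a part of a basis of $N$), then for every $p\ge 0$ both $(\mathcal C^{p,\bullet}(\overline\Sigma,\mathbb Z),\partial)$ and $C^{p,\bullet}(\overline\Sigma,\mathbb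 Z)$ are cochain complexes, and for every $q\geq 0$ $$H^q\bigl(\mathcal C^{p,\bullet}(\overline\Sigma,\mathbb Z),\partial\bigr)\cong H^{p,q}(\overline\Sigma,\mathbb Z).$$ If $\Sigma$ is only assumed to be simplicial (each cone is generated by as many rays as its dimension), the same holds with $\mathbb Q$ in place of $\mathbb Z$. -/

import Mathlib

open scoped TensorProduct

noncomputable section

namespace TropicalFan

/-! ## Cones, fans and lattices -/

/-- Convex cones (containing the origin) in the real vector space `N_ℝ = ℝ ⊗ N`. -/
abbrev Cone (N : Type*) [AddCommGroup N] := PointedCone ℝ (ℝ ⊗[ℤ] N)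

/-- The dimension of a cone: the dimension of its linear span `N_{σ,ℝ}`. -/
def coneDim {N : Type*} [AddCommGroup N] (σ : Cone N) : ℕ :=
  Module.finrank ℝ (Submodule.span ℝ (σ : Set (ℝ ⊗[ℤ] N)))

/-- The lattice `N_σ = N ∩ N_{σ,ℝ}`. -/
def coneLattice {N : Type*} [AddCommGroup N] (σ : Cone N) : Submodule ℤ N where
  carrier := {n | (1 : ℝ) ⊗ₜ[ℤ] n ∈ Submodule.span ℝ (σ : Set (ℝ ⊗[ℤ] N))}
  add_mem' {a b} ha hb := by
    rw [Set.mem_ofPred_eq] at ha hb ⊢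
    rw [TensorProduct.tmul_add]
    exact Submodule.add_mem _ ha hb
  zero_mem' := by
    rw [Set.mem_ofPred_eq, TensorProduct.tmul_zero]
    exact Submodule.zero_mem _
  smul_mem' c a ha := by
    rw [Set.mem_ofPred_eq] at ha ⊢
    rw [TensorProduct.tmul_smul]
    exact zsmul_mem ha c

/-- A rational fan in `N_ℝ`: a finite collection of strictly convex cones, each generated by
finitely many lattice vectors, closed under taking faces, any two of which meet in a common
face. -/
structure RationalFan (N : Type*) [AddCommGroup N] where
  cones : Set (Cone N)
  finite : cones.Finite
  rational : ∀ σ ∈ cones, ∃ s : Finset N,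
    σ = PointedCone.hull ℝ ((fun n : N => (1 : ℝ) ⊗ₜ[ℤ] n) '' (s : Set N))
  strictly_convex : ∀ σ ∈ cones, (σ : ConvexCone ℝ (ℝ ⊗[ℤ] N)).Salient
  face_mem : ∀ σ ∈ cones, ∀ τ : Cone N, τ.IsFaceOf σ → τ ∈ cones
  inter_isFaceOf : ∀ σ ∈ cones, ∀ τ ∈ cones, (σ ⊓ τ).IsFaceOf σ

/-- A fan is simplicial if each of its cones is generated by as many rays as its dimension, that is,
by finitely many linearly independent vectors. -/
def RationalFan.IsSimplicial {N : Type*} [AddCommGroup N] (Δ : RationalFan N) : Prop :=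
  ∀ σ ∈ Δ.cones, PointedCone.IsSimplicial σ

/-- A fan is unimodular if each of its cones is generated by a part of a basis of the lattice `N`
(the elements of that part are then the primitive vectors of the rays of the cone). -/
def RationalFan.IsUnimodular {N : Type*} [AddCommGroup N] (Δ : RationalFan N) : Prop :=
  ∀ σ ∈ Δ.cones, ∃ (n : ℕ) (b : Module.Basis (Fin n) ℤ N) (s : Finset (Fin n)),
    σ = PointedCone.hull ℝ ((fun i => (1 : ℝ) ⊗ₜ[ℤ] b i) '' (s : Set (Fin n)))

section

variable {N : Type*} [AddCommGroup N]

theorem coneLattice_mono {τ σ : Cone N} (h : τ ≤ σ) : coneLattice τ ≤ coneLattice σ :=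
  fun _ hn => Submodule.span_mono (show (τ : Set (ℝ ⊗[ℤ] N)) ⊆ σ from h) hn

/-- The quotient lattice `N^τ = N / N_τ`. -/
abbrev QuotLattice (τ : Cone N) := N ⧸ coneLattice τ

/-- The projection `N^τ → N^σ` for `τ ⊆ σ`. -/
abbrev proj {τ σ : Cone N} (h : τ ≤ σ) : QuotLattice τ →ₗ[ℤ] QuotLattice σ :=
  Submodule.factor (coneLattice_mono h)

/-- The lattice `N^τ_σ`, image of `N_σ` in `N^τ`; for `τ ⊆ σ` it is `N_σ / N_τ`, the lattice of the
tangent space of the face `□^τ_σ` of the canonical compactification. -/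
def relLattice (τ σ : Cone N) : Submodule ℤ (QuotLattice τ) :=
  (coneLattice σ).map (coneLattice τ).mkQ

theorem relLattice_map_proj {τ τ' η : Cone N} (h : τ' ≤ τ) :
    (relLattice τ' η).map (proj h) = relLattice τ η := by
  rw [relLattice, relLattice, ← Submodule.map_comp, Submodule.factor_comp_mk]

/-! ## Multi-tangent spaces -/

/-- The image of `⋀^k L` in the exterior algebra of `P`, for a sublattice `L` of `P`: the span of
all products of `k` elements of `L`. It is zero if `k < 0`. -/
def extPow {P : Type*} [AddCommGroup P] (L : Submodule ℤ P) :
    ℤ → Submodule ℤ (ExteriorAlgebra ℤ P)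
  | Int.ofNat k => (L.map (ExteriorAlgebra.ι ℤ)) ^ k
  | Int.negSucc _ => ⊥

/-- The multi-tangent space `F_k(□^τ_σ) = ∑ ⋀^k N^τ_η`, the sum being over all cones `η` of the fan
that contain `σ`. In particular `F_k(∞_σ)` is the case `τ = σ`. -/
def multiTangent (Δ : RationalFan N) (k : ℤ) (τ σ : Cone N) :
    Submodule ℤ (ExteriorAlgebra ℤ (QuotLattice τ)) :=
  ⨆ η : {η : Cone N // η ∈ Δ.cones ∧ σ ≤ η}, extPow (relLattice τ η.1) k

/-- The multi-cotangent space `F^k(□^τ_σ)` with coefficients in `R` (`ℤ` or `ℚ`), the dual of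
`F_k(□^τ_σ)`. -/
abbrev MultiCotangent (Δ : RationalFan N) (R : Type*) [CommRing R] (k : ℤ) (τ σ : Cone N) :=
  multiTangent Δ k τ σ →ₗ[ℤ] R

/-- The transpose of a linear map, on duals with coefficients in `R`. -/
def transpose (R : Type*) [CommRing R] {A B : Type*} [AddCommGroup A] [AddCommGroup B]
    (f : A →ₗ[ℤ] B) : (B →ₗ[ℤ] R) →ₗ[R] (A →ₗ[ℤ] R) where
  toFun α := α ∘ₗ f
  map_add' _ _ := rfl
  map_smul' _ _ := rfl

theorem map_extPow_le {P Q : Type*} [AddCommGroup P] [AddCommGroup Q] (f : P →ₗ[ℤ] Q)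
    (L : Submodule ℤ P) (k : ℤ) :
    (extPow L k).map (ExteriorAlgebra.map f).toLinearMap ≤ extPow (L.map f) k := by
  cases k with
  | negSucc k => simp [extPow]
  | ofNat k =>
    simp only [extPow]
    rw [Submodule.map_pow, ← Submodule.map_comp, ExteriorAlgebra.map_comp_ι, Submodule.map_comp]

theorem extPow_mono {P : Type*} [AddCommGroup P] {L L' : Submodule ℤ P} (h : L ≤ L') (k : ℤ) :
    extPow L k ≤ extPow L' k := by
  cases k with
  | negSucc k => exact le_refl _
  | ofNat k => exact pow_le_pow_left' (Submodule.map_mono h) k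

theorem mul_mem_extPow {P : Type*} [AddCommGroup P] {L : Submodule ℤ P} {e : P} (he : e ∈ L)
    {k : ℤ} {x : ExteriorAlgebra ℤ P} (hx : x ∈ extPow L k) :
    ExteriorAlgebra.ι ℤ e * x ∈ extPow L (k + 1) := by
  cases k with
  | negSucc k =>
    have : x = 0 := by simpa [extPow] using hx
    subst this
    simp
  | ofNat k =>
    change _ ∈ (L.map (ExteriorAlgebra.ι ℤ)) ^ (k + 1)
    rw [pow_succ']
    exact Submodule.mul_mem_mul (Submodule.mem_map_of_mem he) hx

theorem map_mem_multiTangent (Δ : RationalFan N) (k : ℤ) {τ' τ σ σ' : Cone N} (h : τ' ≤ τ)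
    (hσ : σ' ≤ σ) {x : ExteriorAlgebra ℤ (QuotLattice τ')} (hx : x ∈ multiTangent Δ k τ' σ) :
    ExteriorAlgebra.map (proj h) x ∈ multiTangent Δ k τ σ' := by
  have : multiTangent Δ k τ' σ ≤
      (multiTangent Δ k τ σ').comap (ExteriorAlgebra.map (proj h)).toLinearMap := by
    refine iSup_le fun η => ?_
    rw [← Submodule.map_le_iff_le_comap]
    refine (map_extPow_le _ _ _).trans ?_
    rw [relLattice_map_proj]
    exact le_iSup (fun η : {η : Cone N // η ∈ Δ.cones ∧ σ' ≤ η} => extPow (relLattice τ η.1) k)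
      ⟨η.1, η.2.1, hσ.trans η.2.2⟩
  exact this hx

/-- For faces `γ = □^τ_σ'` and `δ = □^τ'_σ` with `τ' ⊆ τ ⊆ σ' ⊆ σ`, so that `γ ⊆ δ`, the map
`F_k(δ) → F_k(γ)` induced by the projection `N^τ' → N^τ`. It is the inclusion if `τ' = τ`. -/
def faceMap (Δ : RationalFan N) (k : ℤ) {τ' τ σ σ' : Cone N} (h : τ' ≤ τ) (hσ : σ' ≤ σ) :
    multiTangent Δ k τ' σ →ₗ[ℤ] multiTangent Δ k τ σ' :=
  (ExteriorAlgebra.map (proj h)).toLinearMap.restrict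
    fun _ hx => map_mem_multiTangent Δ k h hσ hx

/-! ## Unit normal vectors and wedge products with them -/

/-- `v` is a unit normal vector to `τ` in `σ`, where `τ` is a face of codimension one of `σ`: it lies
in the half-space `σ + N_{τ,ℝ}` of `N_{σ,ℝ}` bounded by `N_{τ,ℝ}`, and `N_τ + ℤ v = N_σ`. -/
def IsUnitNormal (τ σ : Cone N) (v : N) : Prop :=
  coneLattice τ ⊔ Submodule.span ℤ {v} = coneLattice σ ∧
  ∃ x ∈ σ, ∃ y ∈ Submodule.span ℝ (τ : Set (ℝ ⊗[ℤ] N)), (1 : ℝ) ⊗ₜ[ℤ] v = x + y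

open Classical in
/-- A chosen unit normal vector to `τ` in `σ`. -/
def unitNormal (τ σ : Cone N) : N :=
  if h : ∃ v, IsUnitNormal τ σ v then h.choose else 0

/-- The canonical generator `e^τ_σ` of `N^τ_σ`, the class of any unit normal vector. -/
def relNormal (τ σ : Cone N) : QuotLattice τ := (coneLattice τ).mkQ (unitNormal τ σ)

theorem unitNormal_mem (τ σ : Cone N) : unitNormal τ σ ∈ coneLattice σ := by
  unfold unitNormal
  split_ifs with h
  · rw [← h.choose_spec.1]
    exact Submodule.mem_sup_right (Submodule.mem_span_singleton_self _)
  · exact zero_mem _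

theorem relNormal_mem (τ σ : Cone N) : relNormal τ σ ∈ relLattice τ σ :=
  Submodule.mem_map_of_mem (unitNormal_mem τ σ)

theorem mem_coneLattice {σ : Cone N} {n : N} :
    n ∈ coneLattice σ ↔ (1 : ℝ) ⊗ₜ[ℤ] n ∈ Submodule.span ℝ (σ : Set (ℝ ⊗[ℤ] N)) := Iff.rfl

theorem mem_coneLattice_of_smul {σ : Cone N} {c : ℤ} (hc : c ≠ 0) {n : N}
    (h : c • n ∈ coneLattice σ) : n ∈ coneLattice σ := by
  rw [mem_coneLattice] at h ⊢
  have h2 := Submodule.smul_mem _ ((c : ℝ)⁻¹) h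
  rwa [TensorProduct.tmul_smul, ← Int.cast_smul_eq_zsmul ℝ, smul_smul,
    inv_mul_cancel₀ (by exact_mod_cast hc), one_smul] at h2

instance quotLattice_isTorsionFree (σ : Cone N) : Module.IsTorsionFree ℤ (QuotLattice σ) := by
  rw [Module.isTorsionFree_iff_smul_eq_zero]
  intro c x
  obtain ⟨n, rfl⟩ := (coneLattice σ).mkQ_surjective x
  intro h
  by_cases hc : c = 0
  · exact Or.inl hc
  · right
    rw [← map_smul] at h
    simp only [Submodule.mkQ_apply, Submodule.Quotient.mk_eq_zero] at h ⊢
    exact mem_coneLattice_of_smul hc h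

theorem exists_section [Module.Finite ℤ N] {τ σ : Cone N} (h : τ ≤ σ) :
    ∃ s : QuotLattice σ →ₗ[ℤ] QuotLattice τ, (proj h) ∘ₗ s = LinearMap.id :=
  Module.projective_lifting_property (proj h) LinearMap.id (Submodule.factor_surjective _)

/-- A chosen linear section of the projection `N^τ → N^σ`. -/
def projSection [Module.Finite ℤ N] {τ σ : Cone N} (h : τ ≤ σ) :
    QuotLattice σ →ₗ[ℤ] QuotLattice τ :=
  (exists_section h).choose

theorem proj_projSection [Module.Finite ℤ N] {τ σ : Cone N} (h : τ ≤ σ) (x : QuotLattice σ) :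
    proj h (projSection h x) = x :=
  LinearMap.congr_fun (exists_section h).choose_spec x

/-- For a face `τ` of codimension one of `σ`, the linear map `⋀ N^σ → ⋀ N^τ` sending `x` to
`e^τ_σ ∧ x'`, where `x'` is any lift of `x` along the projection `N^τ → N^σ`
(see `wedgeNormal_map` for the independence of the lift). -/
def wedgeNormal [Module.Finite ℤ N] {τ σ : Cone N} (h : τ ≤ σ) :
    ExteriorAlgebra ℤ (QuotLattice σ) →ₗ[ℤ] ExteriorAlgebra ℤ (QuotLattice τ) :=
  LinearMap.mulLeft ℤ (ExteriorAlgebra.ι ℤ (relNormal τ σ)) ∘ₗ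
    (ExteriorAlgebra.map (projSection h)).toLinearMap

theorem ι_mul_map_eq {P : Type*} [AddCommGroup P] (e : P) (f : P →ₗ[ℤ] P)
    (hf : ∀ v, ∃ c : ℤ, f v = v + c • e) (x : ExteriorAlgebra ℤ P) :
    ExteriorAlgebra.ι ℤ e * ExteriorAlgebra.map f x = ExteriorAlgebra.ι ℤ e * x := by
  induction x using CliffordAlgebra.left_induction with
  | algebraMap r => rw [AlgHom.commutes]
  | add x y hx hy => rw [map_add, mul_add, mul_add, hx, hy]
  | ι_mul x m hx =>
    obtain ⟨c, hc⟩ := hf m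
    change ExteriorAlgebra.ι ℤ e * ExteriorAlgebra.map f (ExteriorAlgebra.ι ℤ m * x) =
      ExteriorAlgebra.ι ℤ e * (ExteriorAlgebra.ι ℤ m * x)
    have h1 : ExteriorAlgebra.ι ℤ e * ExteriorAlgebra.ι ℤ m =
        -(ExteriorAlgebra.ι ℤ m * ExteriorAlgebra.ι ℤ e) :=
      eq_neg_of_add_eq_zero_left (ExteriorAlgebra.ι_add_mul_swap e m)
    have h2 : ExteriorAlgebra.ι ℤ e * ExteriorAlgebra.ι ℤ (f m) =
        ExteriorAlgebra.ι ℤ e * ExteriorAlgebra.ι ℤ m := by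
      rw [hc, map_add, map_smul, mul_add, mul_smul_comm, ExteriorAlgebra.ι_sq_zero, smul_zero,
        add_zero]
    rw [map_mul, ExteriorAlgebra.map_apply_ι, ← mul_assoc, ← mul_assoc, h2, h1, neg_mul, neg_mul,
      mul_assoc, mul_assoc, hx]

/-- The map `wedgeNormal` does not depend on the chosen section: it sends the image of any
`x ∈ ⋀ N^τ` to `e^τ_σ ∧ x`. -/
theorem wedgeNormal_map [Module.Finite ℤ N] {τ σ : Cone N} (h : τ ≤ σ)
    (hv : ∃ v, IsUnitNormal τ σ v) (x : ExteriorAlgebra ℤ (QuotLattice τ)) :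
    wedgeNormal h (ExteriorAlgebra.map (proj h) x) =
      ExteriorAlgebra.ι ℤ (relNormal τ σ) * x := by
  have hu : coneLattice τ ⊔ Submodule.span ℤ {unitNormal τ σ} = coneLattice σ := by
    rw [unitNormal, dif_pos hv]
    exact hv.choose_spec.1
  have key : ∀ v, ∃ c : ℤ, (projSection h ∘ₗ proj h) v = v + c • relNormal τ σ := by
    intro v
    obtain ⟨n, rfl⟩ := (coneLattice τ).mkQ_surjective v
    obtain ⟨m, hm⟩ := (coneLattice τ).mkQ_surjective
      ((projSection h ∘ₗ proj h) ((coneLattice τ).mkQ n))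
    have h1 : (coneLattice σ).mkQ m = (coneLattice σ).mkQ n := by
      rw [← Submodule.factor_mk (coneLattice_mono h) m, hm, LinearMap.comp_apply,
        proj_projSection, Submodule.factor_mk]
    have h2 : m - n ∈ coneLattice σ := (Submodule.Quotient.eq _).1 h1
    rw [← hu, Submodule.mem_sup] at h2
    obtain ⟨y, hy, z, hz, hyz⟩ := h2
    obtain ⟨c, rfl⟩ := Submodule.mem_span_singleton.1 hz
    refine ⟨c, ?_⟩
    rw [← hm, relNormal, ← map_smul, ← map_add]
    refine (Submodule.Quotient.eq _).2 ?_
    convert hy using 1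
    rw [← sub_sub, ← hyz, add_sub_cancel_right]
  rw [wedgeNormal, LinearMap.comp_apply, LinearMap.mulLeft_apply, AlgHom.toLinearMap_apply,
    ← AlgHom.comp_apply, ExteriorAlgebra.map_comp_map, ι_mul_map_eq _ _ key]

theorem wedgeNormal_mem [Module.Finite ℤ N] (Δ : RationalFan N) (k : ℤ) {τ σ : Cone N} (h : τ ≤ σ)
    {x : ExteriorAlgebra ℤ (QuotLattice σ)} (hx : x ∈ multiTangent Δ k σ σ) :
    wedgeNormal h x ∈ multiTangent Δ (k + 1) τ τ := by
  have : multiTangent Δ k σ σ ≤ (multiTangent Δ (k + 1) τ τ).comap (wedgeNormal h) := by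
    refine iSup_le fun η x hx => ?_
    have h1 : (relLattice σ η.1).map (projSection h) ≤ relLattice τ η.1 := by
      rintro _ ⟨_, ⟨n, hn, rfl⟩, rfl⟩
      obtain ⟨m, hm⟩ := (coneLattice τ).mkQ_surjective (projSection h ((coneLattice σ).mkQ n))
      refine ⟨m, ?_, hm⟩
      have h2 : (coneLattice σ).mkQ m = (coneLattice σ).mkQ n := by
        rw [← Submodule.factor_mk (coneLattice_mono h) m, hm, proj_projSection]
      have h3 : m - n ∈ coneLattice η.1 :=
        coneLattice_mono η.2.2 ((Submodule.Quotient.eq _).1 h2)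
      simpa using add_mem h3 hn
    have h4 : relNormal τ σ ∈ relLattice τ η.1 :=
      Submodule.map_mono (coneLattice_mono η.2.2) (relNormal_mem τ σ)
    refine (le_iSup (fun η : {η : Cone N // η ∈ Δ.cones ∧ τ ≤ η} =>
      extPow (relLattice τ η.1) (k + 1)) ⟨η.1, η.2.1, h.trans η.2.2⟩) (mul_mem_extPow h4 ?_)
    exact extPow_mono h1 k (map_extPow_le (projSection h) _ k (Submodule.mem_map_of_mem hx))
  exact this hx

/-- The contraction-and-projection map `F^{k+1}(∞_τ) → F^k(∞_σ)`, `α ↦ π_* κ_e α` with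
`e = e^τ_σ`, for a face `τ` of codimension one of `σ`; it is characterized by
`(π_* κ_e α)(π x) = α (e ∧ x)`. Here `l = k + 1`. -/
def contract [Module.Finite ℤ N] (Δ : RationalFan N) (R : Type*) [CommRing R] {k l : ℤ}
    (hl : l = k + 1) {τ σ : Cone N} (h : τ ≤ σ) :
    MultiCotangent Δ R l τ τ →ₗ[R] MultiCotangent Δ R k σ σ :=
  transpose R ((wedgeNormal h).restrict (p := multiTangent Δ k σ σ) (q := multiTangent Δ l τ τ)
    fun _ hx => hl ▸ wedgeNormal_mem Δ k h hx)

/-! ## The cubical complex -/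

/-- The set `Σ_q` of cones of dimension `q`. -/
abbrev RationalFan.conesOfDim (Δ : RationalFan N) (q : ℕ) :=
  {σ : Cone N // σ ∈ Δ.cones ∧ coneDim σ = q}

instance (Δ : RationalFan N) : Fintype Δ.cones := Δ.finite.fintype

instance (Δ : RationalFan N) (q : ℕ) : Fintype (Δ.conesOfDim q) :=
  (Δ.finite.subset fun _ h => h.1 : {σ : Cone N | σ ∈ Δ.cones ∧ coneDim σ = q}.Finite).fintype

/-- The cubical cochain group `⨁_{|σ| = q} F^{p-q}(∞_σ)`. -/
abbrev CubicalCochain (Δ : RationalFan N) (R : Type*) [CommRing R] (p q : ℕ) :=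
  (σ : Δ.conesOfDim q) → MultiCotangent Δ R ((p : ℤ) - (q : ℤ)) σ.1 σ.1

open Classical in
/-- The differential of the cubical complex, the sum of the maps `contract` over all pairs
of a cone `σ` and a face `τ` of `σ` of codimension one. -/
def cubicalDiff [Module.Finite ℤ N] (Δ : RationalFan N) (R : Type*) [CommRing R] (p q : ℕ) :
    CubicalCochain Δ R p q →ₗ[R] CubicalCochain Δ R p (q + 1) :=
  LinearMap.pi fun σ => ∑ τ : Δ.conesOfDim q,
    if h : τ.1 ≤ σ.1 then
      contract Δ R (by push_cast; ring) h ∘ₗ LinearMap.proj τ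
    else 0

/-! ## The tropical cochain complex of the canonical compactification -/

/-- A choice of orientations of the faces `□^τ_σ` of the canonical compactification: canonical
multivectors `ν^τ_σ`, generators of the top exterior powers of the lattices `N^τ_σ`. -/
structure Orientation (Δ : RationalFan N) where
  ν : (τ σ : Cone N) → ExteriorAlgebra ℤ (QuotLattice τ)
  span_ν : ∀ τ ∈ Δ.cones, ∀ σ ∈ Δ.cones, τ ≤ σ →
    Submodule.span ℤ {ν τ σ} = extPow (relLattice τ σ) ((coneDim σ : ℤ) - (coneDim τ : ℤ))

open Classical in
/-- The integer `c` with `x = c • ν` (zero if there is none): the value on `x` of the canonical form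
dual to a multivector `ν`. -/
def canonicalForm {P : Type*} [AddCommGroup P] (ν x : ExteriorAlgebra ℤ P) : ℤ :=
  if h : ∃ c : ℤ, x = c • ν then h.choose else 0

/-- The sign of the pair of faces `γ = □^τ_σ'`, `δ = □^τ_σ` of the same sedentarity, with `σ'` a
face of codimension one of `σ`: the sign of `ϖ_δ(n ∧ ν_γ)`, `n` being a unit normal vector. -/
def signSame {Δ : RationalFan N} (o : Orientation Δ) (τ σ' σ : Cone N) : ℤ :=
  (canonicalForm (o.ν τ σ)
    (ExteriorAlgebra.ι ℤ ((coneLattice τ).mkQ (unitNormal σ' σ)) * o.ν τ σ')).sign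

/-- The sign of the pair of faces `γ = □^τ_σ`, `δ = □^τ'_σ` with `τ'` a face of codimension one
of `τ`: the sign of `-ϖ_δ(e^τ'_τ ∧ ν')`, where `ν'` is any lift of `ν_γ`. -/
def signChange [Module.Finite ℤ N] {Δ : RationalFan N} (o : Orientation Δ) {τ' τ : Cone N}
    (h : τ' ≤ τ) (σ : Cone N) : ℤ :=
  (-canonicalForm (o.ν τ' σ) (wedgeNormal h (o.ν τ σ))).sign

/-- The faces `□^τ_σ` of dimension `q` of the canonical compactification, indexed by the pairs
`(τ, σ)` of cones of the fan with `τ ⊆ σ` and `|σ| = |τ| + q`. -/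
abbrev RationalFan.Face (Δ : RationalFan N) (q : ℕ) :=
  {δ : Cone N × Cone N //
    δ.1 ∈ Δ.cones ∧ δ.2 ∈ Δ.cones ∧ δ.1 ≤ δ.2 ∧ coneDim δ.2 = coneDim δ.1 + q}

/-- The tropical cochain group `C^{p,q} = ⨁_{|δ| = q} F^p(δ)` of the canonical compactification. -/
abbrev TropicalCochain (Δ : RationalFan N) (R : Type*) [CommRing R] (p q : ℕ) :=
  (δ : Δ.Face q) → MultiCotangent Δ R (p : ℤ) δ.1.1 δ.1.2

open Classical in
/-- The differential of the tropical cochain complex. The faces of codimension one of `δ = □^τ_σ`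
are the faces `□^τ_η` with `τ ⊆ η ⊆ σ`, `|σ| = |η| + 1` (first sum), and the faces `□^η_σ` with
`τ ⊆ η ⊆ σ`, `|η| = |τ| + 1` (second sum). -/
def tropicalDiff [Module.Finite ℤ N] {Δ : RationalFan N} (o : Orientation Δ) (R : Type*)
    [CommRing R] (p q : ℕ) : TropicalCochain Δ R p q →ₗ[R] TropicalCochain Δ R p (q + 1) :=
  LinearMap.pi fun δ =>
    (∑ η : Δ.cones,
      if h : δ.1.1 ≤ η.1 ∧ η.1 ≤ δ.1.2 ∧ coneDim δ.1.2 = coneDim η.1 + 1 then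
        signSame o δ.1.1 η.1 δ.1.2 •
          (transpose R (faceMap Δ (p : ℤ) (le_refl δ.1.1) h.2.1) ∘ₗ
            LinearMap.proj (⟨(δ.1.1, η.1), δ.2.1, η.2, h.1, by
              have h1 := δ.2.2.2.2
              have h2 := h.2.2
              dsimp only
              omega⟩ : Δ.Face q))
      else 0) +
    ∑ η : Δ.cones,
      if h : δ.1.1 ≤ η.1 ∧ η.1 ≤ δ.1.2 ∧ coneDim η.1 = coneDim δ.1.1 + 1 then
        signChange o h.1 δ.1.2 •
          (transpose R (faceMap Δ (p : ℤ) h.1 (le_refl δ.1.2)) ∘ₗ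
            LinearMap.proj (⟨(η.1, δ.1.2), η.2, δ.2.2.1, h.2.1, by
              have h1 := δ.2.2.2.2
              have h2 := h.2.2
              dsimp only
              omega⟩ : Δ.Face q))
      else 0

end

/-! ## Existence of the choices made above -/

section

variable {N : Type*} [AddCommGroup N] [Module.Free ℤ N] [Module.Finite ℤ N]

theorem finrank_coneLattice (Δ : RationalFan N) (σ : Cone N) (hσ : σ ∈ Δ.cones) :
    Module.finrank ℤ (coneLattice σ) = coneDim σ := by
  obtain ⟨s, hs⟩ := Δ.rational σ hσ
  have hinj : Function.Injective ((coneLattice σ).subtype.baseChange ℝ) :=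
    Module.Flat.lTensor_preserves_injective_linearMap (M := ℝ) (coneLattice σ).subtype
      (Submodule.injective_subtype _)
  have hr : LinearMap.range ((coneLattice σ).subtype.baseChange ℝ) =
      Submodule.span ℝ (σ : Set (ℝ ⊗[ℤ] N)) := by
    apply le_antisymm
    · rintro _ ⟨x, rfl⟩
      induction x with
      | zero => simp
      | add x y hx hy => rw [map_add]; exact add_mem hx hy
      | tmul r n =>
        rw [LinearMap.baseChange_tmul]
        have : r ⊗ₜ[ℤ] ((coneLattice σ).subtype n) = r • ((1:ℝ) ⊗ₜ[ℤ] (n : N)) := by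
          rw [TensorProduct.smul_tmul']; simp
        rw [this]
        exact Submodule.smul_mem _ _ n.2
    · rw [Submodule.span_le]
      intro x hx
      have hle : σ ≤ PointedCone.ofSubmodule
          (LinearMap.range ((coneLattice σ).subtype.baseChange ℝ)) := by
        conv_lhs => rw [hs]
        refine Submodule.span_le.2 ?_
        rintro _ ⟨n, hn, rfl⟩
        have hn' : n ∈ coneLattice σ := by
          rw [mem_coneLattice]
          apply Submodule.subset_span
          have : (1:ℝ) ⊗ₜ[ℤ] n ∈ σ := by
            rw [hs]; exact Submodule.subset_span ⟨n, hn, rfl⟩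
          exact this
        exact ⟨1 ⊗ₜ ⟨n, hn'⟩, by simp⟩
      exact hle hx
  rw [coneDim, ← hr, LinearMap.finrank_range_of_inj hinj, Module.finrank_baseChange]

theorem finrank_relLattice (Δ : RationalFan N) (τ σ : Cone N) (hτ : τ ∈ Δ.cones)
    (hσ : σ ∈ Δ.cones) (h : τ ≤ σ) :
    Module.finrank ℤ (relLattice τ σ) + coneDim τ = coneDim σ := by
  rw [← finrank_coneLattice Δ σ hσ, ← finrank_coneLattice Δ τ hτ]
  let f := (coneLattice τ).mkQ ∘ₗ (coneLattice σ).subtype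
  have := Submodule.finrank_quotient_add_finrank (LinearMap.ker f)
  rw [LinearEquiv.finrank_eq f.quotKerEquivRange, LinearMap.range_comp, Submodule.range_subtype, LinearMap.ker_comp, Submodule.ker_mkQ] at this
  rw [← this]
  congr 1
  exact (LinearEquiv.finrank_eq (Submodule.comapSubtypeEquivOfLe (coneLattice_mono h))).symm

/-- Unit normal vectors exist for all pairs of cones of codimension one in the fan. -/
theorem exists_isUnitNormal (Δ : RationalFan N) (τ σ : Cone N) (hτ : τ ∈ Δ.cones)
    (hσ : σ ∈ Δ.cones) (h : τ ≤ σ) (hd : coneDim σ = coneDim τ + 1) :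
    ∃ v, IsUnitNormal τ σ v := by
  have h1 : Module.finrank ℤ (relLattice τ σ) = 1 := by
    have := finrank_relLattice Δ τ σ hτ hσ h; omega
  let b := Module.finBasisOfFinrankEq ℤ _ h1
  obtain ⟨w, hw, hwb⟩ := (b 0).2
  have hsup : coneLattice τ ⊔ Submodule.span ℤ {w} = coneLattice σ := by
    apply le_antisymm
    · refine sup_le (coneLattice_mono h) ?_
      rw [Submodule.span_singleton_le_iff_mem]; exact hw
    · intro n hn
      have := b.sum_repr ⟨(coneLattice τ).mkQ n, Submodule.mem_map_of_mem hn⟩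
      rw [Fin.sum_univ_one] at this
      have h2 := congrArg Subtype.val this
      simp only [Submodule.coe_smul] at h2
      rw [← hwb, ← map_smul] at h2
      have h3 := (Submodule.Quotient.eq _).1 h2
      rw [Submodule.mem_sup]
      exact ⟨_, neg_mem h3, _, Submodule.smul_mem _ _ (Submodule.mem_span_singleton_self _), by abel⟩
  have hne : ∃ x ∈ σ, x ∉ Submodule.span ℝ (τ : Set (ℝ ⊗[ℤ] N)) := by
    by_contra! hc
    have : coneDim σ ≤ coneDim τ := Submodule.finrank_mono (Submodule.span_le.2 hc)
    omega
  obtain ⟨x, hx, hxτ⟩ := hne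
  have hspan : Submodule.span ℝ (τ : Set (ℝ ⊗[ℤ] N)) ⊔ Submodule.span ℝ {(1:ℝ) ⊗ₜ[ℤ] w} =
      Submodule.span ℝ (σ : Set (ℝ ⊗[ℤ] N)) := by
    have hwτ : (1:ℝ) ⊗ₜ[ℤ] w ∉ Submodule.span ℝ (τ : Set (ℝ ⊗[ℤ] N)) := by
      intro hc
      have : (coneLattice τ).mkQ w = 0 := (Submodule.Quotient.mk_eq_zero _).2 hc
      rw [this] at hwb
      exact b.ne_zero 0 (Subtype.ext hwb.symm)
    have hle : Submodule.span ℝ (τ : Set (ℝ ⊗[ℤ] N)) ⊔ Submodule.span ℝ {(1:ℝ) ⊗ₜ[ℤ] w} ≤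
      Submodule.span ℝ (σ : Set (ℝ ⊗[ℤ] N)) := by
      refine sup_le (Submodule.span_mono h) ?_
      rw [Submodule.span_singleton_le_iff_mem]; exact hw
    refine Submodule.eq_of_le_of_finrank_le hle ?_
    change coneDim σ ≤ _
    rw [hd]
    refine Submodule.finrank_lt_finrank_of_lt (lt_of_le_of_ne le_sup_left ?_)
    intro he
    apply hwτ
    rw [he]
    exact Submodule.mem_sup_right (Submodule.mem_span_singleton_self _)
  have hx2 : x ∈ Submodule.span ℝ (σ : Set (ℝ ⊗[ℤ] N)) := Submodule.subset_span hx
  rw [← hspan, Submodule.mem_sup] at hx2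
  obtain ⟨t, ht, z, hz, htz⟩ := hx2
  obtain ⟨c, rfl⟩ := Submodule.mem_span_singleton.1 hz
  rcases lt_trichotomy c 0 with hc | hc | hc
  · refine ⟨-w, ?_, (-c⁻¹) • x, ?_, c⁻¹ • t, Submodule.smul_mem _ _ ht, ?_⟩
    · rw [← Set.neg_singleton, Submodule.span_neg, hsup]
    · exact Submodule.smul_mem σ (⟨-c⁻¹, by simpa using hc.le⟩ : {r : ℝ // 0 ≤ r}) hx
    · rw [← htz, smul_add, smul_smul, neg_mul, inv_mul_cancel₀ hc.ne, TensorProduct.tmul_neg]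
      module
  · subst hc; simp at htz; subst htz; exact absurd ht hxτ
  · refine ⟨w, hsup, c⁻¹ • x, ?_, (-c⁻¹) • t, Submodule.smul_mem _ _ ht, ?_⟩
    · exact Submodule.smul_mem σ (⟨c⁻¹, by simpa using hc.le⟩ : {r : ℝ // 0 ≤ r}) hx
    · rw [← htz, smul_add, smul_smul, inv_mul_cancel₀ hc.ne']
      module

theorem exists_span_eq_extPow {P : Type*} [AddCommGroup P] (L : Submodule ℤ P) [Module.Free ℤ L]
    [Module.Finite ℤ L] :
    ∃ ν, Submodule.span ℤ {ν} = extPow L (Module.finrank ℤ L) := by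
  have h1 : Module.finrank ℤ (⋀[ℤ]^(Module.finrank ℤ L) L) = 1 := by
    rw [exteriorPower.finrank_eq]; simp
  let b := Module.finBasisOfFinrankEq ℤ _ h1
  refine ⟨ExteriorAlgebra.map L.subtype (b 0), ?_⟩
  have h2 : (L.map (ExteriorAlgebra.ι ℤ)) ^ (Module.finrank ℤ L) =
      (⋀[ℤ]^(Module.finrank ℤ L) L).map (ExteriorAlgebra.map L.subtype).toLinearMap := by
    change _ = Submodule.map _ (LinearMap.range (ExteriorAlgebra.ι ℤ) ^ _)
    rw [Submodule.map_pow, LinearMap.range_eq_map, ← Submodule.map_comp, ExteriorAlgebra.map_comp_ι,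
      Submodule.map_comp, Submodule.map_top, Submodule.range_subtype]
  change _ = (L.map (ExteriorAlgebra.ι ℤ)) ^ (Module.finrank ℤ L)
  rw [h2]
  have h3 : ⋀[ℤ]^(Module.finrank ℤ L) L = Submodule.span ℤ {(b 0 : ExteriorAlgebra ℤ L)} := by
    have := congrArg (Submodule.map (Submodule.subtype _)) b.span_eq
    rw [Submodule.map_top, Submodule.range_subtype, Submodule.map_span] at this
    refine this.symm.trans ?_
    congr 1
    ext; simp [Fin.exists_fin_one, eq_comm]
  have h4 := congrArg (Submodule.map (ExteriorAlgebra.map L.subtype).toLinearMap) h3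
  refine Eq.trans ?_ h4.symm
  rw [Submodule.map_span, Set.image_singleton]; rfl

/-- Orientations exist. -/
theorem nonempty_orientation (Δ : RationalFan N) : Nonempty (Orientation Δ) := by
  have : ∀ τ σ : Cone N, ∃ ν : ExteriorAlgebra ℤ (QuotLattice τ),
    Submodule.span ℤ {ν} = extPow (relLattice τ σ) (Module.finrank ℤ (relLattice τ σ)) :=
    fun τ σ => exists_span_eq_extPow _
  choose ν hν using this
  refine ⟨ν, fun τ hτ σ hσ h => ?_⟩
  rw [hν]; congr 1
  have := finrank_relLattice Δ τ σ hτ hσ h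
  omega

end

/-! ## Cohomology -/

section

variable {R : Type*} [CommRing R] {C : ℕ → Type*} [∀ q, AddCommGroup (C q)] [∀ q, Module R (C q)]

/-- The coboundaries of degree `q` of a sequence of maps `C 0 → C 1 → C 2 → ⋯`. -/
def coboundaries (d : ∀ q, C q →ₗ[R] C (q + 1)) : ∀ q, Submodule R (C q)
  | 0 => ⊥
  | q + 1 => LinearMap.range (d q)

/-- The cohomology in degree `q` of a cochain complex `C 0 → C 1 → C 2 → ⋯`: cocycles modulo
coboundaries. -/
abbrev Cohomology (d : ∀ q, C q →ₗ[R] C (q + 1)) (q : ℕ) :=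
  LinearMap.ker (d q) ⧸ (coboundaries d q).comap (LinearMap.ker (d q)).subtype

end

/-- The cohomology in degree `q` of the cubical complex `C^{p,•}`, with coefficients in `R`. -/
abbrev CubicalCohomology {N : Type*} [AddCommGroup N] [Module.Finite ℤ N] (Δ : RationalFan N)
    (R : Type*) [CommRing R] (p q : ℕ) :=
  Cohomology (cubicalDiff Δ R p) q

/-- The tropical cohomology `H^{p,q}` of the canonical compactification, with coefficients
in `R`. -/
abbrev TropicalCohomology {N : Type*} [AddCommGroup N] [Module.Finite ℤ N] {Δ : RationalFan N}
    (o : Orientation Δ) (R : Type*) [CommRing R] (p q : ℕ) :=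
  Cohomology (tropicalDiff o R p) q

end TropicalFan

end

/-!
The two complexes are compared by a surjective map. A cubical cochain of degree `q` assigns to a
cone `σ` of dimension `q` a form of degree `p - q` on `F(∞_σ)`; a tropical cochain assigns, in
particular, a form of degree `p` to the cube `□^0_σ`. Evaluating the latter on `ν ∧ x`, where `ν`
is the orientation of `□^0_σ` and `x` is lifted from `F(∞_σ)`, gives the comparison map `capMap`.
It commutes with the differentials up to the sign `(-1)^q` (`capMap_tropicalDiff`): moving the
unit normal vector past `ν` produces the sign, and the part of the tropical differential that
changes the sedentarity disappears because `ν` vanishes in the quotients `N^η`, `η ≠ 0`. A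
surjective chain map with exact kernel is a quasi-isomorphism (`cohomology_equiv_of_surjective`),
so that it remains to study the kernel.

For a fixed cone `σ`, generated by the rays `e_i`, the spaces of forms on the cubes `□^τ_σ`, `τ ⊆
σ`, are subspaces of the space `A` of forms on `□^0_σ`. Let `f_i` be forms on `N` dual to the
`e_i` up to a common factor `m` (a `Frame` of the cone). If `m` is invertible in the coefficients,
the maps `α ↦ m⁻¹ α(e_i ∧ (f_i ⌟ ·))` are commuting idempotents `P_i` of `A`, and the forms on
`□^τ_σ` are those killed by the `P_i` with `e_i ∈ τ` (`Frame.exists_pull_of_idem`). Hence the row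
`σ`, in which only the sedentarity varies, is a cube complex, exact except at `□^0_σ`, where the
obstruction is the image of the product of all the `P_i` (`cube_exact`). A form is killed by this
product as soon as it vanishes on the multiples of `∏ e_i`, that is, as soon as it is in the
kernel of the comparison map (`Frame.prod_idem_eq_zero_of_cap`). So the rows of the kernel are
exact (`Frame.row_exact`), and the kernel is exact by induction on the dimension of `σ`
(`exists_preimage_of_kernel`). Surjectivity of the comparison map follows by contracting with all
the `f_i` (`Frame.exists_eval_cap`).

The cones of a unimodular fan have frames with `m = 1`; those of a simplicial fan have frames with
some `m > 0`, which is invertible in `ℚ`. That is the only difference between the two cases.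

Both differentials square to zero because exactly two cones lie strictly between a cone and a face
of codimension two, and the unit normal vectors along the two paths differ by an integral matrix
of determinant `-1` (`Frame.normalRel`).
-/

noncomputable section

namespace TropicalFan

/-! ### Exterior algebras -/

section Exterior

variable {P Q : Type*} [AddCommGroup P] [AddCommGroup Q]

local notation "ι" => ExteriorAlgebra.ι ℤ

instance exteriorAlgebra_isTorsionFree [Module.Free ℤ P] :
    Module.IsTorsionFree ℤ (ExteriorAlgebra ℤ P) := by
  obtain ⟨I, b⟩ := Module.Free.exists_basis ℤ P
  classical
  let : LinearOrder I := linearOrderOfSTO WellOrderingRel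
  have : Module.Free ℤ (ExteriorAlgebra ℤ P) := Module.Free.of_basis b.ExteriorAlgebra
  infer_instance

theorem ι_mul_ι_comm (a b : P) : ι a * ι b = -(ι b * ι a) :=
  eq_neg_of_add_eq_zero_left (ExteriorAlgebra.ι_add_mul_swap a b)

theorem ι_mul_ι_mul_comm (a b : P) (x : ExteriorAlgebra ℤ P) :
    ι a * (ι b * x) = -(ι b * (ι a * x)) := by
  rw [← mul_assoc, ι_mul_ι_comm, neg_mul, mul_assoc]

theorem ι_mul_self_mul (a : P) (x : ExteriorAlgebra ℤ P) : ι a * (ι a * x) = 0 := by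
  rw [← mul_assoc, ExteriorAlgebra.ι_sq_zero, zero_mul]

theorem extPow_zero (L : Submodule ℤ P) : extPow L 0 = 1 := pow_zero _

theorem extPow_succ (L : Submodule ℤ P) (k : ℕ) :
    extPow L (k + 1 : ℕ) = L.map (ι) * extPow L k := pow_succ' _ _

/-- Induction on multivectors of `⋀^k L`: the products of elements of `L` and elements of `⋀^k L`
span `⋀^{k+1} L`. -/
theorem extPow_induction {L : Submodule ℤ P} {p : ℕ → ExteriorAlgebra ℤ P → Prop}
    (one : p 0 1) (add : ∀ k x y, p k x → p k y → p k (x + y))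
    (smul : ∀ k (c : ℤ) x, p k x → p k (c • x))
    (mul : ∀ k : ℕ, ∀ v ∈ L, ∀ x ∈ extPow L k, p k x → p (k + 1) (ι v * x)) (k : ℕ)
    {x : ExteriorAlgebra ℤ P} (hx : x ∈ extPow L k) : p k x := by
  induction k generalizing x with
  | zero =>
    rw [Nat.cast_zero, extPow_zero, Submodule.mem_one] at hx
    obtain ⟨c, rfl⟩ := hx
    rw [Algebra.algebraMap_eq_smul_one]
    exact smul _ _ _ one
  | succ k ih =>
    rw [extPow_succ] at hx
    induction hx using Submodule.mul_induction_on' with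
    | mem_mul_mem a ha b hb =>
      obtain ⟨v, hv, rfl⟩ := ha
      exact mul k v hv b hb (ih hb)
    | add x _ y _ hx hy => exact add _ _ _ hx hy

theorem map_extPow (f : P →ₗ[ℤ] Q) (L : Submodule ℤ P) (k : ℤ) :
    (extPow L k).map (ExteriorAlgebra.map f).toLinearMap = extPow (L.map f) k := by
  cases k with
  | negSucc k => simp [extPow]
  | ofNat k =>
    simp only [extPow]
    rw [Submodule.map_pow, ← Submodule.map_comp, ExteriorAlgebra.map_comp_ι, Submodule.map_comp]

theorem mul_mem_extPow_add {L : Submodule ℤ P} {k l : ℤ} {x y : ExteriorAlgebra ℤ P}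
    (hk : 0 ≤ k) (hx : x ∈ extPow L k) (hy : y ∈ extPow L l) : x * y ∈ extPow L (k + l) := by
  lift k to ℕ using hk
  cases l with
  | negSucc l =>
    have : y = 0 := by simpa [extPow] using hy
    subst this
    simp
  | ofNat l =>
    change _ ∈ (L.map (ExteriorAlgebra.ι ℤ)) ^ (k + l)
    rw [pow_add]
    exact Submodule.mul_mem_mul hx hy

theorem extPow_mul_ι {L : Submodule ℤ P} {n : ℕ} {ν : ExteriorAlgebra ℤ P} (hν : ν ∈ extPow L n)
    (v : P) : ν * ι v = (-1 : ℤ) ^ n • (ι v * ν) := by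
  refine extPow_induction (L := L) (p := fun n ν => ν * ι v = (-1 : ℤ) ^ n • (ι v * ν))
    (by simp) ?_ ?_ ?_ n hν
  · intro k x y hx hy
    rw [add_mul, mul_add, smul_add, hx, hy]
  · intro k c x hx
    rw [smul_mul_assoc, hx, mul_smul_comm, smul_comm]
  · intro k w _ x _ hx
    rw [mul_assoc, hx, mul_smul_comm, ι_mul_ι_mul_comm, pow_succ]
    simp

/-- A multivector annihilated by the differences `g v - v` does not see the effect of `g`. -/
theorem mul_map_eq {L : Submodule ℤ P} {n : ℕ} {ν : ExteriorAlgebra ℤ P} (hν : ν ∈ extPow L n)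
    (g : P →ₗ[ℤ] P) (hg : ∀ v, ι (g v - v) * ν = 0) (x : ExteriorAlgebra ℤ P) :
    ν * ExteriorAlgebra.map g x = ν * x := by
  induction x using CliffordAlgebra.left_induction with
  | algebraMap r => rw [AlgHom.commutes]
  | add x y hx hy => rw [map_add, mul_add, mul_add, hx, hy]
  | ι_mul x m hx =>
    change ν * ExteriorAlgebra.map g (ι m * x) = ν * (ι m * x)
    have h : ι (g m) * ν = ι m * ν := by
      rw [← sub_eq_zero, ← sub_mul, ← map_sub, hg]
    rw [map_mul, ExteriorAlgebra.map_apply_ι, ← mul_assoc, extPow_mul_ι hν, h, ← extPow_mul_ι hν,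
      ← mul_assoc, extPow_mul_ι hν, smul_mul_assoc, smul_mul_assoc, mul_assoc, mul_assoc, hx]

theorem extPow_eq_map_subtype (M : Submodule ℤ P) (k : ℕ) :
    extPow M k = (⋀[ℤ]^k M).map (ExteriorAlgebra.map M.subtype).toLinearMap := by
  change (M.map (ExteriorAlgebra.ι ℤ)) ^ k =
    Submodule.map _ (LinearMap.range (ExteriorAlgebra.ι ℤ) ^ _)
  rw [Submodule.map_pow, LinearMap.range_eq_map, ← Submodule.map_comp, ExteriorAlgebra.map_comp_ι,
    Submodule.map_comp, Submodule.map_top, Submodule.range_subtype]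

theorem extPow_eq_bot_of_finrank_lt (M : Submodule ℤ P) [Module.Free ℤ M] [Module.Finite ℤ M]
    {k : ℕ} (hk : Module.finrank ℤ M < k) : extPow M k = ⊥ := by
  have h : Module.finrank ℤ (⋀[ℤ]^k M) = 0 := by
    rw [exteriorPower.finrank_eq, Nat.choose_eq_zero_of_lt hk]
  have : Subsingleton (⋀[ℤ]^k M) := Module.finrank_zero_iff.1 h
  rw [extPow_eq_map_subtype, Submodule.subsingleton_iff_eq_bot.1 this, Submodule.map_bot]

/-- The top exterior power of a direct summand does not vanish. -/
theorem extPow_finrank_ne_bot (M : Submodule ℤ P) [Module.Free ℤ M] [Module.Finite ℤ M]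
    (r : P →ₗ[ℤ] M) (hr : r ∘ₗ M.subtype = LinearMap.id) :
    extPow M (Module.finrank ℤ M) ≠ ⊥ := by
  intro h
  have hinj : Function.Injective (ExteriorAlgebra.map M.subtype).toLinearMap :=
    ExteriorAlgebra.map_injective ⟨r, hr⟩
  rw [extPow_eq_map_subtype] at h
  have h2 := Submodule.map_injective_of_injective hinj (h.trans (Submodule.map_bot _).symm)
  have h1 : Module.finrank ℤ (⋀[ℤ]^(Module.finrank ℤ M) M) = 1 := by
    rw [exteriorPower.finrank_eq, Nat.choose_self]
  rw [h2] at h1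
  simp at h1

/-- `⋀^{k+1} (M + ℤ e) ⊆ e ∧ ⋀^k M + ⋀^{k+1} M`. -/
theorem extPow_sup_span_le (M : Submodule ℤ P) (e : P) (k : ℕ) :
    extPow (M ⊔ Submodule.span ℤ {e}) (k + 1 : ℕ) ≤
      (extPow M k).map (LinearMap.mulLeft ℤ (ι e)) ⊔ extPow M (k + 1 : ℕ) := by
  induction k with
  | zero =>
    rw [extPow_succ, Nat.cast_zero, extPow_zero, extPow_zero, mul_one, Submodule.map_sup]
    refine sup_le (le_sup_of_le_right ?_) (le_sup_of_le_left ?_)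
    · rw [extPow_succ, Nat.cast_zero, extPow_zero, mul_one]
    · rw [Submodule.map_span_le]
      rintro _ rfl
      exact ⟨1, Submodule.one_le.1 le_rfl, by simp⟩
  | succ k ih =>
    rw [extPow_succ]
    refine Submodule.mul_le.2 ?_
    rintro _ ⟨v, hv, rfl⟩ y hy
    obtain ⟨m, hm, z, hz, rfl⟩ := Submodule.mem_sup.1 hv
    obtain ⟨c, rfl⟩ := Submodule.mem_span_singleton.1 hz
    obtain ⟨_, ⟨a, ha, rfl⟩, b, hb, rfl⟩ := Submodule.mem_sup.1 (ih hy)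
    have h1 : ι m * (ι e * a) ∈
        (extPow M (k + 1 : ℕ)).map (LinearMap.mulLeft ℤ (ι e)) :=
      ⟨-(ι m * a), neg_mem (mul_mem_extPow hm ha), by
        rw [LinearMap.mulLeft_apply, mul_neg, ← ι_mul_ι_mul_comm]⟩
    have h2 : ι e * b ∈ (extPow M (k + 1 : ℕ)).map (LinearMap.mulLeft ℤ (ι e)) := ⟨b, hb, rfl⟩
    have h3 : ι m * b ∈ extPow M (k + 1 + 1 : ℕ) := mul_mem_extPow hm hb
    have : ι (m + c • e) * (LinearMap.mulLeft ℤ (ι e) a + b) =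
        (ι m * (ι e * a) + c • (ι e * b)) + ι m * b := by
      rw [LinearMap.mulLeft_apply, map_add, map_smul, add_mul, mul_add, mul_add, smul_mul_assoc,
        smul_mul_assoc, ι_mul_self_mul, smul_zero]
      abel
    rw [this]
    exact Submodule.add_mem_sup (add_mem h1 (Submodule.smul_mem _ _ h2)) h3

/-- If `⋀^{k+1} M = 0` then `⋀^{k+1} (M + ℤ e) = e ∧ ⋀^k M`. -/
theorem extPow_sup_span (M : Submodule ℤ P) (e : P) (k : ℕ)
    (h : extPow M (k + 1 : ℕ) = ⊥) :
    extPow (M ⊔ Submodule.span ℤ {e}) (k + 1 : ℕ) =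
      (extPow M k).map (LinearMap.mulLeft ℤ (ι e)) := by
  refine le_antisymm ((extPow_sup_span_le M e k).trans (by rw [h, sup_bot_eq])) ?_
  rintro _ ⟨a, ha, rfl⟩
  exact mul_mem_extPow (Submodule.mem_sup_right (Submodule.mem_span_singleton_self _))
    (extPow_mono le_sup_left _ ha)

/-- Contraction of multivectors by a linear form. -/
def contr (f : P →ₗ[ℤ] ℤ) : ExteriorAlgebra ℤ P →ₗ[ℤ] ExteriorAlgebra ℤ P :=
  CliffordAlgebra.contractLeft (Q := (0 : QuadraticForm ℤ P)) f

theorem contr_ι_mul (f : P →ₗ[ℤ] ℤ) (v : P) (x : ExteriorAlgebra ℤ P) :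
    contr f (ι v * x) = f v • x - ι v * contr f x :=
  CliffordAlgebra.contractLeft_ι_mul f v x

theorem contr_one (f : P →ₗ[ℤ] ℤ) : contr f 1 = 0 :=
  CliffordAlgebra.contractLeft_one (Q := (0 : QuadraticForm ℤ P)) (d := f)

theorem contr_contr (f : P →ₗ[ℤ] ℤ) (x : ExteriorAlgebra ℤ P) : contr f (contr f x) = 0 :=
  CliffordAlgebra.contractLeft_contractLeft f x

theorem contr_comm (f g : P →ₗ[ℤ] ℤ) (x : ExteriorAlgebra ℤ P) :
    contr f (contr g x) = -contr g (contr f x) :=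
  CliffordAlgebra.contractLeft_comm f g x

theorem contr_mem_extPow (f : P →ₗ[ℤ] ℤ) {L : Submodule ℤ P} {k : ℤ} {x : ExteriorAlgebra ℤ P}
    (hx : x ∈ extPow L k) : contr f x ∈ extPow L (k - 1) := by
  cases k with
  | negSucc k =>
    have : x = 0 := by simpa [extPow] using hx
    subst this
    simp
  | ofNat k =>
    refine extPow_induction (L := L) (p := fun k x => contr f x ∈ extPow L ((k : ℤ) - 1))
      ?_ ?_ ?_ ?_ k hx
    · rw [contr_one]; exact zero_mem _
    · intro k x y hx hy
      rw [map_add]; exact add_mem hx hy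
    · intro k c x hx
      rw [map_smul]; exact Submodule.smul_mem _ _ hx
    · intro k v hv x hx h
      rw [contr_ι_mul]
      refine sub_mem (Submodule.smul_mem _ _ (by simpa using hx)) ?_
      simpa using mul_mem_extPow hv h

/-- On `⋀^k`, the map induced by `m - f(·) e` is `m^{k-1} (m - e ∧ f ⌟ ·)`. -/
theorem smul_map_sub (f : P →ₗ[ℤ] ℤ) (e : P) (m : ℤ) {L : Submodule ℤ P} {k : ℕ}
    {x : ExteriorAlgebra ℤ P} (hx : x ∈ extPow L k) :
    m • ExteriorAlgebra.map (m • LinearMap.id - f.smulRight e) x =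
      m ^ k • (m • x - ι e * contr f x) := by
  set g : P →ₗ[ℤ] P := m • LinearMap.id - f.smulRight e
  refine extPow_induction (L := L) (p := fun k x => m • ExteriorAlgebra.map g x =
    m ^ k • (m • x - ι e * contr f x)) ?_ ?_ ?_ ?_ k hx
  · simp [contr_one]
  · intro k x y hx hy
    simp only [map_add, smul_add, hx, hy, mul_add, smul_sub]
    abel
  · intro k c x hx
    rw [map_smul, smul_comm, hx, map_smul, mul_smul_comm, smul_comm c, smul_sub, smul_comm m c]
  · intro k v _ x _ h
    have hg : ι (g v) = m • ι v - f v • ι e := by simp [g]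
    rw [map_mul, ExteriorAlgebra.map_apply_ι, ← mul_smul_comm, h, hg, contr_ι_mul]
    simp only [mul_smul_comm, mul_sub, sub_mul, smul_mul_assoc, smul_sub, ι_mul_self_mul, smul_zero,
      sub_zero, smul_smul]
    rw [ι_mul_ι_mul_comm v e]
    module

end Exterior

/-! ### Homological algebra -/

section CommutingFamily

variable {R A I : Type*} [CommRing R] [AddCommGroup A] [Module R A] {P : I → A →ₗ[R] A}

theorem apply_prod (comm : ∀ i j a, P i (P j a) = P j (P i a)) (l : List I) (i : I) (a : A) :
    P i ((l.map P).prod a) = (l.map P).prod (P i a) := by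
  induction l with
  | nil => simp
  | cons j l ih => simp only [List.map_cons, List.prod_cons, Module.End.mul_apply, comm i j, ih]

theorem prod_apply_eq_zero (comm : ∀ i j a, P i (P j a) = P j (P i a)) {l : List I} {i : I}
    (hi : i ∈ l) {a : A} (ha : P i a = 0) : (l.map P).prod a = 0 := by
  induction l with
  | nil => simp at hi
  | cons j l ih =>
    rw [List.map_cons, List.prod_cons, Module.End.mul_apply]
    rcases List.mem_cons.1 hi with rfl | hi
    · rw [apply_prod comm, ha, map_zero]
    · rw [ih hi, map_zero]

end CommutingFamily

section Cube

variable {R A I : Type*} [CommRing R] [AddCommGroup A] [Module R A] [Fintype I] [DecidableEq I]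
  {P : I → A →ₗ[R] A} {ε : Finset I → I → ℤ}

/-- The contracting homotopy in the direction `i`: it shows that a cocycle `a` of the cube complex
is cohomologous to `P i ∘ a`. -/
theorem cube_homotopy (idem : ∀ i a, P i (P i a) = P i a)
    (comm : ∀ i j a, P i (P j a) = P j (P i a))
    (hε : ∀ S j, j ∉ S → ε S j * ε S j = 1)
    (anti : ∀ S i j, i ∉ S → j ∉ S → i ≠ j →
      ε S i * ε (insert i S) j = -(ε S j * ε (insert j S) i))
    {k : ℕ} {a : Finset I → A} (ha : ∀ S, ∀ i ∈ S, P i (a S) = 0)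
    (hcl : ∀ S : Finset I, S.card + 1 = k → ∑ j ∈ Sᶜ, ε S j • a (insert j S) = 0) (i : I) :
    ∃ b : Finset I → A, (∀ S : Finset I, S.card ≠ k + 1 → b S = 0) ∧
      (∀ S, ∀ j ∈ S, P j (b S) = 0) ∧
      ∀ S : Finset I, S.card = k → ∑ j ∈ Sᶜ, ε S j • b (insert j S) = a S - P i (a S) := by
  refine ⟨fun T => if i ∈ T ∧ T.card = k + 1 then
    ε (T.erase i) i • (a (T.erase i) - P i (a (T.erase i))) else 0, ?_, ?_, ?_⟩
  · intro S hS
    exact if_neg fun h => hS h.2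
  · intro S j hj
    dsimp only
    split_ifs with h
    · rw [map_zsmul, map_sub]
      by_cases hij : j = i
      · subst hij
        rw [idem, sub_self, smul_zero]
      · rw [comm, ha _ j (Finset.mem_erase.2 ⟨hij, hj⟩), map_zero, sub_self, smul_zero]
    · rw [map_zero]
  · intro S hS
    by_cases hi : i ∈ S
    · -- `S = insert i U`, and the cocycle condition is used at `U`
      obtain ⟨U, hU, rfl⟩ : ∃ U, i ∉ U ∧ insert i U = S :=
        ⟨S.erase i, Finset.notMem_erase _ _, Finset.insert_erase hi⟩
      rw [Finset.card_insert_of_notMem hU] at hS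
      have h1 := hcl U hS
      have h2 : Uᶜ = insert i (insert i U)ᶜ := by
        ext x; simp only [Finset.mem_compl, Finset.mem_insert]; by_cases hx : x = i <;> simp [hx, hU]
      rw [h2, Finset.sum_insert (by simp), add_eq_zero_iff_eq_neg'] at h1
      have h3 : ∀ j ∈ (insert i U)ᶜ, (ε (insert i U) j •
          if i ∈ insert j (insert i U) ∧ (insert j (insert i U)).card = k + 1 then
            ε ((insert j (insert i U)).erase i) i •
              (a ((insert j (insert i U)).erase i) - P i (a ((insert j (insert i U)).erase i)))
          else 0) = -ε U i • (ε U j • a (insert j U) - P i (ε U j • a (insert j U))) := by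
        intro j hj
        rw [Finset.mem_compl, Finset.mem_insert, not_or] at hj
        have h4 : (insert j (insert i U)).erase i = insert j U := by
          rw [Finset.insert_comm, Finset.erase_insert]
          simp [hU, Ne.symm hj.1]
        rw [if_pos ⟨by simp, by
          rw [Finset.card_insert_of_notMem (by simp [hj]), Finset.card_insert_of_notMem hU, hS]⟩,
          h4, map_zsmul, ← smul_sub, smul_smul, smul_smul]
        congr 1
        have h5 := anti U i j hU hj.2 (Ne.symm hj.1)
        have h6 := hε U i hU
        have h7 := hε (insert j U) i (by simp [hU, Ne.symm hj.1])
        linear_combination (ε U i * ε (insert j U) i) * h5 - ε (insert i U) j * ε (insert j U) i * h6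
          - ε U i * ε U j * h7
      rw [Finset.sum_congr rfl h3, ← Finset.smul_sum, Finset.sum_sub_distrib, ← map_sum, h1,
        map_neg, map_zsmul, ha _ i hi, smul_zero, neg_zero, sub_zero, sub_zero, smul_neg, neg_smul,
        neg_neg, smul_smul, hε U i hU, one_smul]
    · dsimp only
      rw [Finset.sum_eq_single i]
      · rw [if_pos ⟨by simp, by rw [Finset.card_insert_of_notMem hi, hS]⟩,
          Finset.erase_insert hi, smul_smul, hε S i hi, one_smul]
      · intro j _ hj
        rw [if_neg, smul_zero]
        rintro ⟨h, -⟩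
        rcases Finset.mem_insert.1 h with h | h
        exacts [hj h.symm, hi h]
      · intro h
        exact absurd (Finset.mem_compl.2 hi) h

/-- Let `P i` be commuting idempotents of `A` and let `A_S` be the common kernel of the `P i`,
`i ∈ S`. The cube complex with terms `⨁_{|S| = k} A_S`, and with the signed inclusions
`A_{S ∪ j} → A_S` as differential, is exact, except at `S = ∅`, where a cochain is a coboundary as
soon as it is killed by the product of all the `P i`. -/
theorem cube_exact (idem : ∀ i a, P i (P i a) = P i a)
    (comm : ∀ i j a, P i (P j a) = P j (P i a))
    (hε : ∀ S j, j ∉ S → ε S j * ε S j = 1)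
    (anti : ∀ S i j, i ∉ S → j ∉ S → i ≠ j →
      ε S i * ε (insert i S) j = -(ε S j * ε (insert j S) i))
    {k : ℕ} {a : Finset I → A} (ha : ∀ S, ∀ i ∈ S, P i (a S) = 0)
    (hcl : ∀ S : Finset I, S.card + 1 = k → ∑ j ∈ Sᶜ, ε S j • a (insert j S) = 0)
    {l : List I} (hl : ∀ i, i ∈ l) (h0 : (l.map P).prod (a ∅) = 0) :
    ∃ b : Finset I → A, (∀ S : Finset I, S.card ≠ k + 1 → b S = 0) ∧
      (∀ S, ∀ j ∈ S, P j (b S) = 0) ∧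
      ∀ S : Finset I, S.card = k → ∑ j ∈ Sᶜ, ε S j • b (insert j S) = a S := by
  have key : ∀ l : List I, ∃ b : Finset I → A, (∀ S : Finset I, S.card ≠ k + 1 → b S = 0) ∧
      (∀ S, ∀ j ∈ S, P j (b S) = 0) ∧
      ∀ S : Finset I, S.card = k →
        ∑ j ∈ Sᶜ, ε S j • b (insert j S) = a S - (l.map P).prod (a S) := by
    intro l
    induction l with
    | nil => exact ⟨0, by simp, by simp, by simp⟩
    | cons i l ih =>
      obtain ⟨b, hb1, hb2, hb3⟩ := ih
      obtain ⟨c, hc1, hc2, hc3⟩ := cube_homotopy (k := k) (a := fun S => (l.map P).prod (a S))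
        idem comm hε anti (fun S i hi => by rw [apply_prod comm, ha S i hi, map_zero])
        (fun S hS => by
          have := congrArg (l.map P).prod (hcl S hS)
          simpa only [map_sum, map_zsmul, map_zero] using this) i
      refine ⟨b + c, fun S hS => ?_, fun S j hj => ?_, fun S hS => ?_⟩
      · rw [Pi.add_apply, hb1 S hS, hc1 S hS, add_zero]
      · rw [Pi.add_apply, map_add, hb2 S j hj, hc2 S j hj, add_zero]
      · simp only [Pi.add_apply, smul_add, Finset.sum_add_distrib]
        rw [hb3 S hS, hc3 S hS, List.map_cons, List.prod_cons, Module.End.mul_apply]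
        abel
  obtain ⟨b, hb1, hb2, hb3⟩ := key l
  refine ⟨b, hb1, hb2, fun S hS => ?_⟩
  rw [hb3 S hS]
  rcases S.eq_empty_or_nonempty with rfl | ⟨i, hi⟩
  · rw [h0, sub_zero]
  · rw [prod_apply_eq_zero comm (hl i) (ha S i hi), sub_zero]

end Cube

section QuasiIso

variable {R : Type*} [CommRing R] {C D : ℕ → Type*} [∀ q, AddCommGroup (C q)] [∀ q, Module R (C q)]
  [∀ q, AddCommGroup (D q)] [∀ q, Module R (D q)]
  {d : ∀ q, C q →ₗ[R] C (q + 1)} {d' : ∀ q, D q →ₗ[R] D (q + 1)}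

/-- A surjective map of cochain complexes, commuting with the differentials up to signs, is a
quasi-isomorphism if its kernel is exact. -/
theorem cohomology_equiv_of_surjective (φ : ∀ q, C q →ₗ[R] D q) (u : ℕ → ℤˣ)
    (hφ : ∀ q x, φ (q + 1) (d q x) = u q • d' q (φ q x))
    (hd : ∀ q, d (q + 1) ∘ₗ d q = 0)
    (surj : ∀ q, Function.Surjective (φ q))
    (exact_zero : ∀ x, d 0 x = 0 → φ 0 x = 0 → x = 0)
    (exact_succ : ∀ q x, d (q + 1) x = 0 → φ (q + 1) x = 0 → ∃ y, φ q y = 0 ∧ d q y = x) (q : ℕ) :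
    Nonempty (Cohomology d' q ≃ₗ[R] Cohomology d q) := by
  have hd' : ∀ q x, d (q + 1) (d q x) = 0 := fun q x => LinearMap.congr_fun (hd q) x
  have hker : ∀ x, d q x = 0 → d' q (φ q x) = 0 := fun x hx => by
    have := hφ q x
    rw [hx, map_zero] at this
    exact (smul_eq_zero_iff_eq (u q)).1 this.symm
  let f : LinearMap.ker (d q) →ₗ[R] LinearMap.ker (d' q) :=
    (φ q).restrict fun x hx => hker x hx
  let g : LinearMap.ker (d q) →ₗ[R] Cohomology d' q := (Submodule.mkQ _) ∘ₗ f
  have hg : Function.Surjective g := by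
    intro z
    obtain ⟨⟨z, hz⟩, rfl⟩ := Submodule.mkQ_surjective _ z
    obtain ⟨c, rfl⟩ := surj q z
    have h1 : φ (q + 1) (d q c) = 0 := by
      rw [hφ, LinearMap.mem_ker.1 hz, smul_zero]
    obtain ⟨k, hk, hkc⟩ := exact_succ q (d q c) (hd' q c) h1
    refine ⟨⟨c - k, by rw [LinearMap.mem_ker, map_sub, hkc, sub_self]⟩, ?_⟩
    have : f ⟨c - k, by rw [LinearMap.mem_ker, map_sub, hkc, sub_self]⟩ = ⟨φ q c, hz⟩ :=
      Subtype.ext (show φ q (c - k) = φ q c by rw [map_sub, hk, sub_zero])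
    rw [LinearMap.comp_apply, this]
  have hgker : LinearMap.ker g = (coboundaries d q).comap (LinearMap.ker (d q)).subtype := by
    ext ⟨x, hx⟩
    rw [LinearMap.mem_ker] at hx
    rw [LinearMap.mem_ker, LinearMap.comp_apply, Submodule.mkQ_apply, Submodule.Quotient.mk_eq_zero,
      Submodule.mem_comap, Submodule.mem_comap]
    change φ q x ∈ coboundaries d' q ↔ x ∈ coboundaries d q
    cases q with
    | zero =>
      simp only [coboundaries, Submodule.mem_bot]
      exact ⟨exact_zero x hx, fun h => by rw [h, map_zero]⟩
    | succ q =>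
      simp only [coboundaries, LinearMap.mem_range]
      constructor
      · rintro ⟨z, hz⟩
        obtain ⟨c, rfl⟩ := surj q z
        have h1 : φ (q + 1) (x - u q • d q c) = 0 := by
          rw [map_sub, Units.smul_def, map_zsmul, hφ, ← Units.smul_def, smul_smul,
            ← hz, ← sq, Int.units_sq, one_smul, sub_self]
        have h2 : d (q + 1) (x - u q • d q c) = 0 := by
          rw [map_sub, Units.smul_def, map_zsmul, hd', hx, smul_zero, sub_zero]
        obtain ⟨k, -, hk⟩ := exact_succ q _ h2 h1
        refine ⟨k + u q • c, ?_⟩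
        rw [map_add, hk, Units.smul_def, Units.smul_def, map_zsmul, sub_add_cancel]
      · rintro ⟨c, rfl⟩
        exact ⟨u q • φ q c, by rw [Units.smul_def, map_zsmul, ← Units.smul_def, ← hφ]⟩
  exact ⟨((Submodule.quotEquivOfEq _ _ hgker.symm).trans
    (g.quotKerEquivOfSurjective hg)).symm⟩

end QuasiIso

/-! ### Simplicial cones and their faces -/

section Frame

variable {N : Type*} [AddCommGroup N]

/-- The extension to `N_ℝ` of an integral linear form on `N`. -/
def realForm (f : N →ₗ[ℤ] ℤ) : (ℝ ⊗[ℤ] N) →ₗ[ℝ] ℝ :=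
  (TensorProduct.AlgebraTensorModule.rid ℤ ℝ ℝ).toLinearMap ∘ₗ f.baseChange ℝ

theorem realForm_tmul (f : N →ₗ[ℤ] ℤ) (n : N) : realForm f ((1 : ℝ) ⊗ₜ[ℤ] n) = f n := by
  simp [realForm]

/-- A frame of a simplicial cone `σ`: lattice vectors `e i` generating its rays, together with
integral linear forms `f i` dual to them up to a common positive multiple `m`. -/
structure Frame (σ : Cone N) where
  n : ℕ
  e : Fin n → N
  f : Fin n → N →ₗ[ℤ] ℤ
  m : ℤ
  m_pos : 0 < m
  f_e : ∀ i j, f i (e j) = if i = j then m else 0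
  hull_eq : σ = PointedCone.hull ℝ (Set.range fun i => (1 : ℝ) ⊗ₜ[ℤ] e i)

namespace Frame

variable {σ : Cone N} (F : Frame σ)

/-- The face of a simplicial cone generated by a set of its rays. -/
def face (S : Finset (Fin F.n)) : Cone N :=
  PointedCone.hull ℝ ((fun i => (1 : ℝ) ⊗ₜ[ℤ] F.e i) '' (S : Set (Fin F.n)))

theorem face_univ : F.face Finset.univ = σ := by
  conv_rhs => rw [F.hull_eq]
  rw [face, Finset.coe_univ, Set.image_univ]

theorem realForm_sum (a : Fin F.n → ℝ) (i : Fin F.n) :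
    realForm (F.f i) (∑ j, a j • ((1 : ℝ) ⊗ₜ[ℤ] F.e j)) = F.m * a i := by
  simp [map_sum, realForm_tmul, F.f_e, mul_comm]

theorem mem_face {S : Finset (Fin F.n)} {x : ℝ ⊗[ℤ] N} : x ∈ F.face S ↔
    ∃ a : Fin F.n → ℝ, (∀ i, 0 ≤ a i) ∧ (∀ i ∉ S, a i = 0) ∧
      x = ∑ i, a i • ((1 : ℝ) ⊗ₜ[ℤ] F.e i) := by
  constructor
  · intro hx
    induction hx using Submodule.span_induction with
    | mem x hx =>
      obtain ⟨i, hi, rfl⟩ := hx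
      refine ⟨Pi.single i 1, fun j => ?_, fun j hj => ?_, ?_⟩
      · by_cases h : j = i
        · subst h; simp
        · simp [h]
      · rw [Pi.single_eq_of_ne]
        rintro rfl
        exact hj hi
      · rw [Finset.sum_eq_single i (fun j _ hj => by simp [hj]) (by simp)]
        simp
    | zero => exact ⟨0, by simp, by simp, by simp⟩
    | add x y _ _ hx hy =>
      obtain ⟨a, ha, ha', rfl⟩ := hx
      obtain ⟨b, hb, hb', rfl⟩ := hy
      refine ⟨a + b, fun i => add_nonneg (ha i) (hb i), fun i hi => ?_, ?_⟩
      · simp [ha' i hi, hb' i hi]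
      · simp [add_smul, Finset.sum_add_distrib]
    | smul c x _ hx =>
      obtain ⟨a, ha, ha', rfl⟩ := hx
      refine ⟨fun i => c.1 * a i, fun i => mul_nonneg c.2 (ha i), fun i hi => ?_, ?_⟩
      · simp [ha' i hi]
      · simp only [mul_smul, ← Finset.smul_sum]
        rfl
  · rintro ⟨a, ha, ha', rfl⟩
    refine sum_mem fun i _ => ?_
    by_cases hi : i ∈ S
    · exact PointedCone.smul_mem _ (ha i) (PointedCone.subset_hull ⟨i, hi, rfl⟩)
    · rw [ha' i hi, zero_smul]
      exact zero_mem _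

theorem mem_cone {x : ℝ ⊗[ℤ] N} : x ∈ σ ↔
    ∃ a : Fin F.n → ℝ, (∀ i, 0 ≤ a i) ∧ x = ∑ i, a i • ((1 : ℝ) ⊗ₜ[ℤ] F.e i) := by
  conv_lhs => rw [← F.face_univ]
  rw [mem_face]
  simp

theorem e_mem_face {S : Finset (Fin F.n)} {i : Fin F.n} (hi : i ∈ S) :
    (1 : ℝ) ⊗ₜ[ℤ] F.e i ∈ F.face S := PointedCone.subset_hull ⟨i, hi, rfl⟩

theorem span_face (S : Finset (Fin F.n)) :
    Submodule.span ℝ (F.face S : Set (ℝ ⊗[ℤ] N)) =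
      Submodule.span ℝ ((fun i => (1 : ℝ) ⊗ₜ[ℤ] F.e i) '' (S : Set (Fin F.n))) := by
  refine le_antisymm (Submodule.span_le.2 ?_) (Submodule.span_mono PointedCone.subset_hull)
  exact fun x hx => PointedCone.hull_le_span (R := ℝ) _ hx

theorem mem_span_face {S : Finset (Fin F.n)} {x : ℝ ⊗[ℤ] N} :
    x ∈ Submodule.span ℝ (F.face S : Set (ℝ ⊗[ℤ] N)) ↔
    ∃ a : Fin F.n → ℝ, (∀ i ∉ S, a i = 0) ∧ x = ∑ i, a i • ((1 : ℝ) ⊗ₜ[ℤ] F.e i) := by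
  constructor
  · intro hx
    induction hx using Submodule.span_induction with
    | mem x hx =>
      obtain ⟨a, -, ha, hax⟩ := F.mem_face.1 hx
      exact ⟨a, ha, hax⟩
    | zero => exact ⟨0, by simp, by simp⟩
    | add x y _ _ hx hy =>
      obtain ⟨a, ha', rfl⟩ := hx
      obtain ⟨b, hb', rfl⟩ := hy
      refine ⟨a + b, fun i hi => ?_, ?_⟩
      · simp [ha' i hi, hb' i hi]
      · simp [add_smul, Finset.sum_add_distrib]
    | smul c x _ hx =>
      obtain ⟨a, ha', rfl⟩ := hx
      refine ⟨fun i => c * a i, fun i hi => ?_, ?_⟩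
      · simp [ha' i hi]
      · simp only [mul_smul, ← Finset.smul_sum]
  · rintro ⟨a, ha', rfl⟩
    refine sum_mem fun i _ => ?_
    by_cases hi : i ∈ S
    · exact Submodule.smul_mem _ _ (Submodule.subset_span (F.e_mem_face hi))
    · rw [ha' i hi, zero_smul]
      exact zero_mem _

theorem linearIndependent : LinearIndependent ℝ fun i => (1 : ℝ) ⊗ₜ[ℤ] F.e i := by
  rw [Fintype.linearIndependent_iff]
  intro a ha i
  have := F.realForm_sum a i
  rw [ha, map_zero] at this
  have hm : (F.m : ℝ) ≠ 0 := by exact_mod_cast F.m_pos.ne'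
  exact (mul_eq_zero.1 this.symm).resolve_left hm

theorem coneDim_face (S : Finset (Fin F.n)) : coneDim (F.face S) = S.card := by
  rw [coneDim, span_face, Set.image_eq_range]
  have := finrank_span_eq_card (R := ℝ)
    (F.linearIndependent.comp (fun i : S => (i : Fin F.n)) Subtype.val_injective)
  rw [Fintype.card_coe] at this
  exact this

theorem face_le_face {S T : Finset (Fin F.n)} : F.face S ≤ F.face T ↔ S ⊆ T := by
  constructor
  · intro h i hi
    by_contra hiT
    obtain ⟨a, -, ha, hx⟩ := F.mem_face.1 (h (F.e_mem_face hi))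
    have h1 := congrArg (realForm (F.f i)) hx
    rw [realForm_sum, ha i hiT, mul_zero, realForm_tmul, F.f_e, if_pos rfl] at h1
    exact F.m_pos.ne' (by exact_mod_cast h1)
  · intro h
    exact Submodule.span_mono (Set.image_mono (by exact_mod_cast h))

theorem face_injective : Function.Injective F.face := fun _ _ h =>
  Finset.Subset.antisymm (F.face_le_face.1 h.le) (F.face_le_face.1 h.ge)

theorem face_le (S : Finset (Fin F.n)) : F.face S ≤ σ := by
  conv_rhs => rw [← F.face_univ]
  exact F.face_le_face.2 (Finset.subset_univ _)

theorem coneDim_eq : coneDim σ = F.n := by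
  conv_lhs => rw [← F.face_univ]
  rw [coneDim_face, Finset.card_univ, Fintype.card_fin]

theorem face_isFaceOf (S : Finset (Fin F.n)) : (F.face S).IsFaceOf σ := by
  refine ⟨F.face_le S, ?_⟩
  intro x y c hx hy hc h
  obtain ⟨a, ha, rfl⟩ := F.mem_cone.1 hx
  obtain ⟨b, hb, rfl⟩ := F.mem_cone.1 hy
  obtain ⟨d, -, hd', hd⟩ := F.mem_face.1 h
  refine F.mem_face.2 ⟨a, ha, fun i hi => ?_, rfl⟩
  have h1 := congrArg (realForm (F.f i)) hd
  have hm : (0 : ℝ) < F.m := by exact_mod_cast F.m_pos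
  rw [map_add, map_smul, realForm_sum, realForm_sum, realForm_sum, hd' i hi, smul_eq_mul] at h1
  have h2 : c * a i + b i = 0 := by
    have : (F.m : ℝ) * (c * a i + b i) = 0 := by linear_combination h1
    exact (mul_eq_zero.1 this).resolve_left hm.ne'
  have h3 : c * a i = 0 := by
    linarith [mul_nonneg hc.le (ha i), hb i]
  exact (mul_eq_zero.1 h3).resolve_left hc.ne'

/-- A face is generated by the ray generators it contains: if a combination of these generators with
nonnegative coefficients lies in it, so do the generators with positive coefficient. -/
theorem exists_face_eq {τ : Cone N} (h : τ.IsFaceOf σ) : ∃ S, F.face S = τ := by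
  classical
  refine ⟨Finset.univ.filter fun i => (1 : ℝ) ⊗ₜ[ℤ] F.e i ∈ τ, le_antisymm ?_ ?_⟩
  · refine Submodule.span_le.2 ?_
    rintro _ ⟨i, hi, rfl⟩
    exact (Finset.mem_filter.1 hi).2
  · intro x hx
    obtain ⟨a, ha, rfl⟩ := F.mem_cone.1 (h.le hx)
    refine F.mem_face.2 ⟨a, ha, fun i hi => ?_, rfl⟩
    by_contra hne
    refine hi (Finset.mem_filter.2 ⟨Finset.mem_univ _, ?_⟩)
    rw [← Finset.add_sum_erase _ _ (Finset.mem_univ i)] at hx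
    refine h.mem_of_smul_add_mem (F.mem_cone.2 ⟨Pi.single i 1, fun j => ?_, ?_⟩)
      (F.mem_cone.2 ⟨Function.update a i 0, fun j => ?_, ?_⟩)
      (lt_of_le_of_ne (ha i) (Ne.symm hne)) hx
    · by_cases h : j = i
      · subst h; simp
      · simp [h]
    · rw [Finset.sum_eq_single i (fun j _ hj => by simp [hj]) (by simp)]
      simp
    · by_cases h : j = i
      · subst h; simp
      · simpa [h] using ha j
    · rw [← Finset.add_sum_erase _ _ (Finset.mem_univ i), Function.update_self, zero_smul, zero_add]
      refine Finset.sum_congr rfl fun j hj => ?_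
      rw [Function.update_of_ne (Finset.ne_of_mem_erase hj)]

theorem e_mem_coneLattice {S : Finset (Fin F.n)} {i : Fin F.n} (hi : i ∈ S) :
    F.e i ∈ coneLattice (F.face S) :=
  Submodule.subset_span (F.e_mem_face hi)

theorem f_eq_zero_of_mem {S : Finset (Fin F.n)} {i : Fin F.n} (hi : i ∉ S) {v : N}
    (hv : v ∈ coneLattice (F.face S)) : F.f i v = 0 := by
  obtain ⟨a, ha, hx⟩ := F.mem_span_face.1 (mem_coneLattice.1 hv)
  have h1 := congrArg (realForm (F.f i)) hx
  rw [realForm_sum, ha i hi, mul_zero, realForm_tmul] at h1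
  exact_mod_cast h1

/-- Up to the factor `m`, lattice vectors of a face are integral combinations of its ray
generators. -/
theorem tmul_smul_sub_sum {S : Finset (Fin F.n)} {v : N} (hv : v ∈ coneLattice (F.face S)) :
    (1 : ℝ) ⊗ₜ[ℤ] (F.m • v - ∑ i ∈ S, F.f i v • F.e i) = 0 := by
  obtain ⟨a, ha, hx⟩ := F.mem_span_face.1 (mem_coneLattice.1 hv)
  have h1 : ∀ i, (F.f i v : ℝ) = F.m * a i := fun i => by
    rw [← realForm_tmul, hx, realForm_sum]
  rw [TensorProduct.tmul_sub, TensorProduct.tmul_smul, hx, TensorProduct.tmul_sum, sub_eq_zero,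
    Finset.smul_sum, ← Finset.sum_subset (Finset.subset_univ S)]
  · refine Finset.sum_congr rfl fun i _ => ?_
    rw [TensorProduct.tmul_smul, ← Int.cast_smul_eq_zsmul ℝ, ← Int.cast_smul_eq_zsmul ℝ,
      smul_smul, h1]
  · intro i _ hi
    rw [ha i hi, zero_smul, smul_zero]

end Frame

end Frame

/-! ### Unit normal vectors in a simplicial fan -/

section Normal

variable {N : Type*} [AddCommGroup N]

/-- The unit normal vectors in the square of cones `τ ⊂ η₁, η₂ ⊂ σ` are related, modulo `N_τ`, by an
integral matrix of determinant `-1`. -/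
def NormalRel (τ η₁ η₂ σ : Cone N) : Prop :=
  ∃ x y z w : ℤ, x * w - y * z = -1 ∧
    unitNormal τ η₂ - (x • unitNormal τ η₁ + y • unitNormal η₁ σ) ∈ coneLattice τ ∧
    unitNormal η₂ σ - (z • unitNormal τ η₁ + w • unitNormal η₁ σ) ∈ coneLattice τ

variable {Δ : RationalFan N}

theorem isFaceOf_of_le {τ σ : Cone N} (hτ : τ ∈ Δ.cones) (hσ : σ ∈ Δ.cones) (h : τ ≤ σ) :
    τ.IsFaceOf σ := by
  have := Δ.inter_isFaceOf σ hσ τ hτ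
  rwa [inf_eq_right.2 h] at this

namespace Frame

variable {σ : Cone N} (F : Frame σ)

theorem face_mem (hσ : σ ∈ Δ.cones) (S : Finset (Fin F.n)) : F.face S ∈ Δ.cones :=
  Δ.face_mem σ hσ _ (F.face_isFaceOf S)

theorem exists_face_eq_of_le (hσ : σ ∈ Δ.cones) {τ : Cone N} (hτ : τ ∈ Δ.cones) (h : τ ≤ σ) :
    ∃ S, F.face S = τ :=
  F.exists_face_eq (isFaceOf_of_le hτ hσ h)

end Frame

variable [Module.Free ℤ N] [Module.Finite ℤ N]

theorem isUnitNormal_unitNormal {τ σ : Cone N} (hτ : τ ∈ Δ.cones)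
    (hσ : σ ∈ Δ.cones) (h : τ ≤ σ) (hd : coneDim σ = coneDim τ + 1) :
    IsUnitNormal τ σ (unitNormal τ σ) := by
  have hv := exists_isUnitNormal Δ τ σ hτ hσ h hd
  rw [unitNormal, dif_pos hv]
  exact hv.choose_spec

namespace Frame

variable {σ : Cone N} (F : Frame σ)

theorem isUnitNormal_face (hσ : σ ∈ Δ.cones) {S T : Finset (Fin F.n)} {i : Fin F.n} (hi : i ∉ S)
    (hT : T = insert i S) :
    IsUnitNormal (F.face S) (F.face T) (unitNormal (F.face S) (F.face T)) := by
  subst hT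
  refine isUnitNormal_unitNormal (F.face_mem hσ _) (F.face_mem hσ _)
    (F.face_le_face.2 (Finset.subset_insert _ _)) ?_
  rw [coneDim_face, coneDim_face, Finset.card_insert_of_notMem hi]

/-- The unit normal vector pointing in the direction of the ray `i` has positive `i`-th
coordinate. -/
theorem f_unitNormal_pos (hσ : σ ∈ Δ.cones) {S T : Finset (Fin F.n)} {i : Fin F.n} (hi : i ∉ S)
    (hT : T = insert i S) : 0 < F.f i (unitNormal (F.face S) (F.face T)) := by
  obtain ⟨h1, x, hx, y, hy, hxy⟩ := F.isUnitNormal_face hσ hi hT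
  set v := unitNormal (F.face S) (F.face T)
  refine lt_of_le_of_ne ?_ ?_
  · obtain ⟨a, ha, -, rfl⟩ := F.mem_face.1 hx
    obtain ⟨b, hb, rfl⟩ := F.mem_span_face.1 hy
    have h2 := congrArg (realForm (F.f i)) hxy
    rw [map_add, realForm_sum, realForm_sum, realForm_tmul, hb i hi, mul_zero, add_zero] at h2
    have h3 : (0 : ℝ) ≤ F.f i v := by
      rw [h2]
      exact mul_nonneg (by exact_mod_cast F.m_pos.le) (ha i)
    exact_mod_cast h3
  · intro h0
    have h2 : F.e i ∈ coneLattice (F.face T) := F.e_mem_coneLattice (by simp [hT])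
    rw [← h1, Submodule.mem_sup] at h2
    obtain ⟨y, hy, z, hz, hyz⟩ := h2
    obtain ⟨c, rfl⟩ := Submodule.mem_span_singleton.1 hz
    have h3 := congrArg (F.f i) hyz
    rw [map_add, map_smul, F.f_eq_zero_of_mem hi hy, ← h0, F.f_e, if_pos rfl] at h3
    simp only [smul_zero, add_zero] at h3
    exact F.m_pos.ne h3

/-- In a simplicial fan the two ways around a square of cones have opposite orientations. -/
theorem normalRel (hσ : σ ∈ Δ.cones) {S : Finset (Fin F.n)} {i j : Fin F.n} (hi : i ∉ S)
    (hj : j ∉ S) (hij : i ≠ j) :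
    NormalRel (F.face S) (F.face (insert i S)) (F.face (insert j S))
      (F.face (insert j (insert i S))) := by
  have hji : j ∉ insert i S := by simp [hj, hij.symm]
  have hij' : i ∉ insert j S := by simp [hi, hij]
  have hT : insert j (insert i S) = insert i (insert j S) := Finset.insert_comm _ _ _
  set T := insert j (insert i S)
  have key : ∀ {i j : Fin F.n}, i ∉ S → j ∉ insert i S → T = insert j (insert i S) →
      ∀ v ∈ coneLattice (F.face T), ∃ x y : ℤ,
        v - (x • unitNormal (F.face S) (F.face (insert i S)) +
          y • unitNormal (F.face (insert i S)) (F.face T)) ∈ coneLattice (F.face S) := by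
    intro i j hi hj hT v hv
    rw [← (F.isUnitNormal_face hσ hj hT).1, ← (F.isUnitNormal_face hσ hi rfl).1,
      Submodule.mem_sup] at hv
    obtain ⟨a, ha, b, hb, rfl⟩ := hv
    obtain ⟨t, ht, c, hc, rfl⟩ := Submodule.mem_sup.1 ha
    obtain ⟨y, rfl⟩ := Submodule.mem_span_singleton.1 hb
    obtain ⟨x, rfl⟩ := Submodule.mem_span_singleton.1 hc
    refine ⟨x, y, ?_⟩
    convert ht using 1
    abel
  have hle : ∀ {i}, insert i S ⊆ T → coneLattice (F.face (insert i S)) ≤ coneLattice (F.face T) :=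
    fun h => coneLattice_mono (F.face_le_face.2 h)
  have hiT : insert i S ⊆ T := Finset.subset_insert _ _
  have hjT : insert j S ⊆ T := hT ▸ Finset.subset_insert _ _
  have m1 := hle hiT (unitNormal_mem (F.face S) (F.face (insert i S)))
  have m2 := hle hjT (unitNormal_mem (F.face S) (F.face (insert j S)))
  have m3 := unitNormal_mem (F.face (insert i S)) (F.face T)
  have m4 := unitNormal_mem (F.face (insert j S)) (F.face T)
  have p1 := F.f_unitNormal_pos hσ hi (T := insert i S) rfl
  have p2 := F.f_unitNormal_pos hσ hj (T := insert j S) rfl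
  have p3 := F.f_unitNormal_pos hσ hji (T := T) rfl
  have p4 := F.f_unitNormal_pos hσ hij' hT
  have z1 := F.f_eq_zero_of_mem hji (unitNormal_mem (F.face S) (F.face (insert i S)))
  have z2 := F.f_eq_zero_of_mem hij' (unitNormal_mem (F.face S) (F.face (insert j S)))
  obtain ⟨x, y, h1⟩ := key hi hji rfl _ m2
  obtain ⟨z, w, h2⟩ := key hi hji rfl _ m4
  obtain ⟨x', y', h3⟩ := key hj hij' hT _ m1
  obtain ⟨z', w', h4⟩ := key hj hij' hT _ m3
  refine ⟨x, y, z, w, ?_, h1, h2⟩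
  have e1 := F.f_eq_zero_of_mem hi h1
  have e1' := F.f_eq_zero_of_mem hj h1
  have e2 := F.f_eq_zero_of_mem hi h2
  have e2' := F.f_eq_zero_of_mem hj h2
  have e3 := F.f_eq_zero_of_mem hi h3
  have e3' := F.f_eq_zero_of_mem hj h3
  have e4 := F.f_eq_zero_of_mem hi h4
  have e4' := F.f_eq_zero_of_mem hj h4
  simp only [map_sub, map_add, map_smul, smul_eq_mul, z1, z2] at e1 e1' e2 e2' e3 e3' e4 e4'
  clear h1 h2 h3 h4 m1 m2 m3 m4 key hle z1 z2
  generalize F.f i (unitNormal (F.face S) (F.face (insert i S))) = a at *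
  generalize F.f j (unitNormal (F.face S) (F.face (insert j S))) = b at *
  generalize F.f j (unitNormal (F.face (insert i S)) (F.face T)) = c at *
  generalize F.f i (unitNormal (F.face (insert j S)) (F.face T)) = d at *
  generalize F.f i (unitNormal (F.face (insert i S)) (F.face T)) = r at *
  generalize F.f j (unitNormal (F.face (insert j S)) (F.face T)) = s at *
  -- determinants of the two pairs of normal vectors in the coordinates `(f i, f j)`
  have d1 : (x * w - y * z) * (a * c) = -(b * d) := by
    linear_combination d * e1' - w * c * e1 + y * c * e2
  have d2 : (x' * w' - y' * z') * (b * d) = -(a * c) := by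
    linear_combination c * e3 + y' * d * e4' - w' * d * e3'
  have hac := mul_pos p1 p3
  have hbd := mul_pos p2 p4
  have hD : (x * w - y * z) * (x' * w' - y' * z') = 1 := by
    have : ((x * w - y * z) * (x' * w' - y' * z') - 1) * (a * c) = 0 := by
      linear_combination (x' * w' - y' * z') * d1 - d2
    have := (mul_eq_zero.1 this).resolve_right hac.ne'
    linarith
  rcases Int.mul_eq_one_iff_eq_one_or_neg_one.1 hD with ⟨h, -⟩ | ⟨h, -⟩
  · rw [h] at d1
    linarith
  · exact h

end Frame

end Normal

/-! ### Frames of unimodular and of simplicial cones -/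

section Existence

theorem exists_dual_family {K V I : Type*} [Field K] [AddCommGroup V] [Module K V] [DecidableEq I]
    {v : I → V} (hv : LinearIndependent K v) :
    ∃ g : I → V →ₗ[K] K, ∀ i j, g i (v j) = if i = j then 1 else 0 := by
  obtain ⟨g, hg⟩ := LinearMap.exists_leftInverse_of_injective (Finsupp.linearCombination K v)
    (LinearMap.ker_eq_bot.2 hv)
  refine ⟨fun i => Finsupp.lapply i ∘ₗ g, fun i j => ?_⟩
  have := LinearMap.congr_fun hg (Finsupp.single j 1)
  rw [LinearMap.comp_apply, Finsupp.linearCombination_single, one_smul] at this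
  rw [LinearMap.comp_apply, this, LinearMap.id_apply, Finsupp.lapply_apply, Finsupp.single_apply]
  simp only [eq_comm]

variable {N : Type*} [AddCommGroup N]

theorem exists_frame_of_basis {n : ℕ} (b : Module.Basis (Fin n) ℤ N) (s : Finset (Fin n)) :
    ∃ F : Frame (PointedCone.hull ℝ ((fun i => (1 : ℝ) ⊗ₜ[ℤ] b i) '' (s : Set (Fin n)))),
      F.m = 1 := by
  refine ⟨{
    n := s.card
    e := fun i => b (s.orderEmbOfFin rfl i)
    f := fun i => b.coord (s.orderEmbOfFin rfl i)
    m := 1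
    m_pos := one_pos
    f_e := fun i j => ?_
    hull_eq := ?_ }, rfl⟩
  · rw [Module.Basis.coord_apply, Module.Basis.repr_self, Finsupp.single_apply]
    simp [eq_comm]
  · rw [← Finset.range_orderEmbOfFin s rfl, ← Set.range_comp]
    rfl

/-- Integral vectors that are linearly independent admit integral dual forms, up to a common
multiple. -/
theorem exists_integral_dual_family [Module.Free ℤ N] [Module.Finite ℤ N] {I : Type*} [Fintype I]
    [DecidableEq I] {e : I → N} (he : LinearIndependent ℤ e) :
    ∃ (m : ℤ) (f : I → N →ₗ[ℤ] ℤ), 0 < m ∧ ∀ i j, f i (e j) = if i = j then m else 0 := by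
  let b := Module.Free.chooseBasis ℤ N
  let φ : N →ₗ[ℤ] (Module.Free.ChooseBasisIndex ℤ N → ℚ) :=
    LinearMap.pi fun k => (Algebra.linearMap ℤ ℚ) ∘ₗ b.coord k
  have hφ : LinearMap.ker φ = ⊥ := by
    rw [LinearMap.ker_eq_bot']
    intro x hx
    refine b.repr.map_eq_zero_iff.1 (Finsupp.ext fun k => ?_)
    have := congrFun hx k
    simpa [φ] using this
  have h1 : LinearIndependent ℚ (φ ∘ e) :=
    (LinearIndependent.iff_fractionRing ℤ ℚ).1 (he.map' φ hφ)
  obtain ⟨g, hg⟩ := exists_dual_family h1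
  obtain ⟨m, hm⟩ := IsLocalization.exist_integer_multiples_of_finite (nonZeroDivisors ℤ)
    (fun p : I × Module.Free.ChooseBasisIndex ℤ N => g p.1 (φ (b p.2)))
  choose z hz using hm
  let f : I → N →ₗ[ℤ] ℤ := fun i => b.constr ℤ fun k => z (i, k)
  have hf : ∀ i n, (f i n : ℚ) = m.1 * g i (φ n) := by
    intro i n
    have : (Algebra.linearMap ℤ ℚ) ∘ₗ f i = m.1 • ((g i).restrictScalars ℤ ∘ₗ φ) := by
      refine b.ext fun k => ?_
      have := hz (i, k)
      simp only [f, LinearMap.comp_apply, Module.Basis.constr_basis, LinearMap.smul_apply]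
      exact this
    have := LinearMap.congr_fun this n
    simpa using this
  have hm0 : m.1 ≠ 0 := nonZeroDivisors.ne_zero m.2
  refine ⟨m.1 * m.1, fun i => m.1 • f i, mul_self_pos.2 hm0, fun i j => ?_⟩
  have h2 : (f i (e j) : ℚ) = if i = j then m.1 else 0 := by
    rw [hf]
    have := hg i j
    rw [Function.comp_apply] at this
    rw [this]
    simp
  have h3 : f i (e j) = if i = j then m.1 else 0 := by
    split_ifs at h2 ⊢ <;> exact_mod_cast h2
  rw [LinearMap.smul_apply, h3]
  simp

theorem linearIndependent_of_tmul {I : Type*} {e : I → N}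
    (he : LinearIndependent ℝ fun i => (1 : ℝ) ⊗ₜ[ℤ] e i) : LinearIndependent ℤ e := by
  have h1 : LinearIndependent ℤ fun i => (1 : ℝ) ⊗ₜ[ℤ] e i :=
    he.restrict_scalars (by
      intro a b h
      simpa using h)
  exact LinearIndependent.of_comp (TensorProduct.mk ℤ ℝ N 1) h1

/-- The rays of a rational simplicial cone contain lattice vectors. -/
theorem exists_lattice_generator {s : Set (ℝ ⊗[ℤ] N)} (hs : LinearIndepOn ℝ id s) {t : Finset N}
    (hst : PointedCone.hull ℝ s =
      PointedCone.hull ℝ ((fun n : N => (1 : ℝ) ⊗ₜ[ℤ] n) '' (t : Set N))) (v : s) :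
    ∃ (n : N) (c : ℝ), 0 < c ∧ (1 : ℝ) ⊗ₜ[ℤ] n = c • (v : ℝ ⊗[ℤ] N) := by
  classical
  obtain ⟨g, hg⟩ := exists_dual_family (v := fun x : s => (x : ℝ ⊗[ℤ] N)) hs
  -- the dual forms are nonnegative on the cone, and recover its elements
  have hnn : ∀ x ∈ PointedCone.hull ℝ s, ∀ w, 0 ≤ g w x := by
    intro x hx w
    induction hx using Submodule.span_induction with
    | mem x hx => rw [hg w ⟨x, hx⟩]; split_ifs <;> simp
    | zero => simp
    | add x y _ _ hx hy => rw [map_add]; exact add_nonneg hx hy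
    | smul c x _ hx =>
      have : g w (c • x) = c.1 * g w x := (g w).map_smul c.1 x
      rw [this]; exact mul_nonneg c.2 hx
  have hrec : ∀ x ∈ PointedCone.hull ℝ s, (∀ w ≠ v, g w x = 0) → x = g v x • (v : ℝ ⊗[ℤ] N) := by
    intro x hx h
    have hx' : x ∈ Submodule.span ℝ s := PointedCone.hull_le_span (R := ℝ) _ hx
    have hx2 : x ∈ Submodule.span ℝ (Set.range fun x : s => (x : ℝ ⊗[ℤ] N)) := by
      simpa using hx'
    obtain ⟨a, rfl⟩ := (Finsupp.mem_span_range_iff_exists_finsupp).1 hx2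
    have ha : ∀ w, g w (a.sum fun i c => c • (i : ℝ ⊗[ℤ] N)) = a w := by
      intro w
      rw [Finsupp.sum, map_sum]
      simp_rw [map_smul, hg]
      simp only [smul_eq_mul, mul_ite, mul_one, mul_zero, Finset.sum_ite_eq, Finsupp.mem_support_iff]
      split_ifs with h
      · rfl
      · exact (not_not.1 h).symm
    simp only [ha] at h ⊢
    rw [Finsupp.sum, Finset.sum_eq_single v]
    · intro w _ hw
      rw [h w hw, zero_smul]
    · intro hv
      rw [Finsupp.notMem_support_iff.1 hv, zero_smul]
  have hv : (v : ℝ ⊗[ℤ] N) ∈ PointedCone.hull ℝ ((fun n : N => (1 : ℝ) ⊗ₜ[ℤ] n) '' (t : Set N)) := by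
    rw [← hst]; exact PointedCone.subset_hull v.2
  rw [PointedCone.hull, Submodule.mem_span_image_finset_iff_exists_fun] at hv
  obtain ⟨c, hc⟩ := hv
  have ht : ∀ n : t, (1 : ℝ) ⊗ₜ[ℤ] (n : N) ∈ PointedCone.hull ℝ s := by
    intro n
    rw [hst]; exact PointedCone.subset_hull ⟨n, n.2, rfl⟩
  have hgc : ∀ w, ∑ n : t, (c n).1 * g w ((1 : ℝ) ⊗ₜ[ℤ] (n : N)) = if w = v then 1 else 0 := by
    intro w
    rw [← hg, ← hc, map_sum]
    exact Finset.sum_congr rfl fun n _ => ((g w).map_smul (c n).1 _).symm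
  obtain ⟨n, -, hne⟩ : ∃ n ∈ Finset.univ, (c n).1 * g v ((1 : ℝ) ⊗ₜ[ℤ] (n : N)) ≠ 0 := by
    refine Finset.exists_ne_zero_of_sum_ne_zero ?_
    rw [hgc, if_pos rfl]
    exact one_ne_zero
  refine ⟨n, g v ((1 : ℝ) ⊗ₜ[ℤ] (n : N)), lt_of_le_of_ne (hnn _ (ht n) v)
    (right_ne_zero_of_mul hne).symm, hrec _ (ht n) fun w hw => ?_⟩
  have h1 := hgc w
  rw [if_neg hw, Finset.sum_eq_zero_iff_of_nonneg
    fun n _ => mul_nonneg (c n).2 (hnn _ (ht n) w)] at h1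
  exact (mul_eq_zero.1 (h1 n (Finset.mem_univ n))).resolve_left (left_ne_zero_of_mul hne)

theorem exists_frame_of_isSimplicial [Module.Free ℤ N] [Module.Finite ℤ N] {Δ : RationalFan N}
    {σ : Cone N} (hσ : σ ∈ Δ.cones) (h : PointedCone.IsSimplicial σ) : Nonempty (Frame σ) := by
  obtain ⟨s, hfin, hs, rfl⟩ := h
  obtain ⟨t, ht⟩ := Δ.rational _ hσ
  choose e c hc he using exists_lattice_generator hs ht
  have := hfin.fintype
  let ψ := (Fintype.equivFin s).symm
  have hli : LinearIndependent ℝ fun i => (1 : ℝ) ⊗ₜ[ℤ] e i := by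
    have := LinearIndependent.units_smul (v := fun x : s => (x : ℝ ⊗[ℤ] N)) hs
      (fun i => Units.mk0 (c i) (hc i).ne')
    convert this using 1
    ext i
    exact he i
  obtain ⟨m, f, hm, hf⟩ := exists_integral_dual_family
    (linearIndependent_of_tmul (hli.comp ψ ψ.injective))
  refine ⟨{
    n := Fintype.card s
    e := fun i => e (ψ i)
    f := f
    m := m
    m_pos := hm
    f_e := hf
    hull_eq := le_antisymm ?_ ?_ }⟩
  · refine Submodule.span_le.2 fun x hx => ?_
    have h1 : x = (c ⟨x, hx⟩)⁻¹ • ((1 : ℝ) ⊗ₜ[ℤ] e ⟨x, hx⟩) := by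
      rw [he, smul_smul, inv_mul_cancel₀ (hc _).ne', one_smul]
    rw [h1]
    exact PointedCone.smul_mem _ (inv_nonneg.2 (hc _).le)
      (PointedCone.subset_hull ⟨ψ.symm ⟨x, hx⟩, by simp⟩)
  · refine Submodule.span_le.2 ?_
    rintro _ ⟨i, rfl⟩
    dsimp only
    rw [he]
    exact PointedCone.smul_mem _ (hc _).le (PointedCone.subset_hull (ψ i).2)

/-- Every cone of `Δ` has a frame whose multiplicity is invertible in `R`. -/
def HasFrames (Δ : RationalFan N) (R : Type*) [CommRing R] : Prop :=
  ∀ σ ∈ Δ.cones, ∃ F : Frame σ, IsUnit (F.m : R)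

theorem RationalFan.IsUnimodular.hasFrames {Δ : RationalFan N} (h : Δ.IsUnimodular) :
    HasFrames Δ ℤ := by
  intro σ hσ
  obtain ⟨n, b, s, rfl⟩ := h σ hσ
  obtain ⟨F, hF⟩ := exists_frame_of_basis b s
  exact ⟨F, by rw [hF]; simp⟩

theorem RationalFan.IsSimplicial.hasFrames [Module.Free ℤ N] [Module.Finite ℤ N]
    {Δ : RationalFan N} (h : Δ.IsSimplicial) : HasFrames Δ ℚ := by
  intro σ hσ
  obtain ⟨F⟩ := exists_frame_of_isSimplicial hσ (h σ hσ)
  exact ⟨F, by simpa using F.m_pos.ne'⟩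

end Existence

/-! ### Orientations and incidence signs -/

section Signs

variable {N : Type*} [AddCommGroup N]

theorem proj_mkQ {τ σ : Cone N} (h : τ ≤ σ) (n : N) :
    proj h ((coneLattice τ).mkQ n) = (coneLattice σ).mkQ n :=
  Submodule.factor_mk (coneLattice_mono h) n

theorem map_proj_map_proj {τ τ' τ'' : Cone N} (h : τ'' ≤ τ') (h' : τ' ≤ τ)
    (x : ExteriorAlgebra ℤ (QuotLattice τ'')) :
    ExteriorAlgebra.map (proj h') (ExteriorAlgebra.map (proj h) x) =
      ExteriorAlgebra.map (proj (h.trans h')) x := by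
  rw [← AlgHom.comp_apply, ExteriorAlgebra.map_comp_map, Submodule.factor_comp]

theorem map_proj_refl {τ : Cone N} (h : τ ≤ τ) (x : ExteriorAlgebra ℤ (QuotLattice τ)) :
    ExteriorAlgebra.map (proj h) x = x := by
  have : proj h = LinearMap.id := by
    ext n
    simp
  rw [this, ExteriorAlgebra.map_id]
  rfl

theorem map_proj_surjective {τ σ : Cone N} (h : τ ≤ σ) :
    Function.Surjective (ExteriorAlgebra.map (proj h)) :=
  ExteriorAlgebra.map_surjective_iff.2 (Submodule.factor_surjective _)

theorem mem_relLattice {τ σ : Cone N} (h : τ ≤ σ) {v : QuotLattice τ} :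
    v ∈ relLattice τ σ ↔ proj h v = 0 := by
  obtain ⟨n, rfl⟩ := (coneLattice τ).mkQ_surjective v
  rw [proj_mkQ, Submodule.mkQ_apply, Submodule.mkQ_apply, Submodule.Quotient.mk_eq_zero]
  constructor
  · rintro ⟨m, hm, hmn⟩
    have h1 : m - n ∈ coneLattice σ := coneLattice_mono h ((Submodule.Quotient.eq _).1 hmn)
    simpa using sub_mem hm h1
  · exact fun hn => ⟨n, hn, rfl⟩

theorem relLattice_mono (τ : Cone N) {σ' σ : Cone N} (h : σ' ≤ σ) :
    relLattice τ σ' ≤ relLattice τ σ := Submodule.map_mono (coneLattice_mono h)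

theorem canonicalForm_smul {P : Type*} [AddCommGroup P] [Module.Free ℤ P]
    {ν : ExteriorAlgebra ℤ P} (hν : ν ≠ 0) (c : ℤ) : canonicalForm ν (c • ν) = c := by
  have h : ∃ c' : ℤ, c • ν = c' • ν := ⟨c, rfl⟩
  rw [canonicalForm, dif_pos h]
  exact (smul_left_injective ℤ hν h.choose_spec).symm

/-- Two generators of the same rank one lattice of multivectors differ by a sign. -/
theorem exists_sign_of_span_eq {P : Type*} [AddCommGroup P] [Module.Free ℤ P]
    {ν x : ExteriorAlgebra ℤ P} (h : Submodule.span ℤ {x} = Submodule.span ℤ {ν}) :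
    ∃ c : ℤ, c * c = 1 ∧ x = c • ν := by
  obtain ⟨u, hu⟩ := Submodule.span_singleton_eq_span_singleton.1 h.symm
  refine ⟨u, by rw [← Units.val_mul, Int.units_mul_self, Units.val_one], ?_⟩
  rw [← hu, Units.smul_def]

theorem NormalRel.mkQ_eq {τ η₁ η₂ σ : Cone N} (h : NormalRel τ η₁ η₂ σ) :
    ∃ x y z w : ℤ, x * w - y * z = -1 ∧
      (coneLattice τ).mkQ (unitNormal τ η₂) =
        x • (coneLattice τ).mkQ (unitNormal τ η₁) + y • (coneLattice τ).mkQ (unitNormal η₁ σ) ∧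
      (coneLattice τ).mkQ (unitNormal η₂ σ) =
        z • (coneLattice τ).mkQ (unitNormal τ η₁) + w • (coneLattice τ).mkQ (unitNormal η₁ σ) := by
  obtain ⟨x, y, z, w, hd, h1, h2⟩ := h
  refine ⟨x, y, z, w, hd, ?_, ?_⟩
  · rw [← map_smul, ← map_smul, ← map_add]
    exact (Submodule.Quotient.eq _).2 h1
  · rw [← map_smul, ← map_smul, ← map_add]
    exact (Submodule.Quotient.eq _).2 h2

section

variable {Δ : RationalFan N} (o : Orientation Δ)

theorem Orientation.span_eq {τ σ : Cone N} (hτ : τ ∈ Δ.cones) (hσ : σ ∈ Δ.cones) (h : τ ≤ σ) {k : ℕ}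
    (hk : coneDim σ = coneDim τ + k) : Submodule.span ℤ {o.ν τ σ} = extPow (relLattice τ σ) k := by
  rw [o.span_ν τ hτ σ hσ h]
  congr 1
  omega

theorem Orientation.ν_mem {τ σ : Cone N} (hτ : τ ∈ Δ.cones) (hσ : σ ∈ Δ.cones) (h : τ ≤ σ) {k : ℕ}
    (hk : coneDim σ = coneDim τ + k) : o.ν τ σ ∈ extPow (relLattice τ σ) k := by
  rw [← o.span_eq hτ hσ h hk]
  exact Submodule.mem_span_singleton_self _

end

section

variable [Module.Finite ℤ N]

theorem sub_projSection_mem {τ σ : Cone N} (h : τ ≤ σ) (v : QuotLattice τ) :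
    projSection h (proj h v) - v ∈ relLattice τ σ := by
  rw [mem_relLattice h, map_sub, proj_projSection, sub_self]

theorem coneDim_mono {τ σ : Cone N} (h : τ ≤ σ) : coneDim τ ≤ coneDim σ :=
  Submodule.finrank_mono (Submodule.span_mono h)

end

variable [Module.Free ℤ N] [Module.Finite ℤ N] {Δ : RationalFan N}

theorem extPow_relLattice_eq_bot {τ σ : Cone N} (hτ : τ ∈ Δ.cones) (hσ : σ ∈ Δ.cones) (h : τ ≤ σ)
    {k : ℕ} (hk : coneDim σ < coneDim τ + k) : extPow (relLattice τ σ) k = ⊥ := by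
  refine extPow_eq_bot_of_finrank_lt _ ?_
  have := finrank_relLattice Δ τ σ hτ hσ h
  omega

variable (o : Orientation Δ)

theorem Orientation.ν_ne_zero {τ σ : Cone N} (hτ : τ ∈ Δ.cones) (hσ : σ ∈ Δ.cones) (h : τ ≤ σ) :
    o.ν τ σ ≠ 0 := by
  intro h0
  have h1 := finrank_relLattice Δ τ σ hτ hσ h
  have h2 := o.span_eq hτ hσ h (k := Module.finrank ℤ (relLattice τ σ)) (by omega)
  rw [h0, Submodule.span_zero_singleton] at h2
  let r : QuotLattice τ →ₗ[ℤ] relLattice τ σ :=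
    (LinearMap.id - projSection h ∘ₗ proj h).codRestrict _ fun v => by
      have := neg_mem (sub_projSection_mem h v)
      rwa [neg_sub] at this
  refine extPow_finrank_ne_bot (relLattice τ σ) r ?_ h2.symm
  ext v
  simp [r, (mem_relLattice h).1 v.2]

/-- The top multivector of `N^τ_σ` is annihilated by the vectors of `N_σ`. -/
theorem Orientation.ι_mul_ν {τ σ : Cone N} (hτ : τ ∈ Δ.cones) (hσ : σ ∈ Δ.cones) (h : τ ≤ σ)
    {v : QuotLattice τ} (hv : v ∈ relLattice τ σ) : ExteriorAlgebra.ι ℤ v * o.ν τ σ = 0 := by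
  obtain ⟨k, hk⟩ := Nat.exists_eq_add_of_le (coneDim_mono h)
  have h1 := mul_mem_extPow hv (o.ν_mem hτ hσ h hk)
  have h2 := extPow_relLattice_eq_bot hτ hσ h (k := k + 1) (by omega)
  rw [Nat.cast_add, Nat.cast_one] at h2
  rw [h2] at h1
  exact (Submodule.mem_bot _).1 h1

theorem sign_of_mul_self {c : ℤ} (h : c * c = 1) : c.sign = c := by
  rcases mul_self_eq_one_iff.1 h with rfl | rfl <;> rfl

/-- The sign `signSame` relates the orientations of two cubes of the same sedentarity. -/
theorem signSame_spec {τ σ' σ : Cone N} (hτ : τ ∈ Δ.cones) (hσ' : σ' ∈ Δ.cones) (hσ : σ ∈ Δ.cones)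
    (h : τ ≤ σ') (h' : σ' ≤ σ) (hd : coneDim σ = coneDim σ' + 1) :
    signSame o τ σ' σ * signSame o τ σ' σ = 1 ∧
    ExteriorAlgebra.ι ℤ ((coneLattice τ).mkQ (unitNormal σ' σ)) * o.ν τ σ' =
      signSame o τ σ' σ • o.ν τ σ := by
  obtain ⟨k, hk⟩ := Nat.exists_eq_add_of_le (coneDim_mono h)
  have h1 : relLattice τ σ = relLattice τ σ' ⊔
      Submodule.span ℤ {(coneLattice τ).mkQ (unitNormal σ' σ)} := by
    conv_lhs => rw [relLattice, ← (isUnitNormal_unitNormal hσ' hσ h' hd).1, Submodule.map_sup,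
      Submodule.map_span, Set.image_singleton]
    rfl
  have h2 : Submodule.span ℤ {ExteriorAlgebra.ι ℤ ((coneLattice τ).mkQ (unitNormal σ' σ)) *
      o.ν τ σ'} = Submodule.span ℤ {o.ν τ σ} := by
    rw [o.span_eq hτ hσ (h.trans h') (k := k + 1) (by omega), h1, extPow_sup_span,
      ← o.span_eq hτ hσ' h hk, Submodule.map_span, Set.image_singleton, LinearMap.mulLeft_apply]
    exact extPow_relLattice_eq_bot hτ hσ' h (by omega)
  obtain ⟨c, hc, hx⟩ := exists_sign_of_span_eq h2
  have : signSame o τ σ' σ = c := by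
    rw [signSame, hx, canonicalForm_smul (o.ν_ne_zero hτ hσ (h.trans h')), sign_of_mul_self hc]
  rw [this]
  exact ⟨hc, hx⟩

/-- The sign `signChange` relates the orientations of two cubes whose sedentarities differ. -/
theorem signChange_spec {τ' τ σ : Cone N} (hτ' : τ' ∈ Δ.cones) (hτ : τ ∈ Δ.cones) (hσ : σ ∈ Δ.cones)
    (h' : τ' ≤ τ) (h : τ ≤ σ) (hd : coneDim τ = coneDim τ' + 1) :
    signChange o h' σ * signChange o h' σ = 1 ∧
    wedgeNormal h' (o.ν τ σ) = -(signChange o h' σ • o.ν τ' σ) := by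
  obtain ⟨k, hk⟩ := Nat.exists_eq_add_of_le (coneDim_mono h)
  have h1 : relLattice τ' σ = (relLattice τ σ).map (projSection h') ⊔
      Submodule.span ℤ {relNormal τ' τ} := by
    have h3 : relLattice τ' τ = Submodule.span ℤ {relNormal τ' τ} := by
      rw [relLattice, ← (isUnitNormal_unitNormal hτ' hτ h' hd).1, Submodule.map_sup,
        Submodule.map_span, Set.image_singleton, ← LinearMap.range_domRestrict]
      convert bot_sup_eq (Submodule.span ℤ {relNormal τ' τ})
      · rw [LinearMap.range_domRestrict, ← le_bot_iff, Submodule.map_le_iff_le_comap]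
        intro x hx
        simpa using hx
      · rfl
    rw [← h3]
    apply le_antisymm
    · intro v hv
      have h4 := sub_projSection_mem h' v
      rw [Submodule.mem_sup]
      refine ⟨_, ⟨proj h' v, ?_, rfl⟩, _, neg_mem h4, by abel⟩
      rw [← relLattice_map_proj h']
      exact ⟨v, hv, rfl⟩
    · refine sup_le ?_ (relLattice_mono _ h)
      rintro _ ⟨v, hv, rfl⟩
      obtain ⟨w, rfl⟩ := Submodule.factor_surjective (coneLattice_mono h') v
      have h5 : w ∈ relLattice τ' σ := by
        rw [SetLike.mem_coe, mem_relLattice h] at hv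
        rw [mem_relLattice (h'.trans h), ← hv]
        exact (Submodule.factor_comp_apply _ _ _).symm
      simpa using add_mem (relLattice_mono τ' h (sub_projSection_mem h' w)) h5
  have h2 : Submodule.span ℤ {wedgeNormal h' (o.ν τ σ)} = Submodule.span ℤ {o.ν τ' σ} := by
    rw [o.span_eq hτ' hσ (h'.trans h) (k := k + 1) (by omega), h1, extPow_sup_span, ← map_extPow,
      ← o.span_eq hτ hσ h hk, ← Submodule.map_comp, Submodule.map_span, Set.image_singleton]
    · rfl
    · rw [← map_extPow, extPow_relLattice_eq_bot hτ hσ h (by omega), Submodule.map_bot]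
  obtain ⟨c, hc, hx⟩ := exists_sign_of_span_eq h2
  have : signChange o h' σ = -c := by
    rw [signChange, hx, canonicalForm_smul (o.ν_ne_zero hτ' hσ (h'.trans h)),
      sign_of_mul_self (by simpa using hc)]
  rw [this, neg_mul_neg, neg_smul, neg_neg]
  exact ⟨hc, hx⟩

theorem wedgeNormal_map_proj {τ σ : Cone N} (hτ : τ ∈ Δ.cones) (hσ : σ ∈ Δ.cones) (h : τ ≤ σ)
    (hd : coneDim σ = coneDim τ + 1) (x : ExteriorAlgebra ℤ (QuotLattice τ)) :
    wedgeNormal h (ExteriorAlgebra.map (proj h) x) =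
      ExteriorAlgebra.ι ℤ ((coneLattice τ).mkQ (unitNormal τ σ)) * x :=
  wedgeNormal_map h (exists_isUnitNormal Δ τ σ hτ hσ h hd) x

theorem wedgeNormal_wedgeNormal {τ η σ : Cone N} (hτ : τ ∈ Δ.cones) (hη : η ∈ Δ.cones)
    (hσ : σ ∈ Δ.cones) (h : τ ≤ η) (h' : η ≤ σ) (hd : coneDim η = coneDim τ + 1)
    (hd' : coneDim σ = coneDim η + 1) (x : ExteriorAlgebra ℤ (QuotLattice τ)) :
    wedgeNormal h (wedgeNormal h' (ExteriorAlgebra.map (proj (h.trans h')) x)) =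
      ExteriorAlgebra.ι ℤ ((coneLattice τ).mkQ (unitNormal τ η)) *
        (ExteriorAlgebra.ι ℤ ((coneLattice τ).mkQ (unitNormal η σ)) * x) := by
  rw [← map_proj_map_proj h h', wedgeNormal_map_proj hη hσ h' hd', ← wedgeNormal_map_proj hτ hη h hd,
    ← proj_mkQ h, ← ExteriorAlgebra.map_apply_ι, ← map_mul]

/-- A change of basis of determinant `-1` reverses the sign of `a ∧ b'`. -/
theorem ι_mul_ι_mul_of_det {P : Type*} [AddCommGroup P] {a b a' b' : P} {x y z w : ℤ}
    (hdet : x * w - y * z = -1) (hb : b = x • a + y • b') (ha : a' = z • a + w • b')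
    (X : ExteriorAlgebra ℤ P) :
    ExteriorAlgebra.ι ℤ b * (ExteriorAlgebra.ι ℤ a' * X) =
      -(ExteriorAlgebra.ι ℤ a * (ExteriorAlgebra.ι ℤ b' * X)) := by
  subst hb ha
  simp only [map_add, map_smul, add_mul, mul_add, smul_mul_assoc, mul_smul_comm, ι_mul_self_mul,
    smul_zero, zero_add, add_zero, smul_smul]
  rw [ι_mul_ι_mul_comm b' a, smul_neg, ← neg_smul, ← add_smul,
    show -(z * y) + w * x = -1 by linarith, neg_one_smul]

/-- The two ways of wedging with unit normal vectors around a square of cones are opposite. -/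
theorem wedgeNormal_wedgeNormal_neg {τ η₁ η₂ σ : Cone N} (hτ : τ ∈ Δ.cones) (hη₁ : η₁ ∈ Δ.cones)
    (hη₂ : η₂ ∈ Δ.cones) (hσ : σ ∈ Δ.cones) (h₁ : τ ≤ η₁) (h₁' : η₁ ≤ σ) (h₂ : τ ≤ η₂) (h₂' : η₂ ≤ σ)
    (hd₁ : coneDim η₁ = coneDim τ + 1) (hd₂ : coneDim η₂ = coneDim τ + 1)
    (hd : coneDim σ = coneDim τ + 2) (hr : NormalRel τ η₁ η₂ σ)
    (y : ExteriorAlgebra ℤ (QuotLattice σ)) :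
    wedgeNormal h₂ (wedgeNormal h₂' y) = -wedgeNormal h₁ (wedgeNormal h₁' y) := by
  obtain ⟨x, rfl⟩ := map_proj_surjective (h₁.trans h₁') y
  rw [wedgeNormal_wedgeNormal hτ hη₁ hσ h₁ h₁' hd₁ (by omega),
    wedgeNormal_wedgeNormal hτ hη₂ hσ h₂ h₂' hd₂ (by omega)]
  obtain ⟨_, _, _, _, hdet, e1, e2⟩ := hr.mkQ_eq
  exact ι_mul_ι_mul_of_det hdet e1 e2 x

/-- The incidence signs around a square of cubes `□^·_σ` with `σ` fixed. -/
theorem signChange_mul_signChange {τ η₁ η₂ η' σ : Cone N} (hτ : τ ∈ Δ.cones) (hη₁ : η₁ ∈ Δ.cones)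
    (hη₂ : η₂ ∈ Δ.cones) (hη' : η' ∈ Δ.cones) (hσ : σ ∈ Δ.cones) (h₁ : τ ≤ η₁) (h₁' : η₁ ≤ η')
    (h₂ : τ ≤ η₂) (h₂' : η₂ ≤ η') (h : η' ≤ σ)
    (hd₁ : coneDim η₁ = coneDim τ + 1) (hd₂ : coneDim η₂ = coneDim τ + 1)
    (hd : coneDim η' = coneDim τ + 2) (hr : NormalRel τ η₁ η₂ η') :
    signChange o h₁ σ * signChange o h₁' σ = -(signChange o h₂ σ * signChange o h₂' σ) := by
  have h0 := wedgeNormal_wedgeNormal_neg hτ hη₁ hη₂ hη' h₁ h₁' h₂ h₂' hd₁ hd₂ hd hr (o.ν η' σ)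
  rw [(signChange_spec o hη₁ hη' hσ h₁' h (by omega)).2,
    (signChange_spec o hη₂ hη' hσ h₂' h (by omega)).2, map_neg, map_neg, map_smul, map_smul,
    (signChange_spec o hτ hη₁ hσ h₁ (h₁'.trans h) hd₁).2,
    (signChange_spec o hτ hη₂ hσ h₂ (h₂'.trans h) hd₂).2, smul_neg, smul_neg, neg_neg, neg_neg,
    smul_smul, smul_smul, ← neg_smul] at h0
  have := smul_left_injective ℤ (o.ν_ne_zero hτ hσ (h₁.trans (h₁'.trans h))) h0
  linarith

/-- The incidence signs around a square of cubes of constant sedentarity. -/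
theorem signSame_mul_signSame {τ η₁ η₂ η' σ : Cone N} (hτ : τ ∈ Δ.cones) (hη₁ : η₁ ∈ Δ.cones)
    (hη₂ : η₂ ∈ Δ.cones) (hη' : η' ∈ Δ.cones) (hσ : σ ∈ Δ.cones) (h : τ ≤ η') (h₁ : η' ≤ η₁)
    (h₁' : η₁ ≤ σ) (h₂ : η' ≤ η₂) (h₂' : η₂ ≤ σ)
    (hd₁ : coneDim η₁ = coneDim η' + 1) (hd₂ : coneDim η₂ = coneDim η' + 1)
    (hd : coneDim σ = coneDim η' + 2) (hr : NormalRel η' η₁ η₂ σ) :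
    signSame o τ η₁ σ * signSame o τ η' η₁ = -(signSame o τ η₂ σ * signSame o τ η' η₂) := by
  have e1 := (signSame_spec o hτ hη₁ hσ (h.trans h₁) h₁' (by omega)).2
  have e2 := (signSame_spec o hτ hη₂ hσ (h.trans h₂) h₂' (by omega)).2
  have f1 := (signSame_spec o hτ hη' hη₁ h h₁ hd₁).2
  have f2 := (signSame_spec o hτ hη' hη₂ h h₂ hd₂).2
  obtain ⟨x, y, z, w, hdet, r1, r2⟩ := hr
  -- the relations hold modulo `N_η'`, which annihilates `ν`
  have g : ∀ {a b : N}, a - b ∈ coneLattice η' →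
      ExteriorAlgebra.ι ℤ ((coneLattice τ).mkQ a) * o.ν τ η' =
      ExteriorAlgebra.ι ℤ ((coneLattice τ).mkQ b) * o.ν τ η' := by
    intro a b hab
    rw [← sub_eq_zero, ← sub_mul, ← map_sub, ← map_sub]
    exact o.ι_mul_ν hτ hη' h (Submodule.mem_map_of_mem hab)
  have lin : ∀ (x y : ℤ) (a b : N), (coneLattice τ).mkQ (x • a + y • b) =
      x • (coneLattice τ).mkQ a + y • (coneLattice τ).mkQ b := by simp
  have g2 := ι_mul_ι_mul_of_det hdet (lin x y (unitNormal η' η₁) (unitNormal η₁ σ))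
    (lin z w (unitNormal η' η₁) (unitNormal η₁ σ)) (o.ν τ η')
  rw [← g r2, ι_mul_ι_mul_comm, ← g r1, f2,
    ι_mul_ι_mul_comm ((coneLattice τ).mkQ (unitNormal η' η₁)), f1, neg_neg, mul_smul_comm,
    mul_smul_comm, e1, e2, smul_smul, smul_smul, ← neg_smul] at g2
  have := smul_left_injective ℤ (o.ν_ne_zero hτ hσ (h.trans (h₁.trans h₁'))) g2
  linarith

/-- The incidence signs around a square of cubes in which both ends vary. -/
theorem signSame_mul_signChange {τ η' η σ : Cone N} (hτ : τ ∈ Δ.cones) (hη' : η' ∈ Δ.cones)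
    (hη : η ∈ Δ.cones) (hσ : σ ∈ Δ.cones) (h₁ : τ ≤ η') (h₂ : η' ≤ η) (h₃ : η ≤ σ)
    (hd₁ : coneDim η' = coneDim τ + 1) (hd₃ : coneDim σ = coneDim η + 1) :
    signSame o τ η σ * signChange o h₁ η = -(signChange o h₁ σ * signSame o η' η σ) := by
  obtain ⟨Y, hY⟩ := map_proj_surjective h₁ (o.ν η' η)
  have e1 := (signChange_spec o hτ hη' hη h₁ h₂ hd₁).2
  have e2 := (signSame_spec o hτ hη hσ (h₁.trans h₂) h₃ hd₃).2
  have e3 := (signSame_spec o hη' hη hσ h₂ h₃ hd₃).2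
  have e4 := (signChange_spec o hτ hη' hσ h₁ (h₂.trans h₃) hd₁).2
  have e5 := congrArg (wedgeNormal h₁) e3
  rw [map_smul, e4, ← hY, ← proj_mkQ h₁, ← ExteriorAlgebra.map_apply_ι, ← map_mul,
    wedgeNormal_map_proj hτ hη' h₁ hd₁, ι_mul_ι_mul_comm, ← wedgeNormal_map_proj hτ hη' h₁ hd₁, hY,
    e1, mul_neg, neg_neg, mul_smul_comm, e2, smul_smul, smul_neg, smul_smul, ← neg_smul] at e5
  have := smul_left_injective ℤ (o.ν_ne_zero hτ hσ (h₁.trans (h₂.trans h₃))) e5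
  linarith

end Signs

/-! ### The tropical differential squares to zero -/

/-- The cancellations in the square of a differential with two anticommuting parts, each of square
zero, written with coefficients. -/
theorem sum_sum_cancel {R M I : Type*} [CommRing R] [AddCommGroup M] [Module R M] [Fintype I]
    {a b c d : I → I → ℤ} (ha : ∀ j, ∑ i, a i j = 0) (hd : ∀ j, ∑ i, d i j = 0)
    (hbc : ∀ i j, b i j + c j i = 0) (X Z : I → M) (Y : I → I → M) :
    ∑ i, (∑ j, (a i j : R) • X j + ∑ j, (b i j : R) • Y j i) +
      ∑ i, (∑ j, (c i j : R) • Y i j + ∑ j, (d i j : R) • Z j) = 0 := by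
  have s1 : ∑ i, ∑ j, (a i j : R) • X j = 0 := by
    rw [Finset.sum_comm]
    refine Finset.sum_eq_zero fun j _ => ?_
    rw [← Finset.sum_smul, ← Int.cast_sum, ha, Int.cast_zero, zero_smul]
  have s2 : ∑ i, ∑ j, (d i j : R) • Z j = 0 := by
    rw [Finset.sum_comm]
    refine Finset.sum_eq_zero fun j _ => ?_
    rw [← Finset.sum_smul, ← Int.cast_sum, hd, Int.cast_zero, zero_smul]
  rw [Finset.sum_add_distrib, Finset.sum_add_distrib, s1, s2, zero_add, add_zero, Finset.sum_comm,
    ← Finset.sum_add_distrib]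
  refine Finset.sum_eq_zero fun i _ => ?_
  rw [← Finset.sum_add_distrib]
  refine Finset.sum_eq_zero fun j _ => ?_
  rw [← add_smul, ← Int.cast_add, hbc, Int.cast_zero, zero_smul]

section Complexes

variable {N : Type*} [AddCommGroup N]

section Pull

variable {Δ : RationalFan N} {R : Type*} [CommRing R] {k : ℤ}

open Classical in
/-- The restriction map `F^k(□^τ_σ') → F^k(□^τ'_σ)` of multi-cotangent spaces, set to zero when
`□^τ_σ'` is not a face of `□^τ'_σ`. -/
def pull (Δ : RationalFan N) (R : Type*) [CommRing R] (k : ℤ) (τ' τ σ' σ : Cone N) :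
    MultiCotangent Δ R k τ σ' →ₗ[R] MultiCotangent Δ R k τ' σ :=
  if h : τ' ≤ τ ∧ σ' ≤ σ then transpose R (faceMap Δ k h.1 h.2) else 0

theorem pull_apply {τ' τ σ' σ : Cone N} (h : τ' ≤ τ) (h' : σ' ≤ σ)
    (α : MultiCotangent Δ R k τ σ') (x : multiTangent Δ k τ' σ) :
    pull Δ R k τ' τ σ' σ α x = α (faceMap Δ k h h' x) := by
  rw [pull, dif_pos ⟨h, h'⟩]
  rfl

theorem pull_pull {τ'' τ' τ σ'' σ' σ : Cone N} (h₁ : τ'' ≤ τ') (h₂ : τ' ≤ τ) (h₃ : σ'' ≤ σ')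
    (h₄ : σ' ≤ σ) (α : MultiCotangent Δ R k τ σ'') :
    pull Δ R k τ'' τ' σ' σ (pull Δ R k τ' τ σ'' σ' α) = pull Δ R k τ'' τ σ'' σ α := by
  ext x
  rw [pull_apply h₁ h₄, pull_apply h₂ h₃, pull_apply (h₁.trans h₂) (h₃.trans h₄)]
  congr 1
  exact Subtype.ext (map_proj_map_proj h₁ h₂ _)

theorem pull_refl {τ σ : Cone N} (α : MultiCotangent Δ R k τ σ) : pull Δ R k τ τ σ σ α = α := by
  ext x
  rw [pull_apply le_rfl le_rfl]
  congr 1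
  exact Subtype.ext (map_proj_refl _ _)

end Pull

section Component

variable {R : Type*} [CommRing R] {p q : ℕ} {Δ : RationalFan N}

open Classical in
/-- The component of a tropical cochain at a pair of cones, zero if the pair is not a face of the
right dimension. -/
def component (α : TropicalCochain Δ R p q) (τ σ : Cone N) : MultiCotangent Δ R p τ σ :=
  if h : τ ∈ Δ.cones ∧ σ ∈ Δ.cones ∧ τ ≤ σ ∧ coneDim σ = coneDim τ + q then α ⟨(τ, σ), h⟩ else 0

theorem component_face (α : TropicalCochain Δ R p q) (δ : Δ.Face q) :
    component α δ.1.1 δ.1.2 = α δ := dif_pos δ.2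

theorem component_of_face (α : TropicalCochain Δ R p q) {τ σ : Cone N}
    (h : τ ∈ Δ.cones ∧ σ ∈ Δ.cones ∧ τ ≤ σ ∧ coneDim σ = coneDim τ + q) :
    component α τ σ = α ⟨(τ, σ), h⟩ := dif_pos h

theorem component_of_not (α : TropicalCochain Δ R p q) {τ σ : Cone N}
    (h : ¬(τ ∈ Δ.cones ∧ σ ∈ Δ.cones ∧ τ ≤ σ ∧ coneDim σ = coneDim τ + q)) :
    component α τ σ = 0 := dif_neg h

end Component

variable {Δ : RationalFan N} (o : Orientation Δ)

open Classical in
/-- The sign of the pair of faces `□^τ_η`, `□^τ_σ`, set to zero when `η` is not a facet of `σ`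
containing `τ`. -/
def incSame (τ η σ : Cone N) : ℤ :=
  if τ ≤ η ∧ η ≤ σ ∧ coneDim σ = coneDim η + 1 then signSame o τ η σ else 0

open Classical in
/-- The sign of the pair of faces `□^η_σ`, `□^τ_σ`, set to zero when `τ` is not a facet of `η` or
`η` is not contained in `σ`. -/
def incChange [Module.Finite ℤ N] (τ η σ : Cone N) : ℤ :=
  if h : τ ≤ η ∧ η ≤ σ ∧ coneDim η = coneDim τ + 1 then signChange o h.1 σ else 0

theorem incSame_ne_zero {τ η σ : Cone N} (h : incSame o τ η σ ≠ 0) :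
    τ ≤ η ∧ η ≤ σ ∧ coneDim σ = coneDim η + 1 := by
  by_contra h'
  exact h (if_neg h')

variable [Module.Finite ℤ N]

theorem incChange_ne_zero {τ η σ : Cone N} (h : incChange o τ η σ ≠ 0) :
    τ ≤ η ∧ η ≤ σ ∧ coneDim η = coneDim τ + 1 := by
  by_contra h'
  exact h (dif_neg h')

section Extend

variable {R : Type*} [CommRing R] {p q : ℕ}

/-- The tropical differential in terms of components. -/
theorem component_tropicalDiff (α : TropicalCochain Δ R p q) {τ σ : Cone N}
    (h : τ ∈ Δ.cones ∧ σ ∈ Δ.cones ∧ τ ≤ σ ∧ coneDim σ = coneDim τ + (q + 1)) :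
    component (tropicalDiff o R p q α) τ σ =
      ∑ η : Δ.cones, (incSame o τ η σ : R) • pull Δ R p τ τ η σ (component α τ η) +
      ∑ η : Δ.cones, (incChange o τ η σ : R) • pull Δ R p τ η σ σ (component α η σ) := by
  have hz : ∀ (c : ℤ) (β : MultiCotangent Δ R p τ σ), c • β = (c : R) • β := fun c β => by
    ext x
    exact zsmul_eq_mul _ _
  refine (component_of_face (q := q + 1) (tropicalDiff o R p q α) h).trans ?_
  refine congrArg₂ (fun x y : MultiCotangent Δ R p τ σ => x + y)
    ((LinearMap.sum_apply _ _ _).trans (Finset.sum_congr rfl fun η _ => ?_))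
    ((LinearMap.sum_apply _ _ _).trans (Finset.sum_congr rfl fun η _ => ?_))
  · by_cases h' : τ ≤ η.1 ∧ η.1 ≤ σ ∧ coneDim σ = coneDim η.1 + 1
    · have hf : τ ∈ Δ.cones ∧ η.1 ∈ Δ.cones ∧ τ ≤ η.1 ∧ coneDim η.1 = coneDim τ + q :=
        ⟨h.1, η.2, h'.1, by omega⟩
      have hs : incSame o τ η.1 σ = signSame o τ η.1 σ := if_pos h'
      have hp : pull Δ R p τ τ η.1 σ = transpose R (faceMap Δ p le_rfl h'.2.1) :=
        dif_pos ⟨le_rfl, h'.2.1⟩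
      have hp' : pull Δ R p τ τ η.1 σ (component α τ η.1) =
          transpose R (faceMap Δ p le_rfl h'.2.1) (α ⟨(τ, η.1), hf⟩) := by
        rw [component_of_face α hf, hp]
      exact ((LinearMap.congr_fun (dif_pos h') α).trans (hz _ _)).trans
        (congrArg₂ (fun (c : ℤ) (β : MultiCotangent Δ R p τ σ) => (c : R) • β) hs hp').symm
    · have hs : (incSame o τ η.1 σ : R) = 0 := by rw [incSame, if_neg h', Int.cast_zero]
      exact (LinearMap.congr_fun (dif_neg h') α).trans
        ((congrArg (· • pull Δ R p τ τ η.1 σ (component α τ η.1)) hs).trans (zero_smul _ _)).symm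
  · by_cases h' : τ ≤ η.1 ∧ η.1 ≤ σ ∧ coneDim η.1 = coneDim τ + 1
    · have hf : η.1 ∈ Δ.cones ∧ σ ∈ Δ.cones ∧ η.1 ≤ σ ∧ coneDim σ = coneDim η.1 + q :=
        ⟨η.2, h.2.1, h'.2.1, by omega⟩
      have hs : incChange o τ η.1 σ = signChange o h'.1 σ := dif_pos h'
      have hp : pull Δ R p τ η.1 σ σ = transpose R (faceMap Δ p h'.1 le_rfl) :=
        dif_pos ⟨h'.1, le_rfl⟩
      have hp' : pull Δ R p τ η.1 σ σ (component α η.1 σ) =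
          transpose R (faceMap Δ p h'.1 le_rfl) (α ⟨(η.1, σ), hf⟩) := by
        rw [component_of_face α hf, hp]
      exact ((LinearMap.congr_fun (dif_pos h') α).trans (hz _ _)).trans
        (congrArg₂ (fun (c : ℤ) (β : MultiCotangent Δ R p τ σ) => (c : R) • β) hs hp').symm
    · have hs : (incChange o τ η.1 σ : R) = 0 := by rw [incChange, dif_neg h', Int.cast_zero]
      exact (LinearMap.congr_fun (dif_neg h') α).trans
        ((congrArg (· • pull Δ R p τ η.1 σ σ (component α η.1 σ)) hs).trans (zero_smul _ _)).symm

end Extend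

variable [Module.Free ℤ N]

/-- In a simplicial fan, exactly two cones lie strictly between a cone and a face of
codimension two, and the unit normal vectors along the two paths are related. -/
theorem exists_diamond (hΔ : ∀ σ ∈ Δ.cones, Nonempty (Frame σ)) {τ σ : Cone N} (hτ : τ ∈ Δ.cones)
    (hσ : σ ∈ Δ.cones) (h : τ ≤ σ) (hd : coneDim σ = coneDim τ + 2) :
    ∃ η₁ η₂ : Δ.cones, η₁ ≠ η₂ ∧ τ ≤ η₁ ∧ η₁ ≤ σ ∧ coneDim η₁.1 = coneDim τ + 1 ∧
      τ ≤ η₂ ∧ η₂ ≤ σ ∧ coneDim η₂.1 = coneDim τ + 1 ∧ NormalRel τ η₁ η₂ σ ∧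
      ∀ η : Δ.cones, τ ≤ η → η ≤ σ → coneDim η.1 = coneDim τ + 1 → η = η₁ ∨ η = η₂ := by
  obtain ⟨F⟩ := hΔ σ hσ
  obtain ⟨S, rfl⟩ := F.exists_face_eq_of_le hσ hτ h
  have h1 : Sᶜ.card = 2 := by
    rw [F.coneDim_face, F.coneDim_eq] at hd
    rw [Finset.card_compl, Fintype.card_fin]
    omega
  obtain ⟨i, j, hij, hS⟩ := Finset.card_eq_two.1 h1
  have hi : i ∉ S := by rw [← Finset.mem_compl, hS]; simp
  have hj : j ∉ S := by rw [← Finset.mem_compl, hS]; simp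
  have htop : F.face (insert j (insert i S)) = σ := by
    conv_rhs => rw [← F.face_univ]
    congr 1
    ext x
    have : x ∈ Sᶜ ↔ x = i ∨ x = j := by rw [hS]; simp
    rw [Finset.mem_compl] at this
    simp only [Finset.mem_insert, Finset.mem_univ, iff_true]
    tauto
  have hrel := F.normalRel hσ hi hj hij
  rw [htop] at hrel
  refine ⟨⟨F.face (insert i S), F.face_mem hσ _⟩, ⟨F.face (insert j S), F.face_mem hσ _⟩, ?_,
    F.face_le_face.2 (Finset.subset_insert _ _), F.face_le _, ?_,
    F.face_le_face.2 (Finset.subset_insert _ _), F.face_le _, ?_, hrel, ?_⟩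
  · intro he
    have h2 := F.face_injective (congrArg Subtype.val he)
    have h3 : i ∈ insert j S := h2 ▸ Finset.mem_insert_self i S
    rcases Finset.mem_insert.1 h3 with h3 | h3
    exacts [hij h3, hi h3]
  · dsimp only
    rw [F.coneDim_face, F.coneDim_face, Finset.card_insert_of_notMem hi]
  · dsimp only
    rw [F.coneDim_face, F.coneDim_face, Finset.card_insert_of_notMem hj]
  · rintro ⟨η, hη⟩ h2 h3 h4
    obtain ⟨T, rfl⟩ := F.exists_face_eq_of_le hσ hη h3
    dsimp only at h2 h4
    rw [F.coneDim_face, F.coneDim_face] at h4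
    rw [F.face_le_face] at h2
    obtain ⟨x, hx, rfl⟩ := (Finset.covBy_iff_exists_insert).1 (Finset.covBy_iff_card_sdiff_eq_one.2
      ⟨h2, by rw [Finset.card_sdiff_of_subset h2]; omega⟩)
    have : x ∈ ({i, j} : Finset _) := by rw [← hS]; simpa using hx
    rcases Finset.mem_insert.1 this with rfl | h5
    · exact Or.inl rfl
    · rw [Finset.mem_singleton] at h5
      subst h5
      exact Or.inr rfl

theorem sum_incSame_mul_incSame (hΔ : ∀ σ ∈ Δ.cones, Nonempty (Frame σ)) {τ η' σ : Cone N}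
    (hτ : τ ∈ Δ.cones) (hη' : η' ∈ Δ.cones) (hσ : σ ∈ Δ.cones) :
    ∑ η : Δ.cones, incSame o τ η σ * incSame o τ η' η = 0 := by
  by_cases hc : τ ≤ η' ∧ η' ≤ σ ∧ coneDim σ = coneDim η' + 2
  · obtain ⟨η₁, η₂, hne, a1, a2, a3, b1, b2, b3, hr, hall⟩ :=
      exists_diamond hΔ hη' hσ hc.2.1 hc.2.2
    rw [Finset.sum_eq_add η₁ η₂ hne]
    · rw [incSame, if_pos ⟨hc.1.trans a1, a2, by omega⟩, incSame, if_pos ⟨hc.1, a1, a3⟩,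
        incSame, if_pos ⟨hc.1.trans b1, b2, by omega⟩, incSame, if_pos ⟨hc.1, b1, b3⟩,
        signSame_mul_signSame o hτ η₁.2 η₂.2 hη' hσ hc.1 a1 a2 b1 b2 a3 b3 hc.2.2 hr]
      exact neg_add_cancel _
    · rintro η - ⟨h1, h2⟩
      by_contra h0
      obtain ⟨-, h3, -⟩ := incSame_ne_zero o (left_ne_zero_of_mul h0)
      obtain ⟨-, h4, h5⟩ := incSame_ne_zero o (right_ne_zero_of_mul h0)
      rcases hall η h4 h3 h5 with h | h
      exacts [h1 h, h2 h]
    · exact fun h => absurd (Finset.mem_univ _) h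
    · exact fun h => absurd (Finset.mem_univ _) h
  · refine Finset.sum_eq_zero fun η _ => ?_
    by_contra h0
    obtain ⟨-, h3, h3'⟩ := incSame_ne_zero o (left_ne_zero_of_mul h0)
    obtain ⟨h4', h4, h5⟩ := incSame_ne_zero o (right_ne_zero_of_mul h0)
    exact hc ⟨h4', h4.trans h3, by omega⟩

theorem sum_incChange_mul_incChange (hΔ : ∀ σ ∈ Δ.cones, Nonempty (Frame σ)) {τ η' σ : Cone N}
    (hτ : τ ∈ Δ.cones) (hη' : η' ∈ Δ.cones) (hσ : σ ∈ Δ.cones) :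
    ∑ η : Δ.cones, incChange o τ η σ * incChange o η η' σ = 0 := by
  by_cases hc : τ ≤ η' ∧ η' ≤ σ ∧ coneDim η' = coneDim τ + 2
  · obtain ⟨η₁, η₂, hne, a1, a2, a3, b1, b2, b3, hr, hall⟩ :=
      exists_diamond hΔ hτ hη' hc.1 hc.2.2
    rw [Finset.sum_eq_add η₁ η₂ hne]
    · rw [incChange, dif_pos ⟨a1, a2.trans hc.2.1, a3⟩, incChange, dif_pos ⟨a2, hc.2.1, by omega⟩,
        incChange, dif_pos ⟨b1, b2.trans hc.2.1, b3⟩, incChange, dif_pos ⟨b2, hc.2.1, by omega⟩,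
        signChange_mul_signChange o hτ η₁.2 η₂.2 hη' hσ a1 a2 b1 b2 hc.2.1 a3 b3 hc.2.2 hr]
      exact neg_add_cancel _
    · rintro η - ⟨h1, h2⟩
      by_contra h0
      obtain ⟨h3, -, h5⟩ := incChange_ne_zero o (left_ne_zero_of_mul h0)
      obtain ⟨h4, -, -⟩ := incChange_ne_zero o (right_ne_zero_of_mul h0)
      rcases hall η h3 h4 h5 with h | h
      exacts [h1 h, h2 h]
    · exact fun h => absurd (Finset.mem_univ _) h
    · exact fun h => absurd (Finset.mem_univ _) h
  · refine Finset.sum_eq_zero fun η _ => ?_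
    by_contra h0
    obtain ⟨h3, -, h3'⟩ := incChange_ne_zero o (left_ne_zero_of_mul h0)
    obtain ⟨h4, h4', h5⟩ := incChange_ne_zero o (right_ne_zero_of_mul h0)
    exact hc ⟨h3.trans h4, h4', by omega⟩

theorem incSame_mul_incChange {τ η' η σ : Cone N} (hτ : τ ∈ Δ.cones) (hη' : η' ∈ Δ.cones)
    (hη : η ∈ Δ.cones) (hσ : σ ∈ Δ.cones) :
    incSame o τ η σ * incChange o τ η' η + incChange o τ η' σ * incSame o η' η σ = 0 := by
  by_cases hc : τ ≤ η' ∧ η' ≤ η ∧ η ≤ σ ∧ coneDim η' = coneDim τ + 1 ∧ coneDim σ = coneDim η + 1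
  · obtain ⟨h1, h2, h3, h4, h5⟩ := hc
    rw [incSame, if_pos ⟨h1.trans h2, h3, h5⟩, incChange, dif_pos ⟨h1, h2, h4⟩,
      incChange, dif_pos ⟨h1, h2.trans h3, h4⟩, incSame, if_pos ⟨h2, h3, h5⟩,
      signSame_mul_signChange o hτ hη' hη hσ h1 h2 h3 h4 h5]
    exact neg_add_cancel _
  · have e1 : incSame o τ η σ * incChange o τ η' η = 0 := by
      by_contra h0
      obtain ⟨-, h3, h3'⟩ := incSame_ne_zero o (left_ne_zero_of_mul h0)
      obtain ⟨h4, h4', h5⟩ := incChange_ne_zero o (right_ne_zero_of_mul h0)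
      exact hc ⟨h4, h4', h3, h5, h3'⟩
    have e2 : incChange o τ η' σ * incSame o η' η σ = 0 := by
      by_contra h0
      obtain ⟨h4, -, h5⟩ := incChange_ne_zero o (left_ne_zero_of_mul h0)
      obtain ⟨h2, h3, h3'⟩ := incSame_ne_zero o (right_ne_zero_of_mul h0)
      exact hc ⟨h4, h2, h3, h5, h3'⟩
    rw [e1, e2, add_zero]

section

variable (R : Type*) [CommRing R] (p q : ℕ)

theorem tropicalDiff_comp_tropicalDiff (hΔ : ∀ σ ∈ Δ.cones, Nonempty (Frame σ)) :
    tropicalDiff o R p (q + 1) ∘ₗ tropicalDiff o R p q = 0 := by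
  refine LinearMap.ext fun α => funext fun δ => ?_
  obtain ⟨⟨τ, σ⟩, hδ⟩ := δ
  have hδ' := hδ
  obtain ⟨hτ, hσ, hτσ, hd⟩ := hδ'
  dsimp only at hτ hσ hτσ hd
  have e1 : ∀ η : Δ.cones, (incSame o τ η σ : R) •
      pull Δ R p τ τ η σ (component (tropicalDiff o R p q α) τ η) =
      ∑ η' : Δ.cones, ((incSame o τ η σ * incSame o τ η' η : ℤ) : R) •
        pull Δ R p τ τ η' σ (component α τ η') +
      ∑ η' : Δ.cones, ((incSame o τ η σ * incChange o τ η' η : ℤ) : R) •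
        pull Δ R p τ η' η σ (component α η' η) := by
    intro η
    by_cases h0 : incSame o τ η σ = 0
    · simp only [h0, zero_mul, Int.cast_zero, zero_smul, Finset.sum_const_zero, add_zero]
    obtain ⟨h1, h2, h3⟩ := incSame_ne_zero o h0
    rw [component_tropicalDiff o _ ⟨hτ, η.2, h1, by omega⟩, map_add, map_sum, map_sum, smul_add,
      Finset.smul_sum, Finset.smul_sum]
    refine congrArg₂ (· + ·) (Finset.sum_congr rfl fun η' _ => ?_)
      (Finset.sum_congr rfl fun η' _ => ?_)
    · by_cases h4 : incSame o τ η' η = 0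
      · rw [h4, mul_zero, Int.cast_zero, zero_smul, zero_smul, map_zero, smul_zero]
      obtain ⟨h5, h6, h7⟩ := incSame_ne_zero o h4
      rw [map_smul, smul_smul, pull_pull le_rfl le_rfl h6 h2, Int.cast_mul]
    · by_cases h4 : incChange o τ η' η = 0
      · rw [h4, mul_zero, Int.cast_zero, zero_smul, zero_smul, map_zero, smul_zero]
      obtain ⟨h5, h6, h7⟩ := incChange_ne_zero o h4
      rw [map_smul, smul_smul, pull_pull le_rfl h5 le_rfl h2, Int.cast_mul]
  have e2 : ∀ η : Δ.cones, (incChange o τ η σ : R) •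
      pull Δ R p τ η σ σ (component (tropicalDiff o R p q α) η σ) =
      ∑ η' : Δ.cones, ((incChange o τ η σ * incSame o η η' σ : ℤ) : R) •
        pull Δ R p τ η η' σ (component α η η') +
      ∑ η' : Δ.cones, ((incChange o τ η σ * incChange o η η' σ : ℤ) : R) •
        pull Δ R p τ η' σ σ (component α η' σ) := by
    intro η
    by_cases h0 : incChange o τ η σ = 0
    · simp only [h0, zero_mul, Int.cast_zero, zero_smul, Finset.sum_const_zero, add_zero]
    obtain ⟨h1, h2, h3⟩ := incChange_ne_zero o h0
    rw [component_tropicalDiff o _ ⟨η.2, hσ, h2, by omega⟩, map_add, map_sum, map_sum, smul_add,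
      Finset.smul_sum, Finset.smul_sum]
    refine congrArg₂ (· + ·) (Finset.sum_congr rfl fun η' _ => ?_)
      (Finset.sum_congr rfl fun η' _ => ?_)
    · by_cases h4 : incSame o η η' σ = 0
      · rw [h4, mul_zero, Int.cast_zero, zero_smul, zero_smul, map_zero, smul_zero]
      obtain ⟨h5, h6, h7⟩ := incSame_ne_zero o h4
      rw [map_smul, smul_smul, pull_pull h1 le_rfl h6 le_rfl, Int.cast_mul]
    · by_cases h4 : incChange o η η' σ = 0
      · rw [h4, mul_zero, Int.cast_zero, zero_smul, zero_smul, map_zero, smul_zero]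
      obtain ⟨h5, h6, h7⟩ := incChange_ne_zero o h4
      rw [map_smul, smul_smul, pull_pull h1 h5 le_rfl le_rfl, Int.cast_mul]
  have h1 := component_tropicalDiff (R := R) (p := p) (q := q + 1) o (tropicalDiff o R p q α) hδ
  refine (component_of_face (q := q + 1 + 1) _ hδ).symm.trans (h1.trans ?_)
  refine (congrArg₂ (fun x y : MultiCotangent Δ R p τ σ => x + y)
    (Finset.sum_congr rfl fun η _ => e1 η) (Finset.sum_congr rfl fun η _ => e2 η)).trans ?_
  exact sum_sum_cancel (fun η' => sum_incSame_mul_incSame o hΔ hτ η'.2 hσ)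
    (fun η' => sum_incChange_mul_incChange o hΔ hτ η'.2 hσ)
    (fun η η' => incSame_mul_incChange o hτ η'.2 η.2 hσ) _ _ _

end

end Complexes

/-! ### The cubical differential squares to zero -/

section Cubical

variable {N : Type*} [AddCommGroup N] {Δ : RationalFan N} {R : Type*} [CommRing R] {k : ℤ}

open Classical in
/-- The value of a form on a multivector, zero if the form is not defined there. -/
def eval {τ σ : Cone N} (α : MultiCotangent Δ R k τ σ)
    (x : ExteriorAlgebra ℤ (QuotLattice τ)) : R :=
  if h : x ∈ multiTangent Δ k τ σ then α ⟨x, h⟩ else 0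

theorem eval_of_mem {τ σ : Cone N} (α : MultiCotangent Δ R k τ σ)
    {x : ExteriorAlgebra ℤ (QuotLattice τ)} (h : x ∈ multiTangent Δ k τ σ) :
    eval α x = α ⟨x, h⟩ := dif_pos h

theorem eval_coe {τ σ : Cone N} (α : MultiCotangent Δ R k τ σ) (x : multiTangent Δ k τ σ) :
    eval α x = α x := dif_pos x.2

theorem eval_zero {τ σ : Cone N} (α : MultiCotangent Δ R k τ σ) : eval α 0 = 0 := by
  rw [eval_of_mem α (zero_mem _)]
  exact map_zero α

theorem eval_neg {τ σ : Cone N} (α : MultiCotangent Δ R k τ σ)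
    (x : ExteriorAlgebra ℤ (QuotLattice τ)) : eval α (-x) = -eval α x := by
  by_cases h : x ∈ multiTangent Δ k τ σ
  · rw [eval_of_mem α h, eval_of_mem α (neg_mem h), ← map_neg]
    rfl
  · rw [eval, dif_neg (fun h' => h (by simpa using neg_mem h')), eval, dif_neg h, neg_zero]

theorem eval_smul {τ σ : Cone N} (α : MultiCotangent Δ R k τ σ) (c : ℤ)
    {x : ExteriorAlgebra ℤ (QuotLattice τ)} (h : x ∈ multiTangent Δ k τ σ) :
    eval α (c • x) = c * eval α x := by
  rw [eval_of_mem α h, eval_of_mem α (Submodule.smul_mem _ c h), ← zsmul_eq_mul, ← map_smul]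
  rfl

theorem eval_ext {τ σ : Cone N} {α β : MultiCotangent Δ R k τ σ}
    (h : ∀ x ∈ multiTangent Δ k τ σ, eval α x = eval β x) : α = β := by
  ext x
  rw [← eval_coe, ← eval_coe, h x x.2]

theorem eval_zero_left {τ σ : Cone N} (x : ExteriorAlgebra ℤ (QuotLattice τ)) :
    eval (0 : MultiCotangent Δ R k τ σ) x = 0 := by
  rw [eval]
  split_ifs <;> rfl

variable [Module.Finite ℤ N]

open Classical in
/-- The map `wedgeNormal`, set to zero when `τ` is not contained in `σ`. -/
def wedge (τ σ : Cone N) :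
    ExteriorAlgebra ℤ (QuotLattice σ) →ₗ[ℤ] ExteriorAlgebra ℤ (QuotLattice τ) :=
  if h : τ ≤ σ then wedgeNormal h else 0

theorem wedge_mem {τ σ : Cone N} {x : ExteriorAlgebra ℤ (QuotLattice σ)} {l : ℤ} (hl : l = k + 1)
    (hx : x ∈ multiTangent Δ k σ σ) : wedge τ σ x ∈ multiTangent Δ l τ τ := by
  rw [wedge]
  split_ifs with h
  · exact hl ▸ wedgeNormal_mem Δ k h hx
  · exact zero_mem _

theorem wedge_of_le {τ σ : Cone N} (h : τ ≤ σ) : wedge τ σ = wedgeNormal h := dif_pos h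

open Classical in
/-- The cubical differential, evaluated on a multivector. -/
theorem cubicalDiff_apply {p q : ℕ} (α : CubicalCochain Δ R p q) (σ : Δ.conesOfDim (q + 1))
    {x : ExteriorAlgebra ℤ (QuotLattice σ.1)}
    (hx : x ∈ multiTangent Δ ((p : ℤ) - ((q + 1 : ℕ) : ℤ)) σ.1 σ.1) :
    eval (cubicalDiff Δ R p q α σ) x = ∑ τ : Δ.conesOfDim q, eval (α τ) (wedge τ.1 σ.1 x) := by
  rw [eval_of_mem _ hx]
  have h1 : cubicalDiff Δ R p q α σ = ∑ τ : Δ.conesOfDim q,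
      (if h : τ.1 ≤ σ.1 then contract Δ R (by push_cast; ring) h ∘ₗ LinearMap.proj τ else 0 :
        CubicalCochain Δ R p q →ₗ[R] MultiCotangent Δ R ((p : ℤ) - ((q + 1 : ℕ) : ℤ)) σ.1 σ.1) α :=
    LinearMap.sum_apply _ _ _
  rw [h1]
  refine (LinearMap.sum_apply _ _ _).trans (Finset.sum_congr rfl fun τ _ => ?_)
  rw [eval_of_mem _ (wedge_mem (by push_cast; ring) hx)]
  by_cases h : τ.1 ≤ σ.1
  · simp only [wedge_of_le h]
    rw [dif_pos h]
    rfl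
  · have h2 : wedge τ.1 σ.1 = 0 := dif_neg h
    simp only [h2]
    rw [dif_neg h]
    exact (map_zero (α τ)).symm

variable [Module.Free ℤ N]

/-- The two cones between `τ` and `σ` contribute opposite terms to the square of the cubical
differential. -/
theorem sum_eval_wedge_wedge (hΔ : ∀ σ ∈ Δ.cones, Nonempty (Frame σ)) {q : ℕ}
    (τ : Δ.conesOfDim q) (σ : Δ.conesOfDim (q + 1 + 1)) (α : MultiCotangent Δ R k τ.1 τ.1)
    (x : ExteriorAlgebra ℤ (QuotLattice σ.1)) :
    ∑ η : Δ.conesOfDim (q + 1), eval α (wedge τ.1 η.1 (wedge η.1 σ.1 x)) = 0 := by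
  have hle : ∀ η : Δ.conesOfDim (q + 1), eval α (wedge τ.1 η.1 (wedge η.1 σ.1 x)) ≠ 0 →
      τ.1 ≤ η.1 ∧ η.1 ≤ σ.1 := by
    intro η h
    constructor
    · by_contra h'
      rw [wedge, dif_neg h', LinearMap.zero_apply, eval_zero] at h
      exact h rfl
    · by_contra h'
      rw [show wedge η.1 σ.1 = 0 from dif_neg h', LinearMap.zero_apply, map_zero, eval_zero] at h
      exact h rfl
  by_cases hc : τ.1 ≤ σ.1
  · obtain ⟨η₁, η₂, hne, a1, a2, a3, b1, b2, b3, hr, hall⟩ :=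
      exists_diamond hΔ τ.2.1 σ.2.1 hc (by rw [τ.2.2, σ.2.2])
    rw [τ.2.2] at a3 b3
    rw [Finset.sum_eq_add ⟨η₁.1, η₁.2, a3⟩ ⟨η₂.1, η₂.2, b3⟩]
    · rw [wedge_of_le a1, wedge_of_le a2, wedge_of_le b1, wedge_of_le b2,
        wedgeNormal_wedgeNormal_neg τ.2.1 η₁.2 η₂.2 σ.2.1 a1 a2 b1 b2
        (by rw [τ.2.2, a3]) (by rw [τ.2.2, b3]) (by rw [τ.2.2, σ.2.2]) hr, eval_neg]
      exact add_neg_cancel _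
    · intro h
      exact hne (Subtype.ext (Subtype.ext_iff.1 h :))
    · rintro η - ⟨h1, h2⟩
      by_contra h0
      obtain ⟨h3, h4⟩ := hle η h0
      rcases hall ⟨η.1, η.2.1⟩ h3 h4 (by rw [τ.2.2]; exact η.2.2) with h | h
      · exact h1 (Subtype.ext (Subtype.ext_iff.1 h :))
      · exact h2 (Subtype.ext (Subtype.ext_iff.1 h :))
    · exact fun h => absurd (Finset.mem_univ _) h
    · exact fun h => absurd (Finset.mem_univ _) h
  · refine Finset.sum_eq_zero fun η _ => ?_
    by_contra h0
    obtain ⟨h3, h4⟩ := hle η h0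
    exact hc (h3.trans h4)

theorem cubicalDiff_comp_cubicalDiff (R : Type*) [CommRing R] (p q : ℕ)
    (hΔ : ∀ σ ∈ Δ.cones, Nonempty (Frame σ)) :
    cubicalDiff Δ R p (q + 1) ∘ₗ cubicalDiff Δ R p q = 0 := by
  refine LinearMap.ext fun α => funext fun σ => eval_ext fun x hx => ?_
  refine ((cubicalDiff_apply (cubicalDiff Δ R p q α) σ hx).trans
    (Finset.sum_congr rfl fun η _ => cubicalDiff_apply α η (wedge_mem (by push_cast; ring) hx))).trans
    ?_
  rw [Finset.sum_comm]
  refine (Finset.sum_eq_zero fun τ _ => sum_eval_wedge_wedge hΔ τ σ (α τ) x).trans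
    (eval_zero_left x).symm

end Cubical

/-! ### Forms on the faces of a simplicial cone -/

section Local

variable {N : Type*} [AddCommGroup N] {Δ : RationalFan N} {R : Type*} [CommRing R]

theorem eval_sub {k : ℤ} {τ σ : Cone N} (α : MultiCotangent Δ R k τ σ)
    {x y : ExteriorAlgebra ℤ (QuotLattice τ)} (hx : x ∈ multiTangent Δ k τ σ)
    (hy : y ∈ multiTangent Δ k τ σ) : eval α (x - y) = eval α x - eval α y := by
  rw [eval_of_mem α hx, eval_of_mem α hy, eval_of_mem α (sub_mem hx hy), ← map_sub]
  rfl

/-- An additive property of multivectors holds on a multi-tangent space as soon as it holds on the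
exterior powers of the lattices of the cones. -/
theorem multiTangent_induction {k : ℤ} {τ σ : Cone N}
    {p : ExteriorAlgebra ℤ (QuotLattice τ) → Prop}
    (mem : ∀ η ∈ Δ.cones, σ ≤ η → ∀ x ∈ extPow (relLattice τ η) k, p x)
    (zero : p 0) (add : ∀ x y, p x → p y → p (x + y))
    {x : ExteriorAlgebra ℤ (QuotLattice τ)} (hx : x ∈ multiTangent Δ k τ σ) : p x :=
  Submodule.iSup_induction _ (motive := p) hx (fun η x hx => mem η.1 η.2.1 η.2.2 x hx) zero add

theorem extPow_le_multiTangent (k : ℤ) (τ : Cone N) {σ η : Cone N} (hη : η ∈ Δ.cones) (h : σ ≤ η) :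
    extPow (relLattice τ η) k ≤ multiTangent Δ k τ σ :=
  le_iSup (fun η : {η : Cone N // η ∈ Δ.cones ∧ σ ≤ η} => extPow (relLattice τ η.1) k) ⟨η, hη, h⟩

theorem contr_mem_multiTangent {k : ℤ} {τ σ : Cone N} (f : QuotLattice τ →ₗ[ℤ] ℤ)
    {x : ExteriorAlgebra ℤ (QuotLattice τ)} (hx : x ∈ multiTangent Δ k τ σ) :
    contr f x ∈ multiTangent Δ (k - 1) τ σ := by
  refine multiTangent_induction (p := fun x => contr f x ∈ multiTangent Δ (k - 1) τ σ) ?_ ?_ ?_ hx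
  · intro η hη h x hx
    exact extPow_le_multiTangent _ _ hη h (contr_mem_extPow f hx)
  · rw [map_zero]; exact zero_mem _
  · intro x y hx hy
    rw [map_add]; exact add_mem hx hy

theorem mul_mem_multiTangent {k l : ℤ} {τ σ : Cone N} (hl : 0 ≤ l)
    {y x : ExteriorAlgebra ℤ (QuotLattice τ)} (hy : y ∈ extPow (relLattice τ σ) l)
    (hx : x ∈ multiTangent Δ k τ σ) : y * x ∈ multiTangent Δ (l + k) τ σ := by
  refine multiTangent_induction (p := fun x => y * x ∈ multiTangent Δ (l + k) τ σ) ?_ ?_ ?_ hx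
  · intro η hη h x hx
    exact extPow_le_multiTangent _ _ hη h
      (mul_mem_extPow_add hl (extPow_mono (relLattice_mono τ h) l hy) hx)
  · rw [mul_zero]; exact zero_mem _
  · intro x y hx hy
    rw [mul_add]; exact add_mem hx hy

theorem ι_mul_mem_multiTangent {k : ℤ} {τ σ : Cone N} {v : QuotLattice τ}
    (hv : v ∈ relLattice τ σ) {x : ExteriorAlgebra ℤ (QuotLattice τ)}
    (hx : x ∈ multiTangent Δ k τ σ) :
    ExteriorAlgebra.ι ℤ v * x ∈ multiTangent Δ (k + 1) τ σ := by
  rw [add_comm]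
  refine mul_mem_multiTangent zero_le_one ?_ hx
  simpa [extPow_zero] using mul_mem_extPow hv (Submodule.one_le.1 (extPow_zero _).ge)

theorem faceMap_surjective (k : ℤ) {τ' τ : Cone N} (σ : Cone N) (h : τ' ≤ τ) :
    Function.Surjective (faceMap Δ k h (le_refl σ)) := by
  rintro ⟨x, hx⟩
  have : ∃ y ∈ multiTangent Δ k τ' σ, ExteriorAlgebra.map (proj h) y = x := by
    refine multiTangent_induction (p := fun x => ∃ y ∈ multiTangent Δ k τ' σ,
      ExteriorAlgebra.map (proj h) y = x) ?_ ?_ ?_ hx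
    · intro η hη hσ x hx
      rw [← relLattice_map_proj h, ← map_extPow] at hx
      obtain ⟨y, hy, rfl⟩ := hx
      exact ⟨y, extPow_le_multiTangent _ _ hη hσ hy, rfl⟩
    · exact ⟨0, zero_mem _, map_zero _⟩
    · rintro _ _ ⟨x, hx, rfl⟩ ⟨y, hy, rfl⟩
      exact ⟨x + y, add_mem hx hy, map_add _ _ _⟩
  obtain ⟨y, hy, rfl⟩ := this
  exact ⟨⟨y, hy⟩, rfl⟩

theorem pull_injective {k : ℤ} {τ' τ : Cone N} (σ : Cone N) (h : τ' ≤ τ) :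
    Function.Injective (pull Δ R k τ' τ σ σ) := by
  intro α β hab
  ext x
  obtain ⟨y, rfl⟩ := faceMap_surjective k σ h x
  rw [← pull_apply h le_rfl, ← pull_apply h le_rfl, hab]

/-- Forms that vanish on the kernel of `F_k(□^τ'_σ) → F_k(□^τ_σ)` come from `F^k(□^τ_σ)`. -/
theorem exists_pull_eq {k : ℤ} {τ' τ : Cone N} (σ : Cone N) (h : τ' ≤ τ)
    (α : MultiCotangent Δ R k τ' σ)
    (hα : ∀ x : multiTangent Δ k τ' σ, ExteriorAlgebra.map (proj h) (x : ExteriorAlgebra ℤ _) = 0 →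
      α x = 0) : ∃ β, pull Δ R k τ' τ σ σ β = α := by
  let f := faceMap Δ k h (le_refl σ)
  refine ⟨(LinearMap.ker f).liftQ α (fun x hx => hα x ?_) ∘ₗ
    (f.quotKerEquivOfSurjective (faceMap_surjective k σ h)).symm.toLinearMap, ?_⟩
  · exact congrArg Subtype.val (LinearMap.mem_ker.1 hx)
  · ext x
    rw [pull_apply h le_rfl, LinearMap.comp_apply]
    have : (f.quotKerEquivOfSurjective (faceMap_surjective k σ h)).symm (f x) =
        (LinearMap.ker f).mkQ x := by
      rw [LinearEquiv.symm_apply_eq]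
      rfl
    change (LinearMap.ker f).liftQ α _
      ((f.quotKerEquivOfSurjective (faceMap_surjective k σ h)).symm (f x)) = α x
    rw [this]
    rfl

namespace Frame

variable {σ : Cone N} (F : Frame σ)

/-- The ray generators of a frame, as vectors of `N^0`. The lattice `N^0` is the quotient of `N`
by the zero sublattice, so that it is not literally `N`. -/
def vec (i : Fin F.n) : QuotLattice (⊥ : Cone N) := (coneLattice ⊥).mkQ (F.e i)

theorem face_empty : F.face ∅ = ⊥ := by simp [face]

theorem f_eq_zero_of_mem_bot (i : Fin F.n) {v : N} (hv : v ∈ coneLattice (⊥ : Cone N)) :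
    F.f i v = 0 := by
  rw [← F.face_empty] at hv
  exact F.f_eq_zero_of_mem (Finset.notMem_empty i) hv

/-- The dual forms of a frame, on `N^0`. -/
def form (i : Fin F.n) : QuotLattice (⊥ : Cone N) →ₗ[ℤ] ℤ :=
  (coneLattice ⊥).liftQ (F.f i) fun _ hv => F.f_eq_zero_of_mem_bot i hv

theorem form_mkQ (i : Fin F.n) (v : N) : F.form i ((coneLattice ⊥).mkQ v) = F.f i v := rfl

theorem form_vec_self (i : Fin F.n) : F.form i (F.vec i) = F.m := by
  rw [vec, form_mkQ, F.f_e, if_pos rfl]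

theorem form_vec_of_ne {i j : Fin F.n} (h : i ≠ j) : F.form i (F.vec j) = 0 := by
  rw [vec, form_mkQ, F.f_e, if_neg h]

theorem vec_mem (i : Fin F.n) : F.vec i ∈ relLattice ⊥ σ := by
  refine Submodule.mem_map_of_mem ?_
  have := F.e_mem_coneLattice (Finset.mem_univ i)
  rwa [F.face_univ] at this

theorem proj_vec {S : Finset (Fin F.n)} {i : Fin F.n} (hi : i ∈ S) {τ : Cone N}
    (hτ : F.face S ≤ τ) :
    proj (bot_le : ⊥ ≤ τ) (F.vec i) = 0 := by
  rw [vec, proj_mkQ, Submodule.mkQ_apply, Submodule.Quotient.mk_eq_zero]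
  exact coneLattice_mono hτ (F.e_mem_coneLattice hi)

/-- The endomorphism `x ↦ e_i ∧ (f_i ⌟ x)` of the exterior algebra: `m` times the projection to the
multivectors divisible by `e_i`. -/
def rayProj (i : Fin F.n) :
    ExteriorAlgebra ℤ (QuotLattice (⊥ : Cone N)) →ₗ[ℤ]
      ExteriorAlgebra ℤ (QuotLattice (⊥ : Cone N)) :=
  LinearMap.mulLeft ℤ (ExteriorAlgebra.ι ℤ (F.vec i)) ∘ₗ contr (F.form i)

theorem rayProj_apply (i : Fin F.n) (x : ExteriorAlgebra ℤ (QuotLattice (⊥ : Cone N))) :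
    F.rayProj i x = ExteriorAlgebra.ι ℤ (F.vec i) * contr (F.form i) x := rfl

theorem rayProj_rayProj_self (i : Fin F.n) (x : ExteriorAlgebra ℤ (QuotLattice (⊥ : Cone N))) :
    F.rayProj i (F.rayProj i x) = F.m • F.rayProj i x := by
  rw [rayProj_apply, rayProj_apply, contr_ι_mul, contr_contr, mul_zero, sub_zero, form_vec_self,
    mul_smul_comm]

theorem rayProj_comm (i j : Fin F.n) (x : ExteriorAlgebra ℤ (QuotLattice (⊥ : Cone N))) :
    F.rayProj i (F.rayProj j x) = F.rayProj j (F.rayProj i x) := by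
  by_cases h : i = j
  · rw [h]
  · rw [rayProj_apply, rayProj_apply, contr_ι_mul, form_vec_of_ne F h, zero_smul, zero_sub, mul_neg,
      rayProj_apply, rayProj_apply, contr_ι_mul, form_vec_of_ne F (Ne.symm h), zero_smul, zero_sub,
      mul_neg, contr_comm, mul_neg, mul_neg, neg_neg, ι_mul_ι_mul_comm]

theorem rayProj_mem (i : Fin F.n) {k : ℤ} {x : ExteriorAlgebra ℤ (QuotLattice (⊥ : Cone N))}
    (hx : x ∈ multiTangent Δ k ⊥ σ) : F.rayProj i x ∈ multiTangent Δ k ⊥ σ := by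
  have := ι_mul_mem_multiTangent (F.vec_mem i) (contr_mem_multiTangent (F.form i) hx)
  rwa [sub_add_cancel] at this

/-- The component in the direction `e_i` of a form on `F_k(□^0_σ)`: the form `x ↦ u⁻¹ α(e_i ∧ (f_i
⌟ x))`, where `u` is the image in `R` of the multiplicity `m`. -/
def idem (Δ : RationalFan N) (u : Rˣ) (k : ℤ) (i : Fin F.n) :
    MultiCotangent Δ R k ⊥ σ →ₗ[R] MultiCotangent Δ R k ⊥ σ :=
  (u⁻¹ : Rˣ).1 • transpose R
    ((F.rayProj i).restrict fun _ hx => F.rayProj_mem (Δ := Δ) (k := k) i hx)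

variable {u : Rˣ} {k : ℤ}

theorem eval_idem (i : Fin F.n) (α : MultiCotangent Δ R k ⊥ σ)
    {x : ExteriorAlgebra ℤ (QuotLattice (⊥ : Cone N))} (hx : x ∈ multiTangent Δ k ⊥ σ) :
    eval (F.idem Δ u k i α) x = (u⁻¹ : Rˣ).1 * eval α (F.rayProj i x) := by
  rw [eval_of_mem _ hx, eval_of_mem _ (F.rayProj_mem i hx)]
  rfl

theorem idem_idem (hu : (u : R) = F.m) (i : Fin F.n) (α : MultiCotangent Δ R k ⊥ σ) :
    F.idem Δ u k i (F.idem Δ u k i α) = F.idem Δ u k i α := by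
  refine eval_ext fun x hx => ?_
  rw [eval_idem F i _ hx, eval_idem F i _ (F.rayProj_mem i hx), rayProj_rayProj_self,
    eval_smul _ _ (F.rayProj_mem i hx), eval_idem F i _ hx, ← hu, ← mul_assoc _ (u : R),
    Units.inv_mul, one_mul]

theorem idem_comm (i j : Fin F.n) (α : MultiCotangent Δ R k ⊥ σ) :
    F.idem Δ u k i (F.idem Δ u k j α) = F.idem Δ u k j (F.idem Δ u k i α) := by
  refine eval_ext fun x hx => ?_
  rw [eval_idem F i _ hx, eval_idem F j _ (F.rayProj_mem i hx), eval_idem F j _ hx,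
    eval_idem F i _ (F.rayProj_mem j hx), rayProj_comm]

/-- Forms on a face of the cube have no component in the directions of its sedentarity. -/
theorem idem_pull {S : Finset (Fin F.n)} {i : Fin F.n} (hi : i ∈ S) {τ : Cone N} (hτ : F.face S = τ)
    (β : MultiCotangent Δ R k τ σ) : F.idem Δ u k i (pull Δ R k ⊥ τ σ σ β) = 0 := by
  refine eval_ext fun x hx => ?_
  rw [eval_idem F i _ hx, eval_of_mem _ (F.rayProj_mem i hx), pull_apply bot_le le_rfl,
    eval_zero_left]
  have : faceMap Δ k (bot_le : ⊥ ≤ τ) (le_refl σ) ⟨F.rayProj i x, F.rayProj_mem i hx⟩ = 0 := by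
    refine Subtype.ext ?_
    change ExteriorAlgebra.map (proj bot_le) (F.rayProj i x) = 0
    rw [rayProj_apply, map_mul, ExteriorAlgebra.map_apply_ι, F.proj_vec hi hτ.le, map_zero, zero_mul]
  rw [this, map_zero, mul_zero]

/-- On multi-tangent vectors, the map induced by `v ↦ m v - f_i(v) e_i` is, up to powers of `m`, the
projection complementary to `rayProj`. -/
theorem smul_map_eq (i : Fin F.n) {p : ℕ} {x : ExteriorAlgebra ℤ (QuotLattice (⊥ : Cone N))}
    (hx : x ∈ multiTangent Δ p ⊥ σ) :
    F.m • ExteriorAlgebra.map (F.m • LinearMap.id - (F.form i).smulRight (F.vec i)) x =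
      F.m ^ p • (F.m • x - F.rayProj i x) := by
  refine multiTangent_induction (p := fun x => F.m • ExteriorAlgebra.map
    (F.m • LinearMap.id - (F.form i).smulRight (F.vec i)) x = F.m ^ p • (F.m • x - F.rayProj i x))
    ?_ ?_ ?_ hx
  · intro η _ _ x hx
    exact smul_map_sub _ _ _ hx
  · simp
  · intro x y hx hy
    rw [map_add, smul_add, hx, hy, map_add]
    module

theorem map_mem_multiTangent_of_le {g : QuotLattice (⊥ : Cone N) →ₗ[ℤ] QuotLattice (⊥ : Cone N)}
    (hg : ∀ η, σ ≤ η → (relLattice ⊥ η).map g ≤ relLattice ⊥ η)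
    {x : ExteriorAlgebra ℤ (QuotLattice (⊥ : Cone N))} (hx : x ∈ multiTangent Δ k ⊥ σ) :
    ExteriorAlgebra.map g x ∈ multiTangent Δ k ⊥ σ := by
  refine multiTangent_induction (p := fun x => ExteriorAlgebra.map g x ∈ multiTangent Δ k ⊥ σ)
    ?_ ?_ ?_ hx
  · intro η hη h x hx
    refine extPow_le_multiTangent _ _ hη h (extPow_mono (hg η h) k ?_)
    rw [← map_extPow]
    exact Submodule.mem_map_of_mem hx
  · rw [map_zero]; exact zero_mem _
  · intro x y hx hy
    rw [map_add]; exact add_mem hx hy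

/-- A form without component in the directions `S` is, up to an invertible factor, invariant under
an endomorphism of the lattice that kills the vectors `e_i`, `i ∈ S`. -/
theorem exists_endomorphism (hu : (u : R) = F.m) {p : ℕ} (α : MultiCotangent Δ R p ⊥ σ)
    (S : Finset (Fin F.n)) (hα : ∀ i ∈ S, F.idem Δ u p i α = 0) :
    ∃ (g : QuotLattice (⊥ : Cone N) →ₗ[ℤ] QuotLattice (⊥ : Cone N)) (w : Rˣ),
      (∀ i ∈ S, g (F.vec i) = 0) ∧ (∀ η, σ ≤ η → (relLattice ⊥ η).map g ≤ relLattice ⊥ η) ∧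
      ∀ x ∈ multiTangent Δ p ⊥ σ, eval α (ExteriorAlgebra.map g x) = w * eval α x := by
  induction S using Finset.induction_on with
  | empty => exact ⟨LinearMap.id, 1, by simp, by simp, by simp [ExteriorAlgebra.map_id]⟩
  | insert j S hj ih =>
    obtain ⟨g, w, h1, h2, h3⟩ := ih fun i hi => hα i (Finset.mem_insert_of_mem hi)
    let gj := F.m • LinearMap.id - (F.form j).smulRight (F.vec j)
    have hgj : ∀ η, σ ≤ η → (relLattice ⊥ η).map gj ≤ relLattice ⊥ η := by
      rintro η hη _ ⟨v, hv, rfl⟩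
      exact sub_mem (Submodule.smul_mem _ _ hv)
        (Submodule.smul_mem _ _ (relLattice_mono ⊥ hη (F.vec_mem j)))
    refine ⟨g ∘ₗ gj, w * u ^ p, ?_, ?_, ?_⟩
    · intro i hi
      by_cases hij : i = j
      · subst hij
        simp [gj, form_vec_self]
      · have := h1 i ((Finset.mem_insert.1 hi).resolve_left hij)
        simp [gj, form_vec_of_ne F (Ne.symm hij), this]
    · intro η hη
      rw [Submodule.map_comp]
      exact (Submodule.map_mono (hgj η hη)).trans (h2 η hη)
    · intro x hx
      have hx' := map_mem_multiTangent_of_le hgj hx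
      rw [← ExteriorAlgebra.map_comp_map, AlgHom.comp_apply, h3 _ hx']
      have h4 := congrArg (eval α) (F.smul_map_eq j hx)
      have h5 := F.eval_idem (u := u) j α hx
      rw [hα j (Finset.mem_insert_self j S), eval_zero_left] at h5
      have h6 : eval α (F.rayProj j x) = 0 := (Units.mul_right_eq_zero u⁻¹).1 h5.symm
      have hmx := Submodule.smul_mem (multiTangent Δ p ⊥ σ) F.m hx
      rw [eval_smul α _ hx', eval_smul α _ (sub_mem hmx (F.rayProj_mem j hx)),
        eval_sub α hmx (F.rayProj_mem j hx), eval_smul α _ hx, h6, sub_zero,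
        Int.cast_pow, ← hu] at h4
      have h7 : eval α (ExteriorAlgebra.map gj x) = (u : R) ^ p * eval α x := by
        refine (Units.mul_right_inj u).1 (h4.trans ?_)
        ring
      rw [h7, Units.val_mul, Units.val_pow_eq_pow_val, mul_assoc]

end Frame

end Local

/-! ### Capping the cubes with their orientations -/

section Cap

variable {N : Type*} [AddCommGroup N] {Δ : RationalFan N} {R : Type*} [CommRing R]

theorem coneDim_bot : coneDim (⊥ : Cone N) = 0 := by
  rw [coneDim, Submodule.bot_coe, Submodule.span_zero_singleton, finrank_bot]

theorem Orientation.ν_bot_mem (o : Orientation Δ) (hbot : ⊥ ∈ Δ.cones) {σ : Cone N}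
    (hσ : σ ∈ Δ.cones) :
    o.ν ⊥ σ ∈ extPow (relLattice ⊥ σ) (coneDim σ : ℤ) :=
  o.ν_mem hbot hσ bot_le (by rw [coneDim_bot, zero_add])

theorem exists_map_eq {k : ℤ} {τ' τ σ : Cone N} (h : τ' ≤ τ)
    {x : ExteriorAlgebra ℤ (QuotLattice τ)} (hx : x ∈ multiTangent Δ k τ σ) :
    ∃ y ∈ multiTangent Δ k τ' σ, ExteriorAlgebra.map (proj h) y = x := by
  obtain ⟨y, hy⟩ := faceMap_surjective k σ h ⟨x, hx⟩
  exact ⟨y, y.2, congrArg Subtype.val hy⟩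

namespace Frame

variable {σ : Cone N} (F : Frame σ) {u : Rˣ} {k : ℤ}

/-- Endomorphisms of `N^0` killing the ray generators of a face kill its lattice. -/
theorem eq_zero_of_vec {S : Finset (Fin F.n)}
    {g : QuotLattice (⊥ : Cone N) →ₗ[ℤ] QuotLattice (⊥ : Cone N)} (hg : ∀ i ∈ S, g (F.vec i) = 0)
    {v : QuotLattice (⊥ : Cone N)} (hv : v ∈ relLattice ⊥ (F.face S)) : g v = 0 := by
  obtain ⟨x, hx, rfl⟩ := hv
  have h1 : F.m • x - ∑ i ∈ S, F.f i x • F.e i ∈ coneLattice (⊥ : Cone N) := by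
    rw [mem_coneLattice, F.tmul_smul_sub_sum hx]
    exact zero_mem _
  have h2 := (Submodule.Quotient.mk_eq_zero _).2 h1
  rw [← Submodule.mkQ_apply, map_sub, sub_eq_zero, map_sum] at h2
  have h3 : F.m • g ((coneLattice ⊥).mkQ x) = 0 := by
    rw [← map_smul, ← map_smul, h2, map_sum]
    refine Finset.sum_eq_zero fun i hi => ?_
    rw [map_smul, map_smul]
    exact (congrArg _ (hg i hi)).trans (smul_zero _)
  exact (smul_eq_zero.1 h3).resolve_left F.m_pos.ne'

/-- The forms coming from the face `F_p(□^τ_σ)` are those without component in the directions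
of `τ`. -/
theorem exists_pull_of_idem [Module.Finite ℤ N] (hu : (u : R) = F.m) {p : ℕ}
    {S : Finset (Fin F.n)} (α : MultiCotangent Δ R p ⊥ σ) (hα : ∀ i ∈ S, F.idem Δ u p i α = 0) :
    ∃ β, pull Δ R p ⊥ (F.face S) σ σ β = α := by
  obtain ⟨g, w, h1, h2, h3⟩ := F.exists_endomorphism hu α S hα
  refine exists_pull_eq σ bot_le α fun x hx => ?_
  have hg : (g ∘ₗ projSection bot_le) ∘ₗ proj (bot_le : ⊥ ≤ F.face S) = g := by
    ext v
    have := F.eq_zero_of_vec h1 (sub_projSection_mem bot_le ((coneLattice ⊥).mkQ v))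
    rw [map_sub, sub_eq_zero] at this
    exact this
  have h4 := h3 x x.2
  rw [← hg, ← ExteriorAlgebra.map_comp_map, AlgHom.comp_apply, hx, map_zero, eval_zero,
    eval_coe] at h4
  exact (Units.mul_right_eq_zero w).1 h4.symm

/-- The product of the ray generators with indices in a list. -/
def vecProd (l : List (Fin F.n)) : ExteriorAlgebra ℤ (QuotLattice (⊥ : Cone N)) :=
  (l.map fun i => ExteriorAlgebra.ι ℤ (F.vec i)).prod

theorem vecProd_cons (i : Fin F.n) (l : List (Fin F.n)) :
    F.vecProd (i :: l) = ExteriorAlgebra.ι ℤ (F.vec i) * F.vecProd l := by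
  rw [vecProd, List.map_cons, List.prod_cons, vecProd]

theorem vecProd_mem (l : List (Fin F.n)) :
    F.vecProd l ∈ extPow (relLattice ⊥ σ) (l.length : ℤ) := by
  induction l with
  | nil => exact Submodule.one_le.1 (extPow_zero _).ge
  | cons i l ih =>
    rw [vecProd_cons]
    exact_mod_cast mul_mem_extPow (F.vec_mem i) ih

theorem contr_vecProd_mul {i : Fin F.n} {l : List (Fin F.n)} (hi : i ∉ l)
    (y : ExteriorAlgebra ℤ (QuotLattice (⊥ : Cone N))) :
    contr (F.form i) (F.vecProd l * y) =
      (-1 : ℤ) ^ l.length • (F.vecProd l * contr (F.form i) y) := by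
  induction l with
  | nil => simp [vecProd]
  | cons j l ih =>
    obtain ⟨hij, hil⟩ := not_or.1 (fun h => hi (List.mem_cons.2 h))
    rw [vecProd_cons, mul_assoc, contr_ι_mul, F.form_vec_of_ne hij, zero_smul, zero_sub, ih hil,
      mul_smul_comm, mul_assoc, List.length_cons, pow_succ, mul_neg_one, neg_smul]

/-- A form vanishing on the multiples of `∏ e_i` is killed by the product of the projections. -/
theorem prod_idem_eq_zero {l : List (Fin F.n)} (hl : l.Nodup) (α : MultiCotangent Δ R k ⊥ σ)
    (hα : ∀ y ∈ multiTangent Δ (k - l.length) ⊥ σ, eval α (F.vecProd l * y) = 0) :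
    (l.map (F.idem Δ u k)).prod α = 0 := by
  induction l generalizing α with
  | nil =>
    refine eval_ext fun x hx => ?_
    have := hα x (by simpa using hx)
    rw [vecProd, List.map_nil, List.prod_nil, one_mul] at this
    exact this.trans (eval_zero_left x).symm
  | cons i l ih =>
    obtain ⟨hi, hl⟩ := List.nodup_cons.1 hl
    rw [List.map_cons, List.prod_cons, Module.End.mul_apply, apply_prod F.idem_comm]
    refine ih hl _ fun y hy => ?_
    have hy' := mul_mem_multiTangent (by positivity) (F.vecProd_mem l) hy
    rw [add_sub_cancel] at hy'
    have h1 := contr_mem_multiTangent (F.form i) hy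
    have h2 := mul_mem_multiTangent (by positivity) (F.vecProd_mem (i :: l)) h1
    rw [show ((i :: l).length : ℤ) + (k - l.length - 1) = k by
      rw [List.length_cons]; push_cast; ring] at h2
    rw [eval_idem F i α hy', rayProj_apply, F.contr_vecProd_mul hi, mul_smul_comm, ← mul_assoc,
      ← vecProd_cons, eval_smul α _ h2, hα, mul_zero, mul_zero]
    rw [show k - ((i :: l).length : ℤ) = k - l.length - 1 by
      rw [List.length_cons]; push_cast; ring]
    exact h1

/-- The iterated contraction with the forms `f_i`. -/
def contrList : List (Fin F.n) →
    ExteriorAlgebra ℤ (QuotLattice (⊥ : Cone N)) →ₗ[ℤ] ExteriorAlgebra ℤ (QuotLattice (⊥ : Cone N))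
  | [] => LinearMap.id
  | i :: l => contrList l ∘ₗ contr (F.form i)

theorem contrList_cons (i : Fin F.n) (l : List (Fin F.n))
    (x : ExteriorAlgebra ℤ (QuotLattice (⊥ : Cone N))) :
    F.contrList (i :: l) x = F.contrList l (contr (F.form i) x) := rfl

theorem contrList_mem (l : List (Fin F.n)) {x : ExteriorAlgebra ℤ (QuotLattice (⊥ : Cone N))}
    (hx : x ∈ multiTangent Δ k ⊥ σ) : F.contrList l x ∈ multiTangent Δ (k - l.length) ⊥ σ := by
  induction l generalizing k x with
  | nil => simpa [contrList] using hx
  | cons i l ih =>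
    have := ih (contr_mem_multiTangent (F.form i) hx)
    rwa [show k - 1 - (l.length : ℤ) = k - (i :: l).length by
      rw [List.length_cons]; push_cast; ring] at this

theorem contrList_ι_mul {i : Fin F.n} {l : List (Fin F.n)} (hi : i ∉ l)
    (x : ExteriorAlgebra ℤ (QuotLattice (⊥ : Cone N))) :
    F.contrList l (ExteriorAlgebra.ι ℤ (F.vec i) * x) =
      (-1 : ℤ) ^ l.length • (ExteriorAlgebra.ι ℤ (F.vec i) * F.contrList l x) := by
  induction l generalizing x with
  | nil => simp [contrList]
  | cons j l ih =>
    obtain ⟨hij, hil⟩ := not_or.1 (fun h => hi (List.mem_cons.2 h))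
    rw [contrList_cons, contr_ι_mul, F.form_vec_of_ne (Ne.symm hij), zero_smul, zero_sub, map_neg,
      ih hil, contrList_cons, List.length_cons, pow_succ, mul_neg_one, neg_smul]

/-- Contracting `∏ e_i ∧ x` with all the `f_i` gives back `x` up to a power of `m`, modulo the
multivectors divisible by some `e_i`, which vanish in `⋀ N^σ`. -/
theorem map_contrList_vecProd_mul {l : List (Fin F.n)} (hl : l.Nodup)
    (x : ExteriorAlgebra ℤ (QuotLattice (⊥ : Cone N))) :
    ExteriorAlgebra.map (proj (bot_le : ⊥ ≤ σ)) (F.contrList l (F.vecProd l * x)) =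
      F.m ^ l.length • ExteriorAlgebra.map (proj (bot_le : ⊥ ≤ σ)) x := by
  induction l with
  | nil => simp [vecProd, contrList]
  | cons i l ih =>
    obtain ⟨hi, hl⟩ := List.nodup_cons.1 hl
    rw [vecProd_cons, mul_assoc, contrList_cons, contr_ι_mul, form_vec_self, map_sub, map_smul,
      F.contrList_ι_mul hi, map_sub, map_smul, map_smul,
      map_mul (ExteriorAlgebra.map _), ExteriorAlgebra.map_apply_ι,
      F.proj_vec (Finset.mem_univ i) F.face_univ.le, map_zero, zero_mul, smul_zero, sub_zero, ih hl,
      smul_smul, List.length_cons, pow_succ']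

/-- The product of all the ray generators is a multiple of the orientation of `□^0_σ`. -/
theorem exists_vecProd_eq (o : Orientation Δ) (hbot : ⊥ ∈ Δ.cones) (hσ : σ ∈ Δ.cones) :
    ∃ c : ℤ, F.vecProd (List.finRange F.n) = c • o.ν ⊥ σ := by
  have h1 := F.vecProd_mem (List.finRange F.n)
  rw [List.length_finRange, ← o.span_eq hbot hσ bot_le (by rw [coneDim_bot, zero_add, F.coneDim_eq]),
    Submodule.mem_span_singleton] at h1
  obtain ⟨c, hc⟩ := h1
  exact ⟨c, hc.symm⟩

end Frame

variable [Module.Finite ℤ N]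

/-- The linear map `⋀ N^σ → ⋀ N^0` sending `x` to `ν ∧ x'`, where `ν` is the orientation of the
cube `□^0_σ` and `x'` is any lift of `x`. -/
def cap (o : Orientation Δ) (σ : Cone N) :
    ExteriorAlgebra ℤ (QuotLattice σ) →ₗ[ℤ] ExteriorAlgebra ℤ (QuotLattice (⊥ : Cone N)) :=
  LinearMap.mulLeft ℤ (o.ν ⊥ σ) ∘ₗ (ExteriorAlgebra.map (projSection bot_le)).toLinearMap

variable [Module.Free ℤ N] (o : Orientation Δ)

/-- The map `cap` does not depend on the chosen lifts. -/
theorem cap_map (hbot : ⊥ ∈ Δ.cones) {σ : Cone N} (hσ : σ ∈ Δ.cones)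
    (y : ExteriorAlgebra ℤ (QuotLattice (⊥ : Cone N))) :
    cap o σ (ExteriorAlgebra.map (proj bot_le) y) = o.ν ⊥ σ * y := by
  rw [cap, LinearMap.comp_apply, LinearMap.mulLeft_apply, AlgHom.toLinearMap_apply,
    ← AlgHom.comp_apply, ExteriorAlgebra.map_comp_map]
  exact mul_map_eq (o.ν_bot_mem hbot hσ) _
    (fun v => o.ι_mul_ν hbot hσ bot_le (sub_projSection_mem bot_le v)) y

theorem cap_mem (hbot : ⊥ ∈ Δ.cones) {σ : Cone N} (hσ : σ ∈ Δ.cones) {k l : ℤ}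
    (hl : k = l - coneDim σ) {x : ExteriorAlgebra ℤ (QuotLattice σ)}
    (hx : x ∈ multiTangent Δ k σ σ) : cap o σ x ∈ multiTangent Δ l ⊥ σ := by
  obtain ⟨y, hy, rfl⟩ := exists_map_eq bot_le hx
  rw [cap_map o hbot hσ]
  have := mul_mem_multiTangent (by positivity) (o.ν_bot_mem hbot hσ) hy
  rwa [hl, add_sub_cancel] at this

namespace Frame

variable {σ : Cone N} (F : Frame σ) {u : Rˣ} {k l : ℤ}

/-- A form annihilated by capping has no component in all the ray directions at once. -/
theorem prod_idem_eq_zero_of_cap (hbot : ⊥ ∈ Δ.cones) (hσ : σ ∈ Δ.cones) (hl : k = l - coneDim σ)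
    (α : MultiCotangent Δ R l ⊥ σ)
    (hα : ∀ x ∈ multiTangent Δ k σ σ, eval α (cap o σ x) = 0) :
    ((List.finRange F.n).map (F.idem Δ u l)).prod α = 0 := by
  obtain ⟨c, hc⟩ := F.exists_vecProd_eq o hbot hσ
  refine F.prod_idem_eq_zero (List.nodup_finRange _) α fun y hy => ?_
  rw [List.length_finRange, ← F.coneDim_eq, ← hl] at hy
  have h1 := map_mem_multiTangent Δ k (bot_le : ⊥ ≤ σ) le_rfl hy
  have h2 := cap_mem o hbot hσ hl h1
  have h3 := hα _ h1
  rw [cap_map o hbot hσ] at h2 h3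
  rw [hc, smul_mul_assoc, eval_smul α c h2, h3, mul_zero]

/-- Every form on `F_k(∞_σ)` is obtained by capping a form on `F_l(□^0_σ)`. -/
theorem exists_eval_cap (hu : (u : R) = F.m) (hbot : ⊥ ∈ Δ.cones) (hσ : σ ∈ Δ.cones)
    (hl : k = l - coneDim σ) (β : MultiCotangent Δ R k σ σ) :
    ∃ α : MultiCotangent Δ R l ⊥ σ, ∀ x ∈ multiTangent Δ k σ σ, eval α (cap o σ x) = eval β x := by
  obtain ⟨c, hc⟩ := F.exists_vecProd_eq o hbot hσ
  set r := List.finRange F.n with hr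
  have hlen : r.length = F.n := List.length_finRange
  have hmem : ∀ x ∈ multiTangent Δ l ⊥ σ,
      ((ExteriorAlgebra.map (proj (bot_le : ⊥ ≤ σ))).toLinearMap ∘ₗ F.contrList r) x ∈
        multiTangent Δ k σ σ := by
    intro x hx
    have := F.contrList_mem r hx
    rw [hlen, ← F.coneDim_eq, ← hl] at this
    exact map_mem_multiTangent Δ k bot_le le_rfl this
  -- contraction with all the `f_i` inverts the product with `∏ e_i = c ν`, up to `m ^ n`
  refine ⟨((u⁻¹ ^ F.n : Rˣ).1 * (c : R)) • transpose R (LinearMap.restrict _ hmem) β,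
    fun x hx => ?_⟩
  obtain ⟨y, hy, rfl⟩ := exists_map_eq bot_le hx
  have h1 := cap_mem o hbot hσ hl hx
  rw [eval_of_mem _ h1]
  change ((u⁻¹ ^ F.n : Rˣ).1 * (c : R)) * β ⟨_, hmem _ h1⟩ = _
  rw [← eval_of_mem β, mul_assoc, ← eval_smul β c (hmem _ h1), ← map_smul, cap_map o hbot hσ,
    ← smul_mul_assoc, ← hc, LinearMap.comp_apply, AlgHom.toLinearMap_apply,
    F.map_contrList_vecProd_mul (List.nodup_finRange _), eval_smul β _ hx, ← mul_assoc, hlen,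
    Int.cast_pow, ← hu, ← Units.val_pow_eq_pow_val, ← Units.val_mul, ← mul_pow, inv_mul_cancel,
    one_pow, Units.val_one, one_mul]

end Frame

end Cap

/-! ### Exactness of the rows -/

section Rows

variable {N : Type*} [AddCommGroup N] [Module.Finite ℤ N]
  {Δ : RationalFan N} {R : Type*} [CommRing R] (o : Orientation Δ)

namespace Frame

variable {σ : Cone N} (F : Frame σ) {u : Rˣ} {p q : ℕ}

/-- The part of the tropical differential changing the sedentarity is that of a cube complex, in
terms of the forms on the largest face `□^0_σ`. -/
theorem pull_sum_incChange (hσ : σ ∈ Δ.cones) (S : Finset (Fin F.n))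
    (z : ∀ τ : Cone N, MultiCotangent Δ R p τ σ) :
    pull Δ R p ⊥ (F.face S) σ σ (∑ η : Δ.cones,
      (incChange o (F.face S) η σ : R) • pull Δ R p (F.face S) η σ σ (z η)) =
    ∑ j ∈ Sᶜ, incChange o (F.face S) (F.face (insert j S)) σ •
      pull Δ R p ⊥ (F.face (insert j S)) σ σ (z (F.face (insert j S))) := by
  rw [map_sum]
  symm
  refine Finset.sum_of_injOn (fun j => (⟨F.face (insert j S), F.face_mem hσ _⟩ : Δ.cones))
    ?_ (fun _ _ => Finset.mem_univ _) ?_ ?_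
  · intro i hi j _ hij
    have h1 := F.face_injective (Subtype.ext_iff.1 hij)
    have h2 : i ∈ insert j S := h1 ▸ Finset.mem_insert_self i S
    exact (Finset.mem_insert.1 h2).resolve_right (Finset.mem_compl.1 hi)
  · intro η _ hη
    have h0 : incChange o (F.face S) η.1 σ = 0 := by
      by_contra h
      obtain ⟨h1, h2, h3⟩ := incChange_ne_zero o h
      obtain ⟨T, hT⟩ := F.exists_face_eq_of_le hσ η.2 h2
      rw [← hT, F.face_le_face] at h1
      rw [← hT, coneDim_face, coneDim_face] at h3
      obtain ⟨j, hj, rfl⟩ := (Finset.exists_eq_insert_iff).2 ⟨h1, h3.symm⟩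
      exact hη ⟨j, by simpa using hj, Subtype.ext hT⟩
    rw [map_smul, h0, Int.cast_zero, zero_smul]
  · intro j _
    have h1 : F.face S ≤ F.face (insert j S) := F.face_le_face.2 (Finset.subset_insert _ _)
    rw [map_smul, pull_pull bot_le h1 le_rfl le_rfl, Int.cast_smul_eq_zsmul]

theorem incChange_face (S : Finset (Fin F.n)) {j : Fin F.n} (hj : j ∉ S) {T : Finset (Fin F.n)}
    (hT : T = insert j S) (h : F.face S ≤ F.face T) :
    incChange o (F.face S) (F.face T) σ = signChange o h σ := by
  refine dif_pos ⟨h, F.face_le _, ?_⟩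
  rw [hT, coneDim_face, coneDim_face, Finset.card_insert_of_notMem hj]

/-- A family of forms on the faces `□^τ_σ` annihilated by the idempotents of the directions of `τ`
descends to these faces. -/
theorem exists_family (hu : (u : R) = F.m) (hσ : σ ∈ Δ.cones)
    (b : Finset (Fin F.n) → MultiCotangent Δ R p ⊥ σ)
    (hb : ∀ S, ∀ j ∈ S, F.idem Δ u p j (b S) = 0) :
    ∃ y : ∀ τ : Cone N, MultiCotangent Δ R p τ σ,
      (∀ τ, ¬(τ ∈ Δ.cones ∧ τ ≤ σ) → y τ = 0) ∧
      ∀ S, pull Δ R p ⊥ (F.face S) σ σ (y (F.face S)) = b S := by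
  classical
  have key : ∀ τ : Cone N, ∃ β : MultiCotangent Δ R p τ σ, (¬(τ ∈ Δ.cones ∧ τ ≤ σ) → β = 0) ∧
      ∀ S, F.face S = τ → pull Δ R p ⊥ τ σ σ β = b S := by
    intro τ
    by_cases h : τ ∈ Δ.cones ∧ τ ≤ σ
    · obtain ⟨S, rfl⟩ := F.exists_face_eq_of_le hσ h.1 h.2
      obtain ⟨β, hβ⟩ := F.exists_pull_of_idem hu (b S) (hb S)
      refine ⟨β, fun h' => absurd h h', fun T hT => ?_⟩
      rw [F.face_injective hT, hβ]
    · refine ⟨0, fun _ => rfl, fun S hS => absurd ?_ h⟩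
      rw [← hS]
      exact ⟨F.face_mem hσ S, F.face_le S⟩
  choose y hy using key
  exact ⟨y, fun τ => (hy τ).1, fun S => (hy _).2 S rfl⟩

variable [Module.Free ℤ N]

theorem incChange_mul_self (hσ : σ ∈ Δ.cones) (S : Finset (Fin F.n)) (j : Fin F.n) (hj : j ∉ S) :
    incChange o (F.face S) (F.face (insert j S)) σ *
      incChange o (F.face S) (F.face (insert j S)) σ = 1 := by
  rw [F.incChange_face o S hj rfl (F.face_le_face.2 (Finset.subset_insert _ _))]
  refine (signChange_spec o (F.face_mem hσ _) (F.face_mem hσ _) hσ _ (F.face_le _) ?_).1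
  rw [coneDim_face, coneDim_face, Finset.card_insert_of_notMem hj]

theorem incChange_mul_incChange (hσ : σ ∈ Δ.cones) (S : Finset (Fin F.n)) (i j : Fin F.n)
    (hi : i ∉ S) (hj : j ∉ S) (hij : i ≠ j) :
    incChange o (F.face S) (F.face (insert i S)) σ *
      incChange o (F.face (insert i S)) (F.face (insert j (insert i S))) σ =
    -(incChange o (F.face S) (F.face (insert j S)) σ *
      incChange o (F.face (insert j S)) (F.face (insert i (insert j S))) σ) := by
  have hT : insert i (insert j S) = insert j (insert i S) := Finset.insert_comm _ _ _
  have hji : j ∉ insert i S := by simp [hj, hij.symm]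
  have hij' : i ∉ insert j S := by simp [hi, hij]
  have h1 : F.face S ≤ F.face (insert i S) := F.face_le_face.2 (Finset.subset_insert _ _)
  have h2 : F.face S ≤ F.face (insert j S) := F.face_le_face.2 (Finset.subset_insert _ _)
  have h3 : F.face (insert i S) ≤ F.face (insert j (insert i S)) :=
    F.face_le_face.2 (Finset.subset_insert _ _)
  have h4 : F.face (insert j S) ≤ F.face (insert j (insert i S)) :=
    F.face_le_face.2 (hT ▸ Finset.subset_insert _ _)
  rw [hT, F.incChange_face o S hi rfl h1, F.incChange_face o S hj rfl h2,
    F.incChange_face o _ hji rfl h3, F.incChange_face o _ hij' hT.symm h4]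
  refine signChange_mul_signChange o (F.face_mem hσ _) (F.face_mem hσ _) (F.face_mem hσ _)
    (F.face_mem hσ _) hσ h1 h3 h2 h4 (F.face_le _) ?_ ?_ ?_ (F.normalRel hσ hi hj hij)
  · rw [coneDim_face, coneDim_face, Finset.card_insert_of_notMem hi]
  · rw [coneDim_face, coneDim_face, Finset.card_insert_of_notMem hj]
  · rw [coneDim_face, coneDim_face, Finset.card_insert_of_notMem hji,
      Finset.card_insert_of_notMem hi]

/-- Exactness of the complex of the faces `□^τ_σ` with `σ` fixed, apart from the cube `□^0_σ`,
where the forms have to vanish on the multivectors divisible by the orientation. -/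
theorem row_exact (hu : (u : R) = F.m) (hσ : σ ∈ Δ.cones)
    (x : ∀ τ : Cone N, MultiCotangent Δ R p τ σ)
    (hcl : ∀ τ ∈ Δ.cones, τ ≤ σ → coneDim σ = coneDim τ + (q + 1) →
      ∑ η : Δ.cones, (incChange o τ η σ : R) • pull Δ R p τ η σ σ (x η) = 0)
    (hcap : coneDim σ = q → ∀ w ∈ multiTangent Δ ((p : ℤ) - q) σ σ, eval (x ⊥) (cap o σ w) = 0) :
    ∃ y : ∀ τ : Cone N, MultiCotangent Δ R p τ σ,
      (∀ τ, ¬(τ ∈ Δ.cones ∧ τ ≤ σ ∧ coneDim σ + 1 = coneDim τ + q) → y τ = 0) ∧ y ⊥ = 0 ∧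
      ∀ τ ∈ Δ.cones, τ ≤ σ → coneDim σ = coneDim τ + q →
        ∑ η : Δ.cones, (incChange o τ η σ : R) • pull Δ R p τ η σ σ (y η) = x τ := by
  classical
  have hbot : (⊥ : Cone N) ∈ Δ.cones := F.face_empty ▸ F.face_mem hσ ∅
  have hdim := F.coneDim_eq
  rcases lt_or_ge F.n q with hq | hq
  · exact ⟨fun _ => 0, fun _ _ => rfl, rfl, fun τ _ _ h => absurd h (by omega)⟩
  obtain ⟨k, hk⟩ := Nat.exists_eq_add_of_le hq
  -- the faces `□^τ_σ` of dimension `q` are those with `dim τ = k`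
  let a : Finset (Fin F.n) → MultiCotangent Δ R p ⊥ σ := fun S =>
    if S.card = k then pull Δ R p ⊥ (F.face S) σ σ (x (F.face S)) else 0
  have ha' : ∀ S : Finset (Fin F.n), S.card = k →
      a S = pull Δ R p ⊥ (F.face S) σ σ (x (F.face S)) := fun S hS => if_pos hS
  obtain ⟨b, hb1, hb2, hb3⟩ := cube_exact (P := F.idem Δ u p) (k := k) (a := a)
    (ε := fun S j => incChange o (F.face S) (F.face (insert j S)) σ) (l := List.finRange F.n)
    (F.idem_idem hu) F.idem_comm (F.incChange_mul_self o hσ) (F.incChange_mul_incChange o hσ)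
    (by
      intro S i hi
      by_cases hS : S.card = k
      · rw [ha' S hS]
        exact F.idem_pull hi rfl _
      · rw [show a S = 0 from if_neg hS, map_zero])
    (by
      intro S hS
      have h1 := F.pull_sum_incChange o hσ S x
      rw [hcl _ (F.face_mem hσ S) (F.face_le S) (by rw [coneDim_face]; omega), map_zero] at h1
      refine Eq.trans (Finset.sum_congr rfl fun j hj => ?_) h1.symm
      rw [ha' _ (by rw [Finset.card_insert_of_notMem (Finset.mem_compl.1 hj), hS])])
    (List.mem_finRange)
    (by
      by_cases h0 : k = 0
      · have hq' : coneDim σ = q := by omega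
        refine F.prod_idem_eq_zero_of_cap o hbot hσ (k := (p : ℤ) - q) (by rw [hq']) _
          fun w hw => ?_
        have h1 := hcap hq' w hw
        have h2 := cap_mem o hbot hσ (l := (p : ℤ)) (by rw [hq']) hw
        obtain ⟨τ, hτ⟩ : ∃ τ, τ = F.face ∅ := ⟨_, rfl⟩
        rw [ha' ∅ (by rw [h0]; rfl), ← hτ]
        obtain rfl : τ = ⊥ := hτ.trans F.face_empty
        rw [pull_refl, h1]
      · rw [show a ∅ = 0 from if_neg (fun h => h0 h.symm), map_zero])
  obtain ⟨y, hy1, hy2⟩ := F.exists_family hu hσ b hb2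
  have hy3 : ∀ τ, ¬(τ ∈ Δ.cones ∧ τ ≤ σ ∧ coneDim σ + 1 = coneDim τ + q) → y τ = 0 := by
    intro τ hτ
    by_cases h : τ ∈ Δ.cones ∧ τ ≤ σ
    · obtain ⟨S, rfl⟩ := F.exists_face_eq_of_le hσ h.1 h.2
      refine pull_injective σ bot_le ?_
      rw [hy2, map_zero, hb1]
      intro hS
      exact hτ ⟨h.1, h.2, by rw [coneDim_face]; omega⟩
    · exact hy1 τ h
  refine ⟨y, hy3, hy3 ⊥ ?_, fun τ hτ hτσ hd => ?_⟩
  · rw [coneDim_bot]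
    omega
  · obtain ⟨S, rfl⟩ := F.exists_face_eq_of_le hσ hτ hτσ
    have hS : S.card = k := by rw [coneDim_face] at hd; omega
    refine pull_injective σ bot_le ((F.pull_sum_incChange o hσ S y).trans ?_)
    rw [← ha' S hS, ← hb3 S hS]
    exact Finset.sum_congr rfl fun j _ => by rw [hy2]

end Frame

end Rows

/-! ### Comparison of the two complexes -/

section Comparison

variable {N : Type*} [AddCommGroup N] {Δ : RationalFan N} {R : Type*} [CommRing R]

theorem eval_pull {k : ℤ} {τ' τ σ' σ : Cone N} (h : τ' ≤ τ) (h' : σ' ≤ σ)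
    (β : MultiCotangent Δ R k τ σ') {w : ExteriorAlgebra ℤ (QuotLattice τ')}
    (hw : w ∈ multiTangent Δ k τ' σ) :
    eval (pull Δ R k τ' τ σ' σ β) w = eval β (ExteriorAlgebra.map (proj h) w) := by
  rw [eval_of_mem _ hw, pull_apply h h', eval_of_mem _ (map_mem_multiTangent Δ k h h' hw)]
  rfl

theorem eval_add_left {k : ℤ} {τ σ : Cone N} (α β : MultiCotangent Δ R k τ σ)
    (x : ExteriorAlgebra ℤ (QuotLattice τ)) : eval (α + β) x = eval α x + eval β x := by
  by_cases h : x ∈ multiTangent Δ k τ σ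
  · rw [eval_of_mem _ h, eval_of_mem _ h, eval_of_mem _ h]
    rfl
  · rw [eval, eval, eval, dif_neg h, dif_neg h, dif_neg h, add_zero]

theorem eval_sum_smul {I : Type*} [Fintype I] {k : ℤ} {τ σ : Cone N} (c : I → R)
    (α : I → MultiCotangent Δ R k τ σ) {x : ExteriorAlgebra ℤ (QuotLattice τ)}
    (hx : x ∈ multiTangent Δ k τ σ) :
    eval (∑ i, c i • α i) x = ∑ i, c i * eval (α i) x := by
  rw [eval_of_mem _ hx]
  refine (LinearMap.sum_apply _ _ _).trans (Finset.sum_congr rfl fun i _ => ?_)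
  rw [eval_of_mem _ hx]
  rfl

variable [Module.Finite ℤ N] [Module.Free ℤ N] (o : Orientation Δ) {p q : ℕ}

/-- The comparison map from the tropical to the cubical complex: it caps the forms on the cubes
`□^0_σ` with the orientations of these cubes. -/
def capMap (hbot : ∀ σ ∈ Δ.cones, (⊥ : Cone N) ∈ Δ.cones) (R : Type*) [CommRing R] (p q : ℕ) :
    TropicalCochain Δ R p q →ₗ[R] CubicalCochain Δ R p q :=
  LinearMap.pi fun σ =>
    transpose R ((cap o σ.1).restrict (p := multiTangent Δ ((p : ℤ) - q) σ.1 σ.1)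
      (q := multiTangent Δ p ⊥ σ.1)
      fun _ hx => cap_mem o (hbot _ σ.2.1) σ.2.1 (by rw [σ.2.2]) hx) ∘ₗ
    LinearMap.proj (⟨(⊥, σ.1), hbot _ σ.2.1, σ.2.1, bot_le,
      by rw [coneDim_bot, zero_add, σ.2.2]⟩ : Δ.Face q)

variable {hbot : ∀ σ ∈ Δ.cones, (⊥ : Cone N) ∈ Δ.cones}

theorem eval_capMap (α : TropicalCochain Δ R p q) (σ : Δ.conesOfDim q)
    {x : ExteriorAlgebra ℤ (QuotLattice σ.1)} (hx : x ∈ multiTangent Δ ((p : ℤ) - q) σ.1 σ.1) :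
    eval (capMap o hbot R p q α σ) x = eval (component α ⊥ σ.1) (cap o σ.1 x) := by
  have hf : (⊥ : Cone N) ∈ Δ.cones ∧ σ.1 ∈ Δ.cones ∧ ⊥ ≤ σ.1 ∧
      coneDim σ.1 = coneDim (⊥ : Cone N) + q :=
    ⟨hbot _ σ.2.1, σ.2.1, bot_le, by rw [coneDim_bot, zero_add, σ.2.2]⟩
  rw [eval_of_mem _ hx, component_of_face α hf,
    eval_of_mem _ (cap_mem o hf.1 hf.2.1 (l := (p : ℤ)) (by rw [σ.2.2]) hx)]
  rfl

/-- Capping a form with the orientation of `□^0_σ` amounts to wedging with the unit normal vector to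
`τ` and capping with the orientation of `□^0_τ`, up to the sign of moving a vector past
`ν^0_τ`. -/
theorem incSame_mul_eval_pull (hb : (⊥ : Cone N) ∈ Δ.cones) (τ : Δ.conesOfDim q)
    (σ : Δ.conesOfDim (q + 1)) (α : MultiCotangent Δ R p ⊥ τ.1)
    {x : ExteriorAlgebra ℤ (QuotLattice σ.1)}
    (hx : x ∈ multiTangent Δ ((p : ℤ) - ((q + 1 : ℕ) : ℤ)) σ.1 σ.1) :
    (incSame o ⊥ τ.1 σ.1 : R) * eval (pull Δ R p ⊥ ⊥ τ.1 σ.1 α) (cap o σ.1 x) =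
      (-1) ^ q * eval α (cap o τ.1 (wedge τ.1 σ.1 x)) := by
  by_cases h : τ.1 ≤ σ.1
  · have hd : coneDim σ.1 = coneDim τ.1 + 1 := by rw [σ.2.2, τ.2.2]
    have hs : incSame o ⊥ τ.1 σ.1 = signSame o ⊥ τ.1 σ.1 := if_pos ⟨bot_le, h, hd⟩
    have hc := cap_mem o hb σ.2.1 (l := (p : ℤ)) (by rw [σ.2.2]) hx
    have hw := cap_mem o hb τ.2.1 (l := (p : ℤ)) (by rw [τ.2.2])
      (wedge_mem (τ := τ.1) (l := (p : ℤ) - q) (by push_cast; ring) hx)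
    have hc' := map_mem_multiTangent Δ p (le_refl ⊥) h hc
    rw [eval_pull le_rfl h α hc, map_proj_refl, hs]
    rw [map_proj_refl] at hc'
    rw [← eval_smul α _ hc']
    have h1 : (-1 : R) ^ q = ((-1 : ℤ) ^ q : ℤ) := by push_cast; rfl
    rw [h1, ← eval_smul α _ hw]
    congr 1
    obtain ⟨y, -, rfl⟩ := exists_map_eq bot_le hx
    rw [wedge_of_le h, ← map_proj_map_proj (bot_le : ⊥ ≤ τ.1) h,
      wedgeNormal_map_proj τ.2.1 σ.2.1 h hd, map_proj_map_proj, cap_map o hb σ.2.1,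
      ← smul_mul_assoc, ← (signSame_spec o hb τ.2.1 σ.2.1 bot_le h hd).2]
    have h2 : ExteriorAlgebra.ι ℤ ((coneLattice τ.1).mkQ (unitNormal τ.1 σ.1)) *
        ExteriorAlgebra.map (proj (bot_le : ⊥ ≤ τ.1)) y =
        ExteriorAlgebra.map (proj (bot_le : ⊥ ≤ τ.1))
          (ExteriorAlgebra.ι ℤ ((coneLattice ⊥).mkQ (unitNormal τ.1 σ.1)) * y) := by
      rw [map_mul, ExteriorAlgebra.map_apply_ι, proj_mkQ]
    have hν := o.ν_bot_mem hb τ.2.1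
    rw [τ.2.2] at hν
    rw [h2, cap_map o hb τ.2.1, ← mul_assoc, extPow_mul_ι hν, smul_mul_assoc, smul_smul,
      ← mul_pow, neg_mul_neg, one_mul, one_pow, one_smul]
  · have h1 : incSame o ⊥ τ.1 σ.1 = 0 := if_neg fun h' => h h'.2.1
    rw [h1, Int.cast_zero, zero_mul, show wedge τ.1 σ.1 = 0 from dif_neg h, LinearMap.zero_apply,
      map_zero, eval_zero, mul_zero]

/-- The forms coming from faces of larger sedentarity are annihilated by capping. -/
theorem incChange_mul_eval_pull (hb : (⊥ : Cone N) ∈ Δ.cones) (η : Δ.cones)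
    (σ : Δ.conesOfDim (q + 1)) (α : MultiCotangent Δ R p η.1 σ.1)
    {x : ExteriorAlgebra ℤ (QuotLattice σ.1)}
    (hx : x ∈ multiTangent Δ ((p : ℤ) - ((q + 1 : ℕ) : ℤ)) σ.1 σ.1) :
    (incChange o ⊥ η σ.1 : R) * eval (pull Δ R p ⊥ η σ.1 σ.1 α) (cap o σ.1 x) = 0 := by
  by_cases h : incChange o ⊥ η.1 σ.1 = 0
  · rw [h, Int.cast_zero, zero_mul]
  · obtain ⟨-, h1, h2⟩ := incChange_ne_zero o h
    have hc := cap_mem o hb σ.2.1 (l := (p : ℤ)) (by rw [σ.2.2]) hx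
    have h3 : ExteriorAlgebra.map (proj (bot_le : ⊥ ≤ η.1)) (o.ν ⊥ σ.1) = 0 := by
      have h4 := map_extPow_le (proj (bot_le : ⊥ ≤ η.1)) _ _
        (Submodule.mem_map_of_mem (o.ν_bot_mem hb σ.2.1))
      rw [relLattice_map_proj, extPow_relLattice_eq_bot η.2 σ.2.1 h1
        (by rw [h2, coneDim_bot]; omega)] at h4
      exact (Submodule.mem_bot _).1 h4
    obtain ⟨y, -, rfl⟩ := exists_map_eq bot_le hx
    rw [eval_pull bot_le le_rfl α hc, cap_map o hb σ.2.1, map_mul, h3, zero_mul, eval_zero,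
      mul_zero]

/-- The comparison map commutes with the differentials up to sign: the part of the tropical
differential changing the sedentarity disappears, as the orientation of `□^0_σ` vanishes in the
quotients `N^η`. -/
theorem capMap_tropicalDiff (α : TropicalCochain Δ R p q) :
    capMap o hbot R p (q + 1) (tropicalDiff o R p q α) =
      ((-1) ^ q : ℤˣ) • cubicalDiff Δ R p q (capMap o hbot R p q α) := by
  refine funext fun σ => eval_ext fun x hx => ?_
  have hb := hbot _ σ.2.1
  have hc := cap_mem o hb σ.2.1 (l := (p : ℤ)) (by rw [σ.2.2]) hx
  have h1 : eval ((((-1) ^ q : ℤˣ) • cubicalDiff Δ R p q (capMap o hbot R p q α)) σ) x =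
      (-1) ^ q * eval (cubicalDiff Δ R p q (capMap o hbot R p q α) σ) x := by
    rw [eval_of_mem _ hx, eval_of_mem _ hx]
    refine (zsmul_eq_mul _ _).trans ?_
    congr 1
    simp
  refine ((eval_capMap o (tropicalDiff o R p q α) σ hx).trans ?_).trans h1.symm
  refine ((congrArg (fun β => eval β (cap o σ.1 x)) (component_tropicalDiff o α
    ⟨hb, σ.2.1, bot_le, by rw [coneDim_bot, zero_add, σ.2.2]⟩)).trans
    (eval_add_left _ _ _)).trans ?_
  rw [eval_sum_smul _ _ hc, eval_sum_smul _ _ hc,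
    Finset.sum_eq_zero fun η _ => incChange_mul_eval_pull o hb η σ _ hx, add_zero,
    cubicalDiff_apply _ σ hx, Finset.mul_sum]
  symm
  refine Finset.sum_of_injOn (fun τ : Δ.conesOfDim q => (⟨τ.1, τ.2.1⟩ : Δ.cones)) ?_
    (fun _ _ => Finset.mem_univ _) ?_ ?_
  · intro τ _ τ' _ h
    exact Subtype.ext (Subtype.ext_iff.1 h :)
  · intro η _ hη
    have h0 : incSame o ⊥ η.1 σ.1 = 0 := by
      by_contra h
      obtain ⟨-, -, h3⟩ := incSame_ne_zero o h
      rw [σ.2.2] at h3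
      exact hη ⟨⟨η.1, η.2, by omega⟩, Finset.mem_coe.2 (Finset.mem_univ _), rfl⟩
    rw [h0, Int.cast_zero, zero_mul]
  · intro τ _
    rw [eval_capMap o α τ (wedge_mem (by push_cast; ring) hx)]
    exact (incSame_mul_eval_pull o hb τ σ _ hx).symm

theorem capMap_surjective (hΔ : HasFrames Δ R) : Function.Surjective (capMap o hbot R p q) := by
  classical
  intro β
  have key : ∀ σ : Cone N, ∃ A : ∀ τ : Cone N, MultiCotangent Δ R p τ σ,
      ∀ h : σ ∈ Δ.cones ∧ coneDim σ = q, ∀ x ∈ multiTangent Δ ((p : ℤ) - q) σ σ,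
        eval (A ⊥) (cap o σ x) = eval (β ⟨σ, h⟩) x := by
    intro σ
    by_cases h : σ ∈ Δ.cones ∧ coneDim σ = q
    · obtain ⟨F, u, hu⟩ := hΔ σ h.1
      obtain ⟨α, hα⟩ := F.exists_eval_cap o hu (hbot _ h.1) h.1 (l := p) (by rw [h.2]) (β ⟨σ, h⟩)
      refine ⟨Function.update (fun _ => 0) ⊥ α, fun _ x hx => ?_⟩
      rw [Function.update_self]
      exact hα x hx
    · exact ⟨fun _ => 0, fun h' => absurd h' h⟩
  choose A hA using key
  refine ⟨fun δ => A δ.1.2 δ.1.1, funext fun σ => eval_ext fun x hx => ?_⟩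
  rw [eval_capMap o _ σ hx, component_of_face _
    ⟨hbot _ σ.2.1, σ.2.1, bot_le, by rw [coneDim_bot, zero_add, σ.2.2]⟩]
  exact hA σ.1 σ.2 x hx

end Comparison

/-! ### Exactness of the kernel of the comparison map -/

section Kernel

variable {N : Type*} [AddCommGroup N] {Δ : RationalFan N} {R : Type*} [CommRing R]
  (o : Orientation Δ) {p q : ℕ}

theorem component_sub (α β : TropicalCochain Δ R p q) (τ σ : Cone N) :
    component (α - β) τ σ = component α τ σ - component β τ σ := by
  by_cases h : τ ∈ Δ.cones ∧ σ ∈ Δ.cones ∧ τ ≤ σ ∧ coneDim σ = coneDim τ + q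
  · rw [component_of_face _ h, component_of_face _ h, component_of_face _ h]
    rfl
  · rw [component_of_not _ h, component_of_not _ h, component_of_not _ h, sub_zero]

theorem tropicalCochain_eq_zero {α : TropicalCochain Δ R p q}
    (h : ∀ τ σ : Cone N, component α τ σ = 0) : α = 0 :=
  funext fun δ => (component_face α δ).symm.trans (h _ _)

/-- The part of the tropical differential with constant sedentarity only involves cones of smaller
dimension. -/
theorem sum_incSame_eq_zero {s : ℕ} (α : TropicalCochain Δ R p q) {τ σ : Cone N}
    (hα : ∀ τ' σ' : Cone N, coneDim σ' < s → component α τ' σ' = 0) (hσ : coneDim σ ≤ s) :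
    ∑ η : Δ.cones, (incSame o τ η σ : R) • pull Δ R p τ τ η σ (component α τ η) = 0 := by
  refine Finset.sum_eq_zero fun η _ => ?_
  by_cases h : incSame o τ η σ = 0
  · rw [h, Int.cast_zero, zero_smul]
  · obtain ⟨-, -, h1⟩ := incSame_ne_zero o h
    rw [hα τ η (by omega), map_zero, smul_zero]

variable [Module.Finite ℤ N]

theorem coneDim_lt (σ : Cone N) : coneDim σ < Module.finrank ℝ (ℝ ⊗[ℤ] N) + 1 :=
  Nat.lt_succ_of_le (Submodule.finrank_le _)

variable [Module.Free ℤ N] {hbot : ∀ σ ∈ Δ.cones, (⊥ : Cone N) ∈ Δ.cones}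

/-- The rows of a cocycle in the kernel of the comparison map that starts in dimension `s` are
exact in dimension `s`. -/
theorem exists_row (hΔ : HasFrames Δ R) {s : ℕ} (x : TropicalCochain Δ R p q)
    (hd : tropicalDiff o R p q x = 0) (hx : capMap o hbot R p q x = 0)
    (hs : ∀ τ σ : Cone N, coneDim σ < s → component x τ σ = 0) {σ : Cone N} (hσ : σ ∈ Δ.cones)
    (hσs : coneDim σ = s) :
    ∃ y : ∀ τ : Cone N, MultiCotangent Δ R p τ σ,
      (∀ τ, ¬(τ ∈ Δ.cones ∧ τ ≤ σ ∧ coneDim σ + 1 = coneDim τ + q) → y τ = 0) ∧ y ⊥ = 0 ∧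
      ∀ τ ∈ Δ.cones, τ ≤ σ → coneDim σ = coneDim τ + q →
        ∑ η : Δ.cones, (incChange o τ η σ : R) • pull Δ R p τ η σ σ (y η) = component x τ σ := by
  obtain ⟨F, u, hu⟩ := hΔ σ hσ
  refine F.row_exact o hu hσ (fun τ => component x τ σ) (fun τ hτ h hdim => ?_) fun hdim w hw => ?_
  · have h1 := component_tropicalDiff o x ⟨hτ, hσ, h, hdim⟩
    have h2 : component (tropicalDiff o R p q x) τ σ = 0 := by
      rw [component_of_face (q := q + 1) _ ⟨hτ, hσ, h, hdim⟩, hd]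
      rfl
    have h3 := sum_incSame_eq_zero o (τ := τ) x hs hσs.le
    exact (zero_add _).symm.trans ((congrArg (· + _) h3.symm).trans (h1.symm.trans h2))
  · have h1 := eval_capMap (hbot := hbot) o x ⟨σ, hσ, hdim⟩ hw
    rw [hx] at h1
    exact h1.symm.trans (eval_zero_left w)

/-- The kernel of the comparison map has no cocycles in degree zero: there the rows are injective,
as they have no terms of smaller degree. -/
theorem component_eq_zero_of_kernel_zero (hΔ : HasFrames Δ R) (x : TropicalCochain Δ R p 0)
    (hd : tropicalDiff o R p 0 x = 0) (hx : capMap o hbot R p 0 x = 0) (s : ℕ) (τ σ : Cone N)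
    (hσ : coneDim σ < s) : component x τ σ = 0 := by
  induction s generalizing τ σ with
  | zero => exact absurd hσ (Nat.not_lt_zero _)
  | succ s ih =>
    rcases Nat.lt_succ_iff_lt_or_eq.1 hσ with h | h
    · exact ih τ σ h
    by_cases hf : τ ∈ Δ.cones ∧ σ ∈ Δ.cones ∧ τ ≤ σ ∧ coneDim σ = coneDim τ + 0
    · obtain ⟨y, hy, -, hy'⟩ := exists_row o hΔ x hd hx ih hf.2.1 h
      rw [← hy' τ hf.1 hf.2.2.1 hf.2.2.2]
      refine Finset.sum_eq_zero fun η _ => ?_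
      rw [hy η, map_zero, smul_zero]
      rintro ⟨-, h1, h2⟩
      have := coneDim_mono h1
      omega
    · exact component_of_not x hf

/-- A cocycle in the kernel of the comparison map that starts in dimension `s` can be modified by
the coboundary of an element of the kernel so as to start in dimension `s + 1`. -/
theorem exists_preimage_row (hΔ : HasFrames Δ R) {s : ℕ} (x : TropicalCochain Δ R p (q + 1))
    (hd : tropicalDiff o R p (q + 1) x = 0) (hx : capMap o hbot R p (q + 1) x = 0)
    (hs : ∀ τ σ : Cone N, coneDim σ < s → component x τ σ = 0) :
    ∃ z : TropicalCochain Δ R p q, capMap o hbot R p q z = 0 ∧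
      ∀ τ σ : Cone N, coneDim σ < s + 1 → component (x - tropicalDiff o R p q z) τ σ = 0 := by
  classical
  have key : ∀ σ : Cone N, ∃ y : ∀ τ : Cone N, MultiCotangent Δ R p τ σ,
      (∀ τ, ¬(τ ∈ Δ.cones ∧ σ ∈ Δ.cones ∧ τ ≤ σ ∧ coneDim σ = coneDim τ + q) → y τ = 0) ∧
      (coneDim σ < s → ∀ τ, y τ = 0) ∧ y ⊥ = 0 ∧
      (coneDim σ = s → σ ∈ Δ.cones → ∀ τ ∈ Δ.cones, τ ≤ σ → coneDim σ = coneDim τ + (q + 1) →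
        ∑ η : Δ.cones, (incChange o τ η σ : R) • pull Δ R p τ η σ σ (y η) = component x τ σ) := by
    intro σ
    by_cases h : σ ∈ Δ.cones ∧ coneDim σ = s
    · obtain ⟨y, h1, h2, h3⟩ := exists_row o hΔ x hd hx hs h.1 h.2
      refine ⟨y, fun τ hτ => h1 τ fun h' => hτ ⟨h'.1, h.1, h'.2.1, by omega⟩,
        fun h' => absurd h' (by omega), h2, fun _ _ => h3⟩
    · exact ⟨fun _ => 0, fun _ _ => rfl, fun _ _ => rfl, rfl, fun h1 h2 => absurd ⟨h2, h1⟩ h⟩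
  choose y hy0 hy1 hy2 hy3 using key
  let z : TropicalCochain Δ R p q := fun δ => y δ.1.2 δ.1.1
  have hz : ∀ τ σ : Cone N, component z τ σ = y σ τ := by
    intro τ σ
    by_cases h : τ ∈ Δ.cones ∧ σ ∈ Δ.cones ∧ τ ≤ σ ∧ coneDim σ = coneDim τ + q
    · exact component_of_face z h
    · rw [component_of_not z h, hy0 σ τ h]
  refine ⟨z, funext fun σ => eval_ext fun w hw => ?_, fun τ σ hσ => ?_⟩
  · rw [eval_capMap o z σ hw, hz, hy2, eval_zero_left]
    exact (eval_zero_left w).symm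
  · by_cases hf : τ ∈ Δ.cones ∧ σ ∈ Δ.cones ∧ τ ≤ σ ∧ coneDim σ = coneDim τ + (q + 1)
    · have h1 := component_tropicalDiff o z hf
      have h2 := sum_incSame_eq_zero o (τ := τ) (σ := σ) (s := s) z
        (fun τ' σ' h => (hz τ' σ').trans (hy1 σ' h τ')) (by omega)
      have h3 : ∑ η : Δ.cones, (incChange o τ η σ : R) • pull Δ R p τ η σ σ (component z η σ) =
          component x τ σ := by
        rcases Nat.lt_succ_iff_lt_or_eq.1 hσ with h | h
        · rw [hs τ σ h]
          refine Finset.sum_eq_zero fun η _ => ?_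
          rw [hz, hy1 σ h, map_zero, smul_zero]
        · refine (Finset.sum_congr rfl fun η _ => ?_).trans (hy3 σ h hf.2.1 τ hf.1 hf.2.2.1 hf.2.2.2)
          rw [hz]
      have h4 := h1.trans ((congrArg₂ (· + ·) h2 h3).trans (zero_add _))
      exact (component_sub _ _ τ σ).trans ((congrArg (component x τ σ - ·) h4).trans (sub_self _))
    · exact component_of_not _ hf

/-- A cocycle in the kernel of the comparison map is, in any given range of dimensions, the
coboundary of an element of the kernel. -/
theorem exists_preimage_of_kernel (hΔ : HasFrames Δ R) (x : TropicalCochain Δ R p (q + 1))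
    (hd : tropicalDiff o R p (q + 1) x = 0) (hx : capMap o hbot R p (q + 1) x = 0) (s : ℕ) :
    ∃ y : TropicalCochain Δ R p q, capMap o hbot R p q y = 0 ∧
      ∀ τ σ : Cone N, coneDim σ < s → component (x - tropicalDiff o R p q y) τ σ = 0 := by
  induction s with
  | zero => exact ⟨0, map_zero _, fun _ _ h => absurd h (Nat.not_lt_zero _)⟩
  | succ s ih =>
    obtain ⟨y, hy, hs⟩ := ih
    have h1 : tropicalDiff o R p (q + 1) (x - tropicalDiff o R p q y) = 0 := by
      have h2 := LinearMap.congr_fun (tropicalDiff_comp_tropicalDiff o R p q fun σ hσ =>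
        ⟨(hΔ σ hσ).choose⟩) y
      exact (map_sub _ _ _).trans ((congrArg₂ (· - ·) hd h2).trans (sub_zero _))
    have h3 : capMap o hbot R p (q + 1) (x - tropicalDiff o R p q y) = 0 := by
      have h4 : capMap o hbot R p (q + 1) (tropicalDiff o R p q y) = 0 := by
        rw [capMap_tropicalDiff, hy, map_zero, smul_zero]
      exact (map_sub _ _ _).trans ((congrArg₂ (· - ·) hx h4).trans (sub_zero _))
    obtain ⟨z, hz, hz'⟩ := exists_preimage_row o hΔ _ h1 h3 hs
    refine ⟨y + z, ?_, ?_⟩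
    · rw [map_add, hy, hz, add_zero]
    · rwa [map_add, ← sub_sub]

/-- The comparison map induces isomorphisms in cohomology. -/
theorem nonempty_cohomology_equiv (hΔ : HasFrames Δ R) (p q : ℕ) :
    Nonempty (CubicalCohomology Δ R p q ≃ₗ[R] TropicalCohomology o R p q) := by
  have hbot : ∀ σ ∈ Δ.cones, (⊥ : Cone N) ∈ Δ.cones := fun σ hσ =>
    (hΔ σ hσ).choose.face_empty ▸ (hΔ σ hσ).choose.face_mem hσ ∅
  refine cohomology_equiv_of_surjective (capMap o hbot R p) (fun q => (-1) ^ q)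
    (fun q x => capMap_tropicalDiff o x)
    (fun q => tropicalDiff_comp_tropicalDiff o R p q fun σ hσ => ⟨(hΔ σ hσ).choose⟩)
    (fun q => capMap_surjective o hΔ) (fun x hd hx => ?_) (fun q x hd hx => ?_) q
  · exact tropicalCochain_eq_zero fun τ σ =>
      component_eq_zero_of_kernel_zero o hΔ x hd hx _ τ σ (coneDim_lt σ)
  · obtain ⟨y, hy, hy'⟩ := exists_preimage_of_kernel o hΔ x hd hx
      (Module.finrank ℝ (ℝ ⊗[ℤ] N) + 1)
    exact ⟨y, hy, (sub_eq_zero.1 (tropicalCochain_eq_zero fun τ σ => hy' τ σ (coneDim_lt σ))).symm⟩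

/-- The common form of both cases of the comparison theorem. -/
theorem complexes_and_cohomology_equiv (hΔ : HasFrames Δ R) (p : ℕ) :
    (∀ q, cubicalDiff Δ R p (q + 1) ∘ₗ cubicalDiff Δ R p q = 0) ∧
    (∀ q, tropicalDiff o R p (q + 1) ∘ₗ tropicalDiff o R p q = 0) ∧
    ∀ q, Nonempty (CubicalCohomology Δ R p q ≃ₗ[R] TropicalCohomology o R p q) :=
  ⟨fun q => cubicalDiff_comp_cubicalDiff R p q fun σ hσ => ⟨(hΔ σ hσ).choose⟩,
    fun q => tropicalDiff_comp_tropicalDiff o R p q fun σ hσ => ⟨(hΔ σ hσ).choose⟩,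
    nonempty_cohomology_equiv o hΔ p⟩

end Kernel

end TropicalFan

end

theorem theorem1p7 {N : Type*} [AddCommGroup N] [Module.Free ℤ N] [Module.Finite ℤ N]
    (Δ : TropicalFan.RationalFan N) (o : TropicalFan.Orientation Δ) :
    (Δ.IsUnimodular → ∀ p : ℕ,
      (∀ q, TropicalFan.cubicalDiff Δ ℤ p (q + 1) ∘ₗ TropicalFan.cubicalDiff Δ ℤ p q = 0) ∧
      (∀ q, TropicalFan.tropicalDiff o ℤ p (q + 1) ∘ₗ TropicalFan.tropicalDiff o ℤ p q = 0) ∧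
      ∀ q, Nonempty
        (TropicalFan.CubicalCohomology Δ ℤ p q ≃ₗ[ℤ] TropicalFan.TropicalCohomology o ℤ p q)) ∧
    (Δ.IsSimplicial → ∀ p : ℕ,
      (∀ q, TropicalFan.cubicalDiff Δ ℚ p (q + 1) ∘ₗ TropicalFan.cubicalDiff Δ ℚ p q = 0) ∧
      (∀ q, TropicalFan.tropicalDiff o ℚ p (q + 1) ∘ₗ TropicalFan.tropicalDiff o ℚ p q = 0) ∧
      ∀ q, Nonempty
        (TropicalFan.CubicalCohomology Δ ℚ p q ≃ₗ[ℚ] TropicalFan.TropicalCohomology o ℚ p q)) := by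
  exact ⟨fun h => TropicalFan.complexes_and_cohomology_equiv o h.hasFrames,
    fun h => TropicalFan.complexes_and_cohomology_equiv o h.hasFrames⟩
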